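/- An overpartition of $n$ is a partition of $n$ in which the last occurrence of each part size may be overlined. For an integer $k\ge 1$, a lower $k$-run overpartition is an overpartition such that, whenever a part $\overline{m}$ is overlined, there is an integer $j\ge 0$ with $j+1\le m\le j+k$ such that the overlined parts $\overline{j+1},\overline{j+2},\dots,\overline{j+k}$ all appear (possibly together with non-overlined parts of the same sizes), no part of size $j$ (overlined or not) appears, and no overlined part $\overline{j+k+1}$ appears. Let $\overline{p}_k(n)$ denote the number of lower $k$-run overpartitions of $n$. For every fixed integer $k\ge 1$, as $n\to\infty$, $$\overline{p}_k(n)\sim \frac{1}{2\sqrt{6}\,n}\sqrt{1+\frac{1}{2k(k+1)}}\;\exp\left(\pi\sqrt{\frac23\left(1+\frac{1}{2k(k+1)}\right)n}\right).$$ -/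

import Mathlib

/-- An overpartition of `n`: a partition of `n` in which the last occurrence of each part may be
overlined. Since only the last occurrence of a part size can be overlined, it is determined by
the partition together with the set of those part sizes that carry an overline. -/
structure Overpartition (n : ℕ) where
  /-- the underlying partition, i.e. all parts with the overlines forgotten -/
  toPartition : n.Partition
  /-- the sizes of the overlined parts -/
  overlined : Finset ℕ
  overlined_subset : ∀ m ∈ overlined, m ∈ toPartition.parts

namespace Overpartition

instance instFinite (n : ℕ) : Finite (Overpartition n) := by
  refine Finite.of_injective
    (β := Σ p : n.Partition, {s : Finset ℕ // s ∈ p.parts.toFinset.powerset})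
    (fun l => ⟨l.toPartition, l.overlined, Finset.mem_powerset.2 fun m hm =>
      Multiset.mem_toFinset.2 (l.overlined_subset m hm)⟩) ?_
  rintro ⟨p, s, hs⟩ ⟨p', s', hs'⟩ h
  obtain ⟨rfl, h2⟩ := Sigma.mk.inj_iff.1 h
  have h3 := congrArg Subtype.val (eq_of_heq h2)
  simp only at h3
  subst h3
  rfl

/-- An overpartition has a gap at `m` if it has no part of size `m`, overlined or not. -/
def HasGapAt {n : ℕ} (l : Overpartition n) (m : ℕ) : Prop :=
  m ∉ l.toPartition.parts

/-- Lower `k`-run overpartitions: every overlined part `m` lies in some run `j+1, …, j+k` of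
overlined parts, with a gap at `j`, and with no overlined part `j+k+1`. -/
def IsLowerRun {n : ℕ} (k : ℕ) (l : Overpartition n) : Prop :=
  ∀ m ∈ l.overlined, ∃ j : ℕ, m ∈ Finset.Icc (j + 1) (j + k) ∧
    (∀ i ∈ Finset.Icc (j + 1) (j + k), i ∈ l.overlined) ∧
    l.HasGapAt j ∧ j + k + 1 ∉ l.overlined

end Overpartition

/-- The number of lower `k`-run overpartitions of size `n`. -/
noncomputable def numRunOverpartitions (k n : ℕ) : ℕ :=
  Nat.card {l : Overpartition n // l.IsLowerRun k}

/-!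
Write `q = e ^ (-t + i θ)` and let `G(q)` be the generating function of lower `k`-run
overpartitions. The overlined parts of such an overpartition are the runs `j + 1, …, j + k` above
the elements `j` of a set `J` of gaps any two of which differ by more than `k`, and the remaining
data is a partition that avoids `J` and contains the runs. Summing over the partitions for fixed
`J` gives `G = P H` (`hasSum_numRunOverpartitions`), where `P` is the partition generating function
and `H` is a sum over the sets `J` of products of weights `q ^ ((j + 1) + ⋯ + (j + k)) (1 - q ^ j)`,
the second factor being absent for `j = 0`.

The coefficients are recovered by the saddle point method (`tendsto_coeff_of_growth`), which needs
two facts: the asymptotic behaviour of `G(e ^ (-t))` as `t` tends to `0` from the right, and a decay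
of `G(q)` on the circle of radius `e ^ (-t)` away from the positive real axis. Near the axis the
Gaussian shape comes for free from the growth on the real axis: the suitably rescaled and normalized
functions are bounded and holomorphic and converge on a real segment, hence everywhere
(`tendsto_zero_of_tendsto_zero_on_radius`).

On the real axis `P` is known through the transformation of the Dedekind eta function
(`tendsto_partitionSum`). For `H`, let `H j` be the sum over the sets `J` of numbers `≥ j`; then
`H j = H (j + 1) + w j * H (j + k + 1)`, where `w j` is the weight of `j`, and `H j` tends to `1` at
infinity. A WKB ansatz `exp (S₀ (j t) / t + S₁ (j t))` solves this recursion up to a relative error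
`O(t ^ 2 e ^ (-j t))` (`exists_trial_residual_bound`). The errors sum to `O(t)`, and a comparison
principle (`le_of_backward_recursion`) turns the ansatz into upper and lower bounds for `H j`
(`exists_realRunSum_bound`). The functions `S₀` and `S₁` are explicit in the solution
`y` of `e ^ (-s) = y (1 + y ^ k) / (1 + y ^ (k + 1))`, and the value
`S₀ 0 = π ^ 2 / (12 k (k + 1))` is a dilogarithm evaluation (`negDilog_one`). This gives
`tendsto_realRunFactor`.

The decay off the real axis (`norm_genFun_le`) has two regimes. For `|θ| ≤ 64 t`, the same
recursion is compared with itself at `q` and `|q|`: every `i` outside `J` contributes a factor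
`(1 - |q| ^ i) / |1 - q ^ i|` to the quotient of the absolute values, and the elements of `J` are
too sparse to spoil the gain (`norm_genFun_le_of_factorRatio`). For larger `|θ|`, put
`X = |q| / (1 - |q|)`; then `|P|` is smaller than on the real axis by a factor `e ^ (-23 X / 24)`,
while `|H|` is at most `2 e ^ (11 X / 12)` (`norm_genFun_le_of_norm_one_sub`).
-/

open Filter Topology

/-! ### Partitions with forbidden and prescribed part sizes -/

/-- The number of partitions of `n` without a part size in `S`, in which every element of `D`
occurs as a part. -/
noncomputable def prescribedCard (S D : Finset ℕ) (n : ℕ) : ℕ :=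
  Nat.card {p : n.Partition // (∀ i ∈ S, i ∉ p.parts) ∧ ∀ i ∈ D, i ∈ p.parts}

lemma prescribedCard_insert_of_le {S D : Finset ℕ} {a n : ℕ} (ha : 1 ≤ a) (haS : a ∉ S)
    (haD : a ∉ D) (han : a ≤ n) :
    prescribedCard S (insert a D) n = prescribedCard S D (n - a) := by
  unfold prescribedCard
  have e1 : {p : n.Partition // (∀ i ∈ S, i ∉ p.parts) ∧ ∀ i ∈ insert a D, i ∈ p.parts} ≃
      {p : {p : n.Partition // a ∈ p.parts} //
        (∀ i ∈ S, i ∉ p.1.parts) ∧ ∀ i ∈ D, i ∈ p.1.parts} :=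
    { toFun := fun p => ⟨⟨p.1, p.2.2 a (Finset.mem_insert_self _ _)⟩, p.2.1,
        fun i hi => p.2.2 i (Finset.mem_insert_of_mem hi)⟩
      invFun := fun p => ⟨p.1.1, p.2.1, by
        intro i hi
        rcases Finset.mem_insert.1 hi with rfl | hi
        · exact p.1.2
        · exact p.2.2 i hi⟩
      left_inv := fun p => rfl
      right_inv := fun p => rfl }
  refine Nat.card_congr (e1.trans
    (Equiv.subtypeEquiv (Nat.Partition.partitionWithPartEquiv ha han) ?_))
  intro p
  simp only [Nat.Partition.partitionWithPartEquiv_apply_parts]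
  have h : ∀ i, i ≠ a → (i ∈ p.1.parts.erase a ↔ i ∈ p.1.parts) := fun i hi =>
    Multiset.mem_erase_of_ne hi
  refine and_congr (forall₂_congr fun i hi => ?_) (forall₂_congr fun i hi => ?_)
  · rw [h i (by rintro rfl; exact haS hi)]
  · rw [h i (by rintro rfl; exact haD hi)]

lemma prescribedCard_eq_zero_of_lt {S D : Finset ℕ} {a n : ℕ} (ha : a ∈ D) (han : n < a) :
    prescribedCard S D n = 0 := by
  unfold prescribedCard
  rw [Nat.card_eq_zero]
  left
  refine ⟨fun p => ?_⟩
  have := Nat.Partition.le_of_mem_parts (p.2.2 a ha)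
  omega

/-- The partitions without a part in `S` split according to whether `a` is a part. -/
lemma prescribedCard_split (S : Finset ℕ) (a n : ℕ) :
    prescribedCard S ∅ n = prescribedCard (insert a S) ∅ n + prescribedCard S {a} n := by
  classical
  unfold prescribedCard
  rw [← Nat.card_sum]
  refine (Nat.card_congr (Equiv.ofBijective
    (Sum.elim (fun p => ⟨p.1, fun i hi => p.2.1 i (Finset.mem_insert_of_mem hi), by simp⟩)
      (fun p => ⟨p.1, p.2.1, by simp⟩)) ⟨?_, ?_⟩)).symm
  · rintro (p | p) (p' | p') h
    · simpa [Subtype.ext_iff] using h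
    · simp only [Sum.elim_inl, Sum.elim_inr, Subtype.mk.injEq] at h
      exact absurd (h ▸ p'.2.2 a (by simp)) (p.2.1 a (by simp))
    · simp only [Sum.elim_inl, Sum.elim_inr, Subtype.mk.injEq] at h
      exact absurd (h ▸ p.2.2 a (by simp)) (p'.2.1 a (by simp))
    · simpa [Subtype.ext_iff] using h
  · rintro ⟨p, h1, h2⟩
    by_cases hp : a ∈ p.parts
    · exact ⟨Sum.inr ⟨p, h1, by simpa using hp⟩, rfl⟩
    · refine ⟨Sum.inl ⟨p, fun i hi => ?_, by simp⟩, rfl⟩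
      rcases Finset.mem_insert.1 hi with rfl | hi
      · exact hp
      · exact h1 i hi

lemma prescribedCard_mono_left {S S' D : Finset ℕ} (h : S ⊆ S') (n : ℕ) :
    prescribedCard S' D n ≤ prescribedCard S D n := by
  unfold prescribedCard
  refine Nat.card_le_card_of_injective
    (fun p => ⟨p.1, fun i hi => p.2.1 i (h hi), p.2.2⟩) ?_
  intro p p' hp
  simpa [Subtype.ext_iff] using hp

lemma prescribedCard_empty_zero (S : Finset ℕ) : prescribedCard S ∅ 0 = 1 := by
  unfold prescribedCard
  rw [Nat.card_eq_one_iff_unique]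
  exact ⟨⟨fun p p' => Subtype.ext (Subsingleton.elim _ _)⟩,
    ⟨⟨default, by simp, by simp⟩⟩⟩

/-- If all part sizes up to `n` are forbidden, a positive `n` has no partition. -/
lemma prescribedCard_eq_zero_of_Icc_subset {S : Finset ℕ} {n : ℕ} (hn : n ≠ 0)
    (hS : ∀ i, 1 ≤ i → i ≤ n → i ∈ S) : prescribedCard S ∅ n = 0 := by
  unfold prescribedCard
  rw [Nat.card_eq_zero]
  left
  refine ⟨fun ⟨p, h1, h2⟩ => ?_⟩
  obtain ⟨i, hi⟩ : ∃ i, i ∈ p.parts := by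
    refine Multiset.exists_mem_of_ne_zero fun h => hn ?_
    rw [← p.parts_sum, h, Multiset.sum_zero]
  exact h1 i (hS i (p.parts_pos hi) (Nat.Partition.le_of_mem_parts hi)) hi

lemma prescribedCard_singleton {S : Finset ℕ} {a : ℕ} (ha : 1 ≤ a) (haS : a ∉ S) (n : ℕ) :
    prescribedCard S {a} n = if a ≤ n then prescribedCard S ∅ (n - a) else 0 := by
  split_ifs with h
  · rw [← insert_empty_eq, prescribedCard_insert_of_le ha haS (by simp) h]
  · exact prescribedCard_eq_zero_of_lt (Finset.mem_singleton_self a) (by omega)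

lemma one_div_one_sub_le_exp {x : ℝ} (hx : x < 1) : 1 / (1 - x) ≤ Real.exp (x / (1 - x)) := by
  have : 1 / (1 - x) = x / (1 - x) + 1 := by
    have : 1 - x ≠ 0 := by linarith
    field_simp
    ring
  rw [this]
  exact Real.add_one_le_exp _

lemma prod_one_div_one_sub_pow_le {r : ℝ} (h0 : 0 ≤ r) (h1 : r < 1) (N : ℕ) :
    ∏ i ∈ Finset.range N, 1 / (1 - r ^ (i + 1)) ≤ Real.exp (1 / (1 - r) ^ 2) := by
  have hr : 0 < 1 - r := by linarith
  have key : ∀ i ∈ Finset.range N, 1 / (1 - r ^ (i + 1)) ≤ Real.exp (r ^ i / (1 - r)) := by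
    intro i _
    have h2 : r ^ (i + 1) ≤ r := pow_le_of_le_one h0 h1.le (by omega)
    refine (one_div_one_sub_le_exp (by linarith)).trans (Real.exp_le_exp.2 ?_)
    gcongr ?_ / ?_
    · exact pow_le_pow_of_le_one h0 h1.le (by omega)
    · linarith
  refine (Finset.prod_le_prod (fun i _ => ?_) key).trans ?_
  · have h2 : r ^ (i + 1) ≤ r := pow_le_of_le_one h0 h1.le (by omega)
    exact one_div_nonneg.2 (by linarith)
  rw [← Real.exp_sum, Real.exp_le_exp, ← Finset.sum_div]
  have hg : ∑ i ∈ Finset.range N, r ^ i ≤ 1 / (1 - r) := by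
    have := (summable_geometric_of_lt_one h0 h1).sum_le_tsum (Finset.range N)
      (fun i _ => pow_nonneg h0 i)
    rwa [tsum_geometric_of_lt_one h0 h1, ← one_div] at this
  rw [div_le_iff₀ hr]
  refine hg.trans (le_of_eq ?_)
  field_simp

/-- The generating function of the partition numbers converges inside the unit disc. -/
lemma summable_prescribedCard_pow {r : ℝ} (h0 : 0 ≤ r) (h1 : r < 1) (S : Finset ℕ) :
    Summable fun n => (prescribedCard S ∅ n : ℝ) * r ^ n := by
  have main : Summable fun n => (prescribedCard ∅ ∅ n : ℝ) * r ^ n := by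
    refine summable_of_sum_range_le (c := Real.exp (1 / (1 - r) ^ 2)) (fun n => by positivity) ?_
    intro M
    -- Restrict to parts of size at most `N` and let `N` run up to `M`.
    have step : ∀ N ≤ M, ∑ n ∈ Finset.range M, (prescribedCard (Finset.Ioc N M) ∅ n : ℝ) * r ^ n ≤
        ∏ i ∈ Finset.range N, 1 / (1 - r ^ (i + 1)) := by
      intro N
      induction N with
      | zero =>
        intro _
        simp only [Finset.range_zero, Finset.prod_empty]
        rcases Nat.eq_zero_or_pos M with rfl | hM
        · simp
        rw [Finset.sum_eq_single_of_mem 0 (Finset.mem_range.2 hM)]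
        · rw [prescribedCard_empty_zero]
          simp
        · intro n hn hn0
          rw [prescribedCard_eq_zero_of_Icc_subset hn0]
          · simp
          · intro i hi hi'
            have := Finset.mem_range.1 hn
            simp only [Finset.mem_Ioc]
            omega
      | succ N ih =>
        intro hN
        set S₁ := Finset.Ioc (N + 1) M with hS₁
        have hS : insert (N + 1) S₁ = Finset.Ioc N M := by
          ext i
          simp only [hS₁, Finset.mem_insert, Finset.mem_Ioc]
          omega
        have hlt : r ^ (N + 1) < 1 := pow_lt_one₀ h0 h1 (by omega)
        have h2 : ∑ n ∈ Finset.range M, (prescribedCard S₁ {N + 1} n : ℝ) * r ^ n ≤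
            r ^ (N + 1) * ∑ n ∈ Finset.range M, (prescribedCard S₁ ∅ n : ℝ) * r ^ n := by
          obtain ⟨M', rfl⟩ := Nat.exists_eq_add_of_le hN
          rw [Finset.sum_range_add, Finset.sum_eq_zero, zero_add, Finset.mul_sum]
          · refine le_trans (Finset.sum_le_sum fun n _ => ?_)
              (Finset.sum_le_sum_of_subset_of_nonneg
                (Finset.range_mono (show M' ≤ N + 1 + M' by omega)) fun n _ _ => by positivity)
            rw [prescribedCard_singleton (by omega) (by simp [hS₁]), if_pos (by omega),
              Nat.add_sub_cancel_left, pow_add]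
            exact le_of_eq (by ring)
          · intro n hn
            rw [prescribedCard_eq_zero_of_lt (Finset.mem_singleton_self _) (Finset.mem_range.1 hn)]
            simp
        have h3 := ih (by omega)
        have h4 : ∑ n ∈ Finset.range M, (prescribedCard S₁ ∅ n : ℝ) * r ^ n =
            ∑ n ∈ Finset.range M, (prescribedCard (Finset.Ioc N M) ∅ n : ℝ) * r ^ n +
            ∑ n ∈ Finset.range M, (prescribedCard S₁ {N + 1} n : ℝ) * r ^ n := by
          rw [← Finset.sum_add_distrib]
          refine Finset.sum_congr rfl fun n _ => ?_
          rw [prescribedCard_split S₁ (N + 1) n, hS]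
          push_cast
          ring
        rw [Finset.prod_range_succ, mul_one_div, le_div_iff₀ (by linarith)]
        linarith
    have := step M le_rfl
    rw [Finset.Ioc_self] at this
    exact this.trans (prod_one_div_one_sub_pow_le h0 h1 M)
  refine main.of_nonneg_of_le (fun n => by positivity) fun n => ?_
  gcongr
  exact prescribedCard_mono_left (Finset.empty_subset S) n

/-- The generating function `∑ p_S(n) qⁿ` of partitions without a part size in `S`. -/
noncomputable def avoidGenFun (S : Finset ℕ) (q : ℂ) : ℂ :=
  ∑' n, (prescribedCard S ∅ n : ℂ) * q ^ n

lemma summable_norm_prescribedCard_pow {q : ℂ} (hq : ‖q‖ < 1) (S : Finset ℕ) :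
    Summable fun n => ‖(prescribedCard S ∅ n : ℂ) * q ^ n‖ := by
  simpa using summable_prescribedCard_pow (norm_nonneg q) hq S

lemma hasSum_avoidGenFun {q : ℂ} (hq : ‖q‖ < 1) (S : Finset ℕ) :
    HasSum (fun n => (prescribedCard S ∅ n : ℂ) * q ^ n) (avoidGenFun S q) :=
  (summable_norm_prescribedCard_pow hq S).of_norm.hasSum

lemma hasSum_shift {u v : ℕ → ℂ} {q U : ℂ} {a : ℕ} (hu : HasSum (fun n => u n * q ^ n) U)
    (hv0 : ∀ n < a, v n = 0) (hv : ∀ n, v (n + a) = u n) :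
    HasSum (fun n => v n * q ^ n) (q ^ a * U) := by
  rw [← hasSum_nat_add_iff' a]
  rw [Finset.sum_eq_zero fun n hn => by rw [hv0 n (Finset.mem_range.1 hn), zero_mul], sub_zero]
  refine (hu.mul_left (q ^ a)).congr_fun ?_
  intro n
  rw [hv, pow_add]
  ring

/-- Prescribing the parts in `D` multiplies the generating function by `q` to the sum of `D`. -/
lemma hasSum_prescribedCard {q : ℂ} (hq : ‖q‖ < 1) (S D : Finset ℕ) (hD : ∀ i ∈ D, 1 ≤ i)
    (hSD : Disjoint S D) :
    HasSum (fun n => (prescribedCard S D n : ℂ) * q ^ n)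
      (q ^ (∑ i ∈ D, i) * avoidGenFun S q) := by
  induction D using Finset.induction_on with
  | empty => simpa using hasSum_avoidGenFun hq S
  | insert a D ha ih =>
    rw [Finset.disjoint_insert_right] at hSD
    have := ih (fun i hi => hD i (Finset.mem_insert_of_mem hi)) hSD.2
    rw [Finset.sum_insert ha, pow_add, mul_assoc]
    refine hasSum_shift this (fun n hn => ?_) fun n => ?_
    · rw [prescribedCard_eq_zero_of_lt (Finset.mem_insert_self a D) hn, Nat.cast_zero]
    · rw [prescribedCard_insert_of_le (hD a (Finset.mem_insert_self a D)) hSD.1 ha (by omega),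
        Nat.add_sub_cancel]

lemma avoidGenFun_insert {q : ℂ} (hq : ‖q‖ < 1) {S : Finset ℕ} {a : ℕ} (ha : 1 ≤ a)
    (haS : a ∉ S) : avoidGenFun (insert a S) q = (1 - q ^ a) * avoidGenFun S q := by
  have h1 := hasSum_avoidGenFun hq (insert a S)
  have h2 := hasSum_prescribedCard hq S {a} (by simpa using ha) (by simpa using haS)
  have h3 := hasSum_avoidGenFun hq S
  have h4 := h1.add h2
  have h5 : avoidGenFun S q = _ := h3.unique (h4.congr_fun fun n => by
    rw [prescribedCard_split S a n]
    push_cast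
    ring)
  rw [Finset.sum_singleton] at h5
  linear_combination -h5

/-- Since parts are positive, forbidding the part size `0` changes nothing. -/
lemma avoidGenFun_insert_zero (S : Finset ℕ) (q : ℂ) :
    avoidGenFun (insert 0 S) q = avoidGenFun S q := by
  unfold avoidGenFun
  congr 1
  ext n
  congr 2
  rw [prescribedCard_split S 0 n]
  have : prescribedCard S {0} n = 0 := by
    unfold prescribedCard
    rw [Nat.card_eq_zero]
    left
    exact ⟨fun p => absurd (p.1.parts_pos (p.2.2 0 (by simp))) (lt_irrefl 0)⟩
  omega

lemma avoidGenFun_eq_prod {q : ℂ} (hq : ‖q‖ < 1) (S : Finset ℕ) :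
    avoidGenFun S q = (∏ i ∈ S, if i = 0 then 1 else 1 - q ^ i) * avoidGenFun ∅ q := by
  induction S using Finset.induction_on with
  | empty => simp
  | insert a S ha ih =>
    rw [Finset.prod_insert ha]
    split_ifs with h
    · rw [h, avoidGenFun_insert_zero, ih, one_mul]
    · rw [avoidGenFun_insert hq (by omega) ha, ih]
      ring

/-- Euler's product for the generating function of the partition numbers, as a limit. -/
lemma tendsto_avoidGenFun_mul_prod {q : ℂ} (hq : ‖q‖ < 1) :
    Tendsto (fun N => avoidGenFun ∅ q * ∏ i ∈ Finset.range N, (1 - q ^ (i + 1))) atTop (𝓝 1) := by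
  have h1 : ∀ N, avoidGenFun ∅ q * ∏ i ∈ Finset.range N, (1 - q ^ (i + 1)) =
      avoidGenFun (Finset.Ioc 0 N) q := by
    intro N
    rw [avoidGenFun_eq_prod hq (Finset.Ioc 0 N), mul_comm]
    congr 1
    rw [Finset.range_eq_Ico, Finset.prod_Ico_add' (fun i => (1 : ℂ) - q ^ i) 0 N 1]
    have : Finset.Ico (0 + 1) (N + 1) = Finset.Ioc 0 N := by
      ext i
      simp only [Finset.mem_Ico, Finset.mem_Ioc]
      omega
    rw [this]
    exact Finset.prod_congr (M := ℂ) rfl fun i hi =>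
      (if_neg (by have := (Finset.mem_Ioc.1 hi).1; omega)).symm
  simp_rw [h1, avoidGenFun]
  have h2 : (1 : ℂ) = ∑' n : ℕ, if n = 0 then 1 else 0 := by simp
  rw [h2]
  refine tendsto_tsum_of_dominated_convergence (summable_norm_prescribedCard_pow hq ∅) ?_ ?_
  · intro n
    refine tendsto_const_nhds.congr' ?_
    filter_upwards [eventually_ge_atTop n] with N hN
    split_ifs with h
    · rw [h, prescribedCard_empty_zero]
      simp
    · rw [prescribedCard_eq_zero_of_Icc_subset h]
      · simp
      · intro i hi hi'
        simp only [Finset.mem_Ioc]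
        omega
  · refine .of_forall fun N n => ?_
    rw [norm_mul, norm_mul]
    gcongr
    simpa using prescribedCard_mono_left (Finset.empty_subset _) n

/-! ### Lower run overpartitions as spaced sets of gaps -/

/-- A finite set of naturals any two distinct elements of which differ by more than `k`. The
gaps below the runs of a lower `k`-run overpartition form such a set. -/
def Spaced (k : ℕ) (J : Finset ℕ) : Prop := ∀ a ∈ J, ∀ b ∈ J, a < b → a + k < b

/-- The part sizes covered by the runs of length `k` that start right above the elements
of `J`. -/
def runParts (k : ℕ) (J : Finset ℕ) : Finset ℕ :=
  J.biUnion fun j => Finset.Icc (j + 1) (j + k)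

/-- The sum `(j + 1) + ⋯ + (j + k)`. -/
def runSize (k j : ℕ) : ℕ := ∑ i ∈ Finset.Icc (j + 1) (j + k), i

lemma mem_runParts {k : ℕ} {J : Finset ℕ} {m : ℕ} :
    m ∈ runParts k J ↔ ∃ j ∈ J, j + 1 ≤ m ∧ m ≤ j + k := by
  simp [runParts]

lemma two_mul_runSize (k j : ℕ) : 2 * runSize k j = 2 * (k * j) + k * (k + 1) := by
  have h : ∀ k, 2 * runSize k j = 2 * (k * j) + k * (k + 1) := by
    intro k
    induction k with
    | zero => simp [runSize]
    | succ k ih =>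
      unfold runSize at ih ⊢
      rw [← add_assoc, Finset.sum_Icc_succ_top (by omega), mul_add, ih]
      ring
  exact h k

lemma runSize_ge {k : ℕ} (hk : 1 ≤ k) (j : ℕ) : j + 1 ≤ runSize k j := by
  have := two_mul_runSize k j
  nlinarith [Nat.zero_le j]

lemma sum_runParts {k : ℕ} {J : Finset ℕ} (hJ : Spaced k J) :
    ∑ i ∈ runParts k J, i = ∑ j ∈ J, runSize k j := by
  unfold runParts
  rw [Finset.sum_biUnion]
  · rfl
  · intro a ha b hb hab
    rw [Function.onFun, Finset.disjoint_left]
    intro i hi hi'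
    simp only [Finset.mem_Icc] at hi hi'
    rcases lt_or_gt_of_ne hab with h | h
    · have := hJ a ha b hb h
      omega
    · have := hJ b hb a ha h
      omega

lemma disjoint_runParts {k : ℕ} {J : Finset ℕ} (hJ : Spaced k J) : Disjoint J (runParts k J) := by
  rw [Finset.disjoint_left]
  intro a ha ha'
  obtain ⟨j, hj, h1, h2⟩ := mem_runParts.1 ha'
  have := hJ j hj a ha (by omega)
  omega

namespace Overpartition

open Classical in
/-- The gaps that lie right below an overlined part. -/
noncomputable def gapSet {n : ℕ} (l : Overpartition n) : Finset ℕ :=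
  {j ∈ Finset.range n | j ∉ l.toPartition.parts ∧ j + 1 ∈ l.overlined}

lemma mem_gapSet {n : ℕ} {l : Overpartition n} {j : ℕ} :
    j ∈ l.gapSet ↔ j ∉ l.toPartition.parts ∧ j + 1 ∈ l.overlined := by
  unfold gapSet
  simp only [Finset.mem_filter, Finset.mem_range, and_iff_right_iff_imp]
  intro h
  exact Nat.Partition.le_of_mem_parts (l.overlined_subset _ h.2)

/-- In a lower run overpartition a gap below an overlined part starts a full run. -/
lemma IsLowerRun.run_of_mem_gapSet {n k : ℕ} {l : Overpartition n} (hl : l.IsLowerRun k) {j : ℕ}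
    (hj : j ∈ l.gapSet) : ∀ i ∈ Finset.Icc (j + 1) (j + k), i ∈ l.overlined := by
  rw [mem_gapSet] at hj
  obtain ⟨j', h1, h2, -⟩ := hl _ hj.2
  rw [Finset.mem_Icc] at h1
  have : j' = j := by
    by_contra hne
    exact hj.1 (l.overlined_subset _ (h2 j (Finset.mem_Icc.2 ⟨by omega, by omega⟩)))
  exact this ▸ h2

lemma IsLowerRun.spaced_gapSet {n k : ℕ} {l : Overpartition n} (hl : l.IsLowerRun k) :
    Spaced k l.gapSet := by
  intro a ha b hb hab
  by_contra hlt
  exact (mem_gapSet.1 hb).1 (l.overlined_subset _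
    (hl.run_of_mem_gapSet ha b (Finset.mem_Icc.2 ⟨by omega, by omega⟩)))

lemma IsLowerRun.runParts_gapSet {n k : ℕ} {l : Overpartition n} (hl : l.IsLowerRun k) :
    runParts k l.gapSet = l.overlined := by
  ext m
  rw [mem_runParts]
  constructor
  · rintro ⟨j, hj, h1, h2⟩
    exact hl.run_of_mem_gapSet hj m (Finset.mem_Icc.2 ⟨h1, h2⟩)
  · intro hm
    obtain ⟨j, h1, h2, h3, -⟩ := hl m hm
    rw [Finset.mem_Icc] at h1
    exact ⟨j, mem_gapSet.2 ⟨h3, h2 _ (Finset.mem_Icc.2 ⟨by omega, by omega⟩)⟩, h1⟩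

lemma isLowerRun_runParts {n k : ℕ} (p : n.Partition) {J : Finset ℕ} (hJ : Spaced k J)
    (h1 : ∀ i ∈ J, i ∉ p.parts) (h2 : ∀ i ∈ runParts k J, i ∈ p.parts) :
    IsLowerRun k (⟨p, runParts k J, h2⟩ : Overpartition n) := by
  intro m hm
  obtain ⟨j, hj, hm1, hm2⟩ := mem_runParts.1 hm
  refine ⟨j, Finset.mem_Icc.2 ⟨hm1, hm2⟩, fun i hi => ?_, h1 j hj, fun h => ?_⟩
  · exact mem_runParts.2 ⟨j, hj, Finset.mem_Icc.1 hi⟩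
  · obtain ⟨j', hj', h3, h4⟩ := mem_runParts.1 h
    have h5 := hJ j hj j' hj' (by omega)
    omega

lemma gapSet_runParts {n k : ℕ} (hk : 1 ≤ k) (p : n.Partition) {J : Finset ℕ}
    (h1 : ∀ i ∈ J, i ∉ p.parts) (h2 : ∀ i ∈ runParts k J, i ∈ p.parts) :
    gapSet (⟨p, runParts k J, h2⟩ : Overpartition n) = J := by
  ext j
  rw [mem_gapSet]
  constructor
  · rintro ⟨h3, h4⟩
    obtain ⟨j', hj', h5, h6⟩ := mem_runParts.1 h4
    rcases eq_or_ne j' j with rfl | hne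
    · exact hj'
    · exact absurd (h2 j (mem_runParts.2 ⟨j', hj', by omega, by omega⟩)) h3
  · intro hj
    exact ⟨h1 j hj, mem_runParts.2 ⟨j, hj, by omega, by omega⟩⟩

end Overpartition

lemma prescribedCard_runParts_eq_zero {k n : ℕ} (hk : 1 ≤ k) {J : Finset ℕ}
    (hJ : J ∉ (Finset.range n).powerset) : prescribedCard J (runParts k J) n = 0 := by
  obtain ⟨j, hj, hjn⟩ := Finset.not_subset.1 (fun h => hJ (Finset.mem_powerset.2 h))
  refine prescribedCard_eq_zero_of_lt (a := j + 1)
    (mem_runParts.2 ⟨j, hj, le_rfl, by omega⟩) ?_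
  simp only [Finset.mem_range, not_lt] at hjn
  omega

open Classical in
/-- Lower `k`-run overpartitions correspond to pairs of a spaced set `J` of gaps and a partition
that avoids `J` and contains all the runs above `J`. -/
lemma numRunOverpartitions_eq_sum {k : ℕ} (hk : 1 ≤ k) (n : ℕ) :
    numRunOverpartitions k n = ∑ J ∈ (Finset.range n).powerset with Spaced k J,
      prescribedCard J (runParts k J) n := by
  rw [← Finset.sum_coe_sort]
  unfold prescribedCard
  rw [← Nat.card_sigma]
  refine Nat.card_congr
    { toFun := fun l => ⟨⟨l.1.gapSet, ?_⟩, ⟨l.1.toPartition, ?_, ?_⟩⟩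
      invFun := fun x => ⟨⟨x.2.1, runParts k x.1.1, x.2.2.2⟩, ?_⟩
      left_inv := ?_
      right_inv := ?_ }
  · exact Finset.mem_filter.2 ⟨Finset.mem_powerset.2 (Finset.filter_subset _ _),
      l.2.spaced_gapSet⟩
  · exact fun i hi => (Overpartition.mem_gapSet.1 hi).1
  · exact fun i hi => l.1.overlined_subset i (l.2.runParts_gapSet ▸ hi)
  · exact Overpartition.isLowerRun_runParts x.2.1 (Finset.mem_filter.1 x.1.2).2 x.2.2.1 x.2.2.2
  · rintro ⟨⟨p, s, hs⟩, hl⟩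
    simp only [Subtype.mk.injEq, Overpartition.mk.injEq, true_and]
    exact hl.runParts_gapSet
  · rintro ⟨⟨J, hJ⟩, ⟨p, h1, h2⟩⟩
    have h := Overpartition.gapSet_runParts hk p h1 h2
    refine Sigma.ext (Subtype.ext h) ?_
    simp only
    congr!

/-! ### The generating function -/

open Classical in
/-- The sum of `∏ i ∈ J, w i` over the finite sets `J` of naturals `≥ j` whose elements differ
pairwise by more than `k`. -/
noncomputable def runSum (k : ℕ) (w : ℕ → ℂ) (j : ℕ) : ℂ :=
  ∑' J : Finset ℕ, if Spaced k J ∧ ∀ i ∈ J, j ≤ i then ∏ i ∈ J, w i else 0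

section runSum

variable {k : ℕ} {w : ℕ → ℂ}

lemma summable_runSum (hw : Summable fun i => ‖w i‖) (p : Finset ℕ → Prop) [DecidablePred p] :
    Summable fun J : Finset ℕ => if p J then ∏ i ∈ J, w i else 0 := by
  refine (summable_finsetProd_of_summable_nonneg (fun i => norm_nonneg (w i)) hw).of_norm_bounded
    fun J => ?_
  split_ifs
  · rw [norm_prod]
  · rw [norm_zero]
    exact Finset.prod_nonneg fun i _ => norm_nonneg _

/-- Splitting according to whether the least admissible element is used. -/
lemma runSum_eq_add (hw : Summable fun i => ‖w i‖) (j : ℕ) :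
    runSum k w j = runSum k w (j + 1) + w j * runSum k w (j + k + 1) := by
  classical
  have h1 : ∀ J : Finset ℕ, (if Spaced k J ∧ ∀ i ∈ J, j ≤ i then ∏ i ∈ J, w i else 0) =
      (if Spaced k J ∧ ∀ i ∈ J, j + 1 ≤ i then ∏ i ∈ J, w i else 0) +
      (if Spaced k J ∧ (∀ i ∈ J, j ≤ i) ∧ j ∈ J then ∏ i ∈ J, w i else 0) := by
    intro J
    by_cases hj : j ∈ J
    · have : ¬ ∀ i ∈ J, j + 1 ≤ i := fun h => absurd (h j hj) (by omega)
      rw [if_neg (c := Spaced k J ∧ ∀ i ∈ J, j + 1 ≤ i) (fun h => this h.2), zero_add]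
      simp only [hj, and_true]
    · have : (∀ i ∈ J, j ≤ i) ↔ ∀ i ∈ J, j + 1 ≤ i :=
        forall₂_congr fun i hi => by
          have : i ≠ j := fun h => hj (h ▸ hi)
          omega
      simp [hj, this]
  unfold runSum
  simp_rw [h1]
  rw [(summable_runSum hw _).tsum_add (summable_runSum hw _), ← tsum_mul_left]
  congr 1
  have hnot : ∀ J : Finset ℕ, (∀ i ∈ J, j + k + 1 ≤ i) → j ∉ J := fun J h hj =>
    absurd (h j hj) (by omega)
  refine tsum_eq_tsum_of_ne_zero_bij (fun J => insert j J.1) ?_ ?_ ?_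
  · rintro ⟨J, hJ⟩ ⟨J', hJ'⟩ h
    have hJ1 : j ∉ J := by
      by_contra hc
      exact hJ (by simp only; rw [if_neg (fun h => hnot J h.2 hc), mul_zero])
    have hJ2 : j ∉ J' := by
      by_contra hc
      exact hJ' (by simp only; rw [if_neg (fun h => hnot J' h.2 hc), mul_zero])
    simp only at h
    rw [Subtype.mk.injEq, ← Finset.erase_insert hJ1, h, Finset.erase_insert hJ2]
  · intro J hJ
    simp only [Function.mem_support, ne_eq, ite_eq_right_iff, Classical.not_imp] at hJ
    obtain ⟨⟨h2, h3, h4⟩, h5⟩ := hJ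
    refine ⟨⟨J.erase j, ?_⟩, Finset.insert_erase h4⟩
    rw [Function.mem_support, if_pos, Finset.mul_prod_erase J w h4]
    · exact h5
    · refine ⟨fun a ha b hb hab =>
        h2 a (Finset.mem_of_mem_erase ha) b (Finset.mem_of_mem_erase hb) hab, fun i hi => ?_⟩
      have h6 := h3 i (Finset.mem_of_mem_erase hi)
      have h7 := Finset.ne_of_mem_erase hi
      have := h2 j h4 i (Finset.mem_of_mem_erase hi) (by omega)
      omega
  · rintro ⟨J, hJ⟩
    have hJ0 : Spaced k J ∧ ∀ i ∈ J, j + k + 1 ≤ i := by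
      by_contra hc
      exact hJ (by simp only; rw [if_neg hc, mul_zero])
    have hJ1 := hnot J hJ0.2
    simp only
    rw [if_pos, if_pos hJ0, Finset.prod_insert hJ1]
    refine ⟨fun a ha b hb hab => ?_, fun i hi => ?_, Finset.mem_insert_self _ _⟩
    · rcases Finset.mem_insert.1 ha with rfl | ha' <;>
        rcases Finset.mem_insert.1 hb with rfl | hb'
      · omega
      · have := hJ0.2 b hb'
        omega
      · have := hJ0.2 a ha'
        omega
      · exact hJ0.1 a ha' b hb' hab
    · rcases Finset.mem_insert.1 hi with rfl | hi
      · exact le_rfl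
      · have := hJ0.2 i hi
        omega

lemma tendsto_runSum (hw : Summable fun i => ‖w i‖) : Tendsto (runSum k w) atTop (𝓝 1) := by
  classical
  have h1 : (1 : ℂ) = ∑' J : Finset ℕ, if J = ∅ then 1 else 0 := by simp
  rw [h1]
  refine tendsto_tsum_of_dominated_convergence
    (summable_finsetProd_of_summable_nonneg (fun i => norm_nonneg (w i)) hw) (fun J => ?_)
    (.of_forall fun j J => ?_)
  · refine tendsto_const_nhds.congr' ?_
    split_ifs with hJ
    · filter_upwards with j
      simp [hJ, Spaced]
    · obtain ⟨i, hi⟩ := Finset.nonempty_iff_ne_empty.2 hJ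
      filter_upwards [eventually_gt_atTop i] with j hj
      rw [if_neg]
      rintro ⟨-, h⟩
      have := h i hi
      omega
  · split_ifs
    · rw [norm_prod]
    · rw [norm_zero]
      exact Finset.prod_nonneg fun i _ => norm_nonneg _

lemma runSum_congr {w' : ℕ → ℂ} {j : ℕ} (h : ∀ i, j ≤ i → w i = w' i) :
    runSum k w j = runSum k w' j := by
  classical
  unfold runSum
  congr 1
  ext J
  split_ifs with hJ
  · exact Finset.prod_congr rfl fun i hi => h i (hJ.2 i hi)
  · rfl

end runSum

/-- The weight of a run right above a gap of positive size `j`. -/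
noncomputable def runWeight (k : ℕ) (q : ℂ) (j : ℕ) : ℂ := q ^ runSize k j * (1 - q ^ j)

lemma summable_pow_runSize {k : ℕ} (hk : 1 ≤ k) {r : ℝ} (h0 : 0 ≤ r) (h1 : r < 1) :
    Summable fun j => r ^ runSize k j := by
  refine (summable_geometric_of_lt_one h0 h1).of_nonneg_of_le (fun j => by positivity) fun j => ?_
  refine pow_le_pow_of_le_one h0 h1.le ?_
  have := runSize_ge hk j
  omega

lemma summable_norm_runWeight {k : ℕ} (hk : 1 ≤ k) {q : ℂ} (hq : ‖q‖ < 1) :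
    Summable fun j => ‖runWeight k q j‖ := by
  refine ((summable_pow_runSize hk (norm_nonneg q) hq).mul_right 2).of_nonneg_of_le
    (fun j => norm_nonneg _) fun j => ?_
  rw [runWeight, norm_mul, norm_pow]
  gcongr
  refine (norm_sub_le _ _).trans ?_
  rw [norm_one, norm_pow]
  linarith [pow_le_one₀ (n := j) (norm_nonneg q) hq.le]

/-- The factor `H` in the factorization `G = P H` of the generating function `G` of lower
`k`-run overpartitions, where `P` is the generating function of the partition numbers. The second
term collects the overpartitions with a run starting at `1`, that is above the gap `0`. -/
noncomputable def runFactor (k : ℕ) (q : ℂ) : ℂ :=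
  runSum k (runWeight k q) 1 + q ^ runSize k 0 * runSum k (runWeight k q) (k + 1)

lemma norm_avoidGenFun_le {q : ℂ} (hq : ‖q‖ < 1) (S : Finset ℕ) :
    ‖avoidGenFun S q‖ ≤ ∑' n, (prescribedCard ∅ ∅ n : ℝ) * ‖q‖ ^ n := by
  have h0 := norm_nonneg q
  refine (norm_tsum_le_tsum_norm (summable_norm_prescribedCard_pow hq S)).trans ?_
  refine (summable_norm_prescribedCard_pow hq S).tsum_le_tsum (fun n => ?_)
    (summable_prescribedCard_pow h0 hq ∅)
  rw [norm_mul, norm_pow, Complex.norm_natCast]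
  gcongr
  exact prescribedCard_mono_left (Finset.empty_subset S) n

/-- The generating function of lower `k`-run overpartitions is `P(q) H(q)`. -/
theorem hasSum_numRunOverpartitions {k : ℕ} (hk : 1 ≤ k) {q : ℂ} (hq : ‖q‖ < 1) :
    HasSum (fun n => (numRunOverpartitions k n : ℂ) * q ^ n)
      (avoidGenFun ∅ q * runFactor k q) := by
  classical
  have hq0 := norm_nonneg q
  set f : Finset ℕ × ℕ → ℂ := fun x =>
    if Spaced k x.1 then (prescribedCard x.1 (runParts k x.1) x.2 : ℂ) * q ^ x.2 else 0 with hf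
  have hpos : ∀ J : Finset ℕ, ∀ i ∈ runParts k J, 1 ≤ i := fun J i hi => by
    obtain ⟨j, -, h, -⟩ := mem_runParts.1 hi
    omega
  -- the sum over partitions for a fixed set of gaps
  have hrow : ∀ z : ℂ, ‖z‖ < 1 → ∀ J, Spaced k J → HasSum
      (fun n => (prescribedCard J (runParts k J) n : ℂ) * z ^ n)
      ((∏ j ∈ J, z ^ runSize k j) * avoidGenFun J z) := by
    intro z hz J hJ
    have := hasSum_prescribedCard hz J (runParts k J) (hpos J) (disjoint_runParts hJ)
    rwa [sum_runParts hJ, ← Finset.prod_pow_eq_pow_sum] at this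
  have hqr : ‖((‖q‖ : ℝ) : ℂ)‖ < 1 := by simpa using hq
  have hrowr : ∀ J, Spaced k J → HasSum
      (fun n => (prescribedCard J (runParts k J) n : ℝ) * ‖q‖ ^ n)
      ((∏ j ∈ J, (‖q‖ : ℂ) ^ runSize k j) * avoidGenFun J (‖q‖ : ℂ)).re := by
    intro J hJ
    have := Complex.hasSum_re (hrow _ hqr J hJ)
    refine this.congr_fun fun n => ?_
    rw [← Complex.ofReal_pow, ← Complex.ofReal_natCast, ← Complex.ofReal_mul, Complex.ofReal_re]
  have hnorm : ∀ x, ‖f x‖ = if Spaced k x.1 then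
      (prescribedCard x.1 (runParts k x.1) x.2 : ℝ) * ‖q‖ ^ x.2 else 0 := by
    intro x
    simp only [hf]
    split_ifs
    · rw [norm_mul, norm_pow, Complex.norm_natCast]
    · exact norm_zero
  have hsum : Summable fun x => ‖f x‖ := by
    rw [summable_prod_of_nonneg (fun x => norm_nonneg _)]
    simp_rw [hnorm]
    constructor
    · intro J
      split_ifs with hJ
      · exact (hrowr J hJ).summable
      · exact summable_zero
    · refine ((summable_finsetProd_of_summable_nonneg (fun i => by positivity)
        (summable_pow_runSize hk hq0 hq)).mul_right
        (∑' n, (prescribedCard ∅ ∅ n : ℝ) * ‖q‖ ^ n)).of_nonneg_of_le (fun J => ?_) fun J => ?_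
      · exact tsum_nonneg fun n => by split_ifs <;> positivity
      · split_ifs with hJ
        · rw [(hrowr J hJ).tsum_eq]
          refine (Complex.re_le_norm _).trans ?_
          rw [norm_mul, norm_prod]
          have := norm_avoidGenFun_le hqr J
          simp only [norm_pow, Complex.norm_real, norm_norm] at this ⊢
          gcongr
        · rw [tsum_zero]
          exact mul_nonneg (Finset.prod_nonneg fun i _ => by positivity)
            (tsum_nonneg fun n => by positivity)
  -- the weight in which the factor `1 - q ^ j` is dropped at `j = 0`
  set W : ℕ → ℂ := fun j => q ^ runSize k j * (if j = 0 then 1 else 1 - q ^ j) with hW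
  have hWs : Summable fun j => ‖W j‖ := by
    rw [← summable_nat_add_iff 1]
    refine ((summable_nat_add_iff 1).2 (summable_norm_runWeight hk hq)).congr fun j => ?_
    simp [hW, runWeight]
  have hJ : HasSum (fun J : Finset ℕ => if Spaced k J then
      (∏ j ∈ J, q ^ runSize k j) * avoidGenFun J q else 0)
      (avoidGenFun ∅ q * runFactor k q) := by
    have h1 := (summable_runSum hWs (fun J => Spaced k J ∧ ∀ i ∈ J, 0 ≤ i)).hasSum.mul_left
      (avoidGenFun ∅ q)
    have h2 : runSum k W 0 = runFactor k q := by
      have hc : ∀ j, 1 ≤ j → runSum k W j = runSum k (runWeight k q) j := fun j hj =>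
        runSum_congr fun i hi => by
          simp only [hW, runWeight]
          rw [if_neg (by omega)]
      rw [runSum_eq_add hWs, zero_add, zero_add, runFactor, hc 1 le_rfl, hc (k + 1) (by omega)]
      simp [hW]
    rw [← h2]
    unfold runSum
    refine h1.congr_fun fun J => ?_
    simp only [zero_le, implies_true, and_true, mul_ite, mul_zero]
    split_ifs
    · rw [avoidGenFun_eq_prod hq J, hW, Finset.prod_mul_distrib]
      ring
    · rfl
  have htot : HasSum f (avoidGenFun ∅ q * runFactor k q) := by
    have h1 := hsum.of_norm.hasSum
    have h2 := h1.prod_fiberwise (g := fun J => if Spaced k J then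
      (∏ j ∈ J, q ^ runSize k j) * avoidGenFun J q else 0) (fun J => by
        simp only [hf]
        split_ifs with hJ
        · exact hrow q hq J hJ
        · exact hasSum_zero)
    rwa [h2.unique hJ] at h1
  have hswap := (Equiv.prodComm ℕ (Finset ℕ)).hasSum_iff.2 htot
  refine hswap.prod_fiberwise fun n => ?_
  rw [numRunOverpartitions_eq_sum hk, Finset.sum_filter, Nat.cast_sum, Finset.sum_mul]
  have h3 : HasSum (fun J : Finset ℕ =>
      ((if Spaced k J then prescribedCard J (runParts k J) n else 0 : ℕ) : ℂ) * q ^ n)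
      (∑ J ∈ (Finset.range n).powerset,
        ((if Spaced k J then prescribedCard J (runParts k J) n else 0 : ℕ) : ℂ) * q ^ n) := by
    refine hasSum_sum_of_ne_finset_zero fun J hJ => ?_
    rw [prescribedCard_runParts_eq_zero hk hJ]
    simp
  refine h3.congr_fun fun J => ?_
  change f (J, n) = _
  simp only [hf]
  split_ifs <;> simp

/-! ### Real arguments and a comparison principle -/

/-- A subsolution of a backward linear recursion with nonnegative coefficients lies below a
supersolution if both tend to `1` at infinity. -/
lemma le_of_backward_recursion {u v b c : ℕ → ℝ} {m j₀ : ℕ} (hm : 1 ≤ m)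
    (hb : ∀ j, 0 ≤ b j) (hc : ∀ j, 0 ≤ c j)
    (hu : ∀ j, j₀ ≤ j → u j ≤ b j * u (j + 1) + c j * u (j + m))
    (hv : ∀ j, j₀ ≤ j → b j * v (j + 1) + c j * v (j + m) ≤ v j)
    (hu1 : Tendsto u atTop (𝓝 1)) (hv1 : Tendsto v atTop (𝓝 1)) {j : ℕ} (hj : j₀ ≤ j) :
    u j ≤ v j := by
  have key : ∀ ε > 0, u j ≤ (1 + ε) * v j := by
    intro ε hε
    have h1 : ∀ᶠ i in atTop, u i ≤ (1 + ε) * v i := by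
      have h2 : Tendsto (fun i => (1 + ε) * v i - u i) atTop (𝓝 ((1 + ε) * 1 - 1)) :=
        (hv1.const_mul _).sub hu1
      filter_upwards [h2.eventually_const_lt (show (0 : ℝ) < (1 + ε) * 1 - 1 by linarith)]
        with i hi
      linarith
    obtain ⟨N, hN⟩ := eventually_atTop.1 h1
    have h3 : ∀ d i, j₀ ≤ i → N ≤ i + d → u i ≤ (1 + ε) * v i := by
      intro d
      induction d with
      | zero => exact fun i _ h => hN i h
      | succ d ih =>
        intro i hi hid
        have h4 := ih (i + 1) (by omega) (by omega)
        have h5 := ih (i + m) (by omega) (by omega)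
        have h6 := mul_le_mul_of_nonneg_left h4 (hb i)
        have h7 := mul_le_mul_of_nonneg_left h5 (hc i)
        have h8 := mul_le_mul_of_nonneg_left (hv i hi) (show 0 ≤ 1 + ε by linarith)
        linarith [hu i hi]
    exact h3 N j hj (by omega)
  have h : Tendsto (fun ε : ℝ => (1 + ε) * v j) (𝓝[>] 0) (𝓝 ((1 + 0) * v j)) :=
    ((tendsto_const_nhds.add tendsto_id).mul_const (v j)).mono_left nhdsWithin_le_nhds
  have := ge_of_tendsto h (by filter_upwards [self_mem_nhdsWithin] with ε hε using key ε hε)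
  linarith

open Classical in
/-- `runSum` for real weights. -/
noncomputable def realRunSum (k : ℕ) (v : ℕ → ℝ) (j : ℕ) : ℝ :=
  ∑' J : Finset ℕ, if Spaced k J ∧ ∀ i ∈ J, j ≤ i then ∏ i ∈ J, v i else 0

lemma runSum_ofReal (k : ℕ) (v : ℕ → ℝ) (j : ℕ) :
    runSum k (fun i => (v i : ℂ)) j = (realRunSum k v j : ℂ) := by
  classical
  rw [realRunSum, Complex.ofReal_tsum]
  unfold runSum
  congr 1
  ext J
  split_ifs <;> simp

section realRunSum

variable {k : ℕ} {v : ℕ → ℝ}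

lemma realRunSum_eq_add (hv : Summable fun i => |v i|) (j : ℕ) :
    realRunSum k v j = realRunSum k v (j + 1) + v j * realRunSum k v (j + k + 1) := by
  have h := runSum_eq_add (k := k) (w := fun i => (v i : ℂ)) (by simpa using hv) j
  simp only [runSum_ofReal] at h
  exact_mod_cast h

lemma tendsto_realRunSum (hv : Summable fun i => |v i|) :
    Tendsto (realRunSum k v) atTop (𝓝 1) := by
  have h := tendsto_runSum (k := k) (w := fun i => (v i : ℂ)) (by simpa using hv)
  have h1 := (Complex.continuous_re.tendsto _).comp h
  refine h1.congr fun j => ?_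
  rw [Function.comp_apply, runSum_ofReal, Complex.ofReal_re]

lemma realRunSum_nonneg (h0 : ∀ i, 0 ≤ v i) (j : ℕ) : 0 ≤ realRunSum k v j :=
  tsum_nonneg fun J => by
    split_ifs
    · exact Finset.prod_nonneg fun i _ => h0 i
    · exact le_rfl

lemma one_le_realRunSum (hv : Summable fun i => |v i|) (h0 : ∀ i, 0 ≤ v i) (j : ℕ) :
    1 ≤ realRunSum k v j := by
  have hanti : Antitone (realRunSum k v) := antitone_nat_of_succ_le fun j => by
    rw [realRunSum_eq_add hv j]
    have := mul_nonneg (h0 j) (realRunSum_nonneg (k := k) h0 (j + k + 1))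
    linarith
  exact hanti.le_of_tendsto (tendsto_realRunSum hv) j

end realRunSum

/-- The weight `runWeight` at a real argument. -/
noncomputable def realRunWeight (k : ℕ) (r : ℝ) (j : ℕ) : ℝ := r ^ runSize k j * (1 - r ^ j)

lemma runWeight_ofReal (k : ℕ) (r : ℝ) (j : ℕ) :
    runWeight k (r : ℂ) j = (realRunWeight k r j : ℂ) := by
  simp [runWeight, realRunWeight]

lemma realRunWeight_nonneg {r : ℝ} (h0 : 0 ≤ r) (h1 : r < 1) (k j : ℕ) :
    0 ≤ realRunWeight k r j :=
  mul_nonneg (by positivity) (by linarith [pow_le_one₀ (n := j) h0 h1.le])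

lemma summable_abs_realRunWeight {k : ℕ} (hk : 1 ≤ k) {r : ℝ} (h0 : 0 ≤ r) (h1 : r < 1) :
    Summable fun j => |realRunWeight k r j| := by
  have h := summable_norm_runWeight hk (q := (r : ℂ)) (by simpa [abs_of_nonneg h0] using h1)
  simpa [runWeight_ofReal] using h

/-- The partition generating function at a real argument. -/
noncomputable def partitionSum (r : ℝ) : ℝ := ∑' n, (prescribedCard ∅ ∅ n : ℝ) * r ^ n

lemma avoidGenFun_ofReal (r : ℝ) : avoidGenFun ∅ (r : ℂ) = (partitionSum r : ℂ) := by
  rw [avoidGenFun, partitionSum, Complex.ofReal_tsum]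
  simp

lemma one_le_partitionSum {r : ℝ} (h0 : 0 ≤ r) (h1 : r < 1) : 1 ≤ partitionSum r := by
  have := (summable_prescribedCard_pow h0 h1 ∅).le_tsum 0 (fun n _ => by positivity)
  simpa [partitionSum, prescribedCard_empty_zero] using this

/-- The factor `H` of the generating function at a real argument. -/
noncomputable def realRunFactor (k : ℕ) (r : ℝ) : ℝ :=
  realRunSum k (realRunWeight k r) 1 +
    r ^ runSize k 0 * realRunSum k (realRunWeight k r) (k + 1)

lemma runFactor_ofReal (k : ℕ) (r : ℝ) : runFactor k (r : ℂ) = (realRunFactor k r : ℂ) := by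
  have h : runWeight k (r : ℂ) = fun i => (realRunWeight k r i : ℂ) :=
    funext (runWeight_ofReal k r)
  rw [runFactor, realRunFactor, h, runSum_ofReal, runSum_ofReal]
  push_cast
  rfl

lemma one_le_realRunFactor {k : ℕ} (hk : 1 ≤ k) {r : ℝ} (h0 : 0 ≤ r) (h1 : r < 1) :
    1 ≤ realRunFactor k r := by
  have h := one_le_realRunSum (k := k) (summable_abs_realRunWeight hk h0 h1)
    (realRunWeight_nonneg h0 h1 k)
  have := mul_nonneg (pow_nonneg h0 (runSize k 0)) (zero_le_one.trans (h (k + 1)))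
  have := h 1
  rw [realRunFactor]
  linarith

/-- The generating function at a real argument. -/
lemma hasSum_numRunOverpartitions_real {k : ℕ} (hk : 1 ≤ k) {r : ℝ} (h0 : 0 ≤ r) (h1 : r < 1) :
    HasSum (fun n => (numRunOverpartitions k n : ℝ) * r ^ n)
      (partitionSum r * realRunFactor k r) := by
  have h := hasSum_numRunOverpartitions hk (q := (r : ℂ)) (by simpa [abs_of_nonneg h0] using h1)
  rw [avoidGenFun_ofReal, runFactor_ofReal] at h
  exact_mod_cast h

/-! ### Bounds on a circle, near the positive real axis -/

/-- The quotient of `∏ (1 - |q| ^ i)` by `∏ |1 - q ^ i|`, both over `i > N`. -/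
noncomputable def tailRatio (q : ℂ) (N : ℕ) : ℝ :=
  ‖avoidGenFun ∅ q * ∏ i ∈ Finset.range N, (1 - q ^ (i + 1))‖ /
    (partitionSum ‖q‖ * ∏ i ∈ Finset.range N, (1 - ‖q‖ ^ (i + 1)))

lemma one_sub_norm_pow_pos {q : ℂ} (hq : ‖q‖ < 1) (i : ℕ) : 0 < 1 - ‖q‖ ^ (i + 1) := by
  have : ‖q‖ ^ (i + 1) < 1 := pow_lt_one₀ (norm_nonneg q) hq (Nat.succ_ne_zero i)
  linarith

lemma one_sub_norm_pow_le {q : ℂ} (i : ℕ) : 1 - ‖q‖ ^ i ≤ ‖1 - q ^ i‖ := by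
  have := norm_sub_norm_le (1 : ℂ) (q ^ i)
  rwa [norm_one, norm_pow] at this

lemma norm_one_sub_pow_pos {q : ℂ} (hq : ‖q‖ < 1) (i : ℕ) : 0 < ‖1 - q ^ (i + 1)‖ :=
  (one_sub_norm_pow_pos hq i).trans_le (one_sub_norm_pow_le _)

lemma tailRatio_nonneg {q : ℂ} (hq : ‖q‖ < 1) (N : ℕ) : 0 ≤ tailRatio q N :=
  div_nonneg (norm_nonneg _) (mul_nonneg
    (zero_le_one.trans (one_le_partitionSum (norm_nonneg q) hq))
    (Finset.prod_nonneg fun i _ => (one_sub_norm_pow_pos hq i).le))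

lemma tailRatio_mul {q : ℂ} (hq : ‖q‖ < 1) (N : ℕ) :
    tailRatio q N * ‖1 - q ^ (N + 1)‖ = (1 - ‖q‖ ^ (N + 1)) * tailRatio q (N + 1) := by
  have h1 := (one_sub_norm_pow_pos hq N).ne'
  have h2 := (zero_lt_one.trans_le (one_le_partitionSum (norm_nonneg q) hq)).ne'
  have h3 : ∏ i ∈ Finset.range N, (1 - ‖q‖ ^ (i + 1)) ≠ 0 :=
    Finset.prod_ne_zero_iff.2 fun i _ => (one_sub_norm_pow_pos hq i).ne'
  rw [tailRatio, tailRatio, Finset.prod_range_succ, Finset.prod_range_succ, ← mul_assoc,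
    norm_mul _ (1 - q ^ (N + 1))]
  field_simp

/-- The ratio `(1 - |q| ^ i) / |1 - q ^ i|`. -/
noncomputable def factorRatio (q : ℂ) (i : ℕ) : ℝ := (1 - ‖q‖ ^ i) / ‖1 - q ^ i‖

lemma factorRatio_nonneg {q : ℂ} (hq : ‖q‖ < 1) (i : ℕ) : 0 ≤ factorRatio q i :=
  div_nonneg (by linarith [pow_le_one₀ (n := i) (norm_nonneg q) hq.le]) (norm_nonneg _)

lemma factorRatio_le_one (q : ℂ) (i : ℕ) : factorRatio q i ≤ 1 :=
  div_le_one_of_le₀ (one_sub_norm_pow_le i) (norm_nonneg _)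

lemma tailRatio_eq {q : ℂ} (hq : ‖q‖ < 1) (N : ℕ) :
    tailRatio q N = factorRatio q (N + 1) * tailRatio q (N + 1) := by
  rw [factorRatio, div_mul_eq_mul_div, eq_div_iff (norm_one_sub_pow_pos hq N).ne',
    tailRatio_mul hq]

lemma tailRatio_mono {q : ℂ} (hq : ‖q‖ < 1) : Monotone (tailRatio q) :=
  monotone_nat_of_le_succ fun N => by
    rw [tailRatio_eq hq]
    exact mul_le_of_le_one_left (tailRatio_nonneg hq _) (factorRatio_le_one _ _)

lemma tendsto_partitionSum_mul_prod {r : ℝ} (h0 : 0 ≤ r) (h1 : r < 1) :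
    Tendsto (fun N => partitionSum r * ∏ i ∈ Finset.range N, (1 - r ^ (i + 1))) atTop (𝓝 1) := by
  have h := tendsto_avoidGenFun_mul_prod (q := (r : ℂ)) (by simpa [abs_of_nonneg h0] using h1)
  rw [avoidGenFun_ofReal] at h
  refine ((Complex.continuous_re.tendsto _).comp h).congr fun N => ?_
  rw [Function.comp_apply, ← Complex.ofReal_re (partitionSum r * _)]
  push_cast
  rfl

lemma tendsto_tailRatio {q : ℂ} (hq : ‖q‖ < 1) : Tendsto (tailRatio q) atTop (𝓝 1) := by
  have h := (tendsto_avoidGenFun_mul_prod hq).norm.div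
    (tendsto_partitionSum_mul_prod (norm_nonneg q) hq) one_ne_zero
  rw [norm_one, div_one] at h
  exact h

lemma norm_runWeight (k : ℕ) (q : ℂ) (j : ℕ) :
    ‖runWeight k q j‖ = ‖q‖ ^ runSize k j * ‖1 - q ^ j‖ := by
  rw [runWeight, norm_mul, norm_pow]

/-- If `1 - |q| ^ i ≤ e ^ (-η) |1 - q ^ i|` for all `i ≤ M`, the generating function at `q` is
smaller than at `|q|` by a factor exponential in `η M`. The set `J` of gaps skips a positive
proportion of the integers up to `M`, and every skipped `i` contributes a factor
`1 / (1 - q ^ i)`. -/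
lemma norm_genFun_le_of_factorRatio {k : ℕ} (hk : 1 ≤ k) {q : ℂ} (hq : ‖q‖ < 1) {η : ℝ}
    (hη : 0 ≤ η) {M : ℕ} (hM : ∀ i, 1 ≤ i → i ≤ M → factorRatio q i ≤ Real.exp (-η)) :
    ‖avoidGenFun ∅ q * runFactor k q‖ ≤ partitionSum ‖q‖ * realRunFactor k ‖q‖ *
      Real.exp (-(η * ((M - 1 - k : ℕ) : ℝ) / (k + 1))) := by
  have h0 := norm_nonneg q
  set H : ℕ → ℝ := fun j => realRunSum k (realRunWeight k ‖q‖) j with hH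
  set e : ℕ → ℝ := fun N => Real.exp (-(η * ((M - 1 - N : ℕ) : ℝ) / (k + 1))) with he
  have hH1 : ∀ j, 1 ≤ H j := one_le_realRunSum (summable_abs_realRunWeight hk h0 hq)
    (realRunWeight_nonneg h0 hq k)
  have hstep : ∀ N d : ℕ, d ≤ k + 1 → (M ≤ N + 1 ∨ factorRatio q (N + d) ≤ Real.exp (-η)) →
      ∀ N', N + 1 ≤ N' → N' ≤ N + k + 1 → factorRatio q (N + d) * e N' ≤ e N := by
    intro N d _ hor N' _ hN'
    rcases hor with hN | hρ
    · have h1 : e N' ≤ 1 := by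
        simp only [he]
        rw [Real.exp_le_one_iff]
        have : 0 ≤ η * ((M - 1 - N' : ℕ) : ℝ) / (k + 1) := by positivity
        linarith
      have h2 : e N = 1 := by
        simp only [he]
        rw [show M - 1 - N = 0 by omega]
        simp
      rw [h2]
      exact mul_le_one₀ (factorRatio_le_one _ _) (Real.exp_pos _).le h1
    · refine (mul_le_mul_of_nonneg_right hρ (Real.exp_pos _).le).trans ?_
      simp only [he]
      rw [← Real.exp_add, Real.exp_le_exp]
      have h1 : ((M - 1 - N : ℕ) : ℝ) ≤ ((M - 1 - N' : ℕ) : ℝ) + (k + 1) := by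
        exact_mod_cast (by omega : M - 1 - N ≤ (M - 1 - N') + (k + 1))
      have h2 : η * ((M - 1 - N : ℕ) : ℝ) / (k + 1) ≤
          η * ((M - 1 - N' : ℕ) : ℝ) / (k + 1) + η := by
        rw [div_add' _ _ _ (by positivity)]
        gcongr
        nlinarith
      linarith
  have main : ∀ N, tailRatio q N * ‖runSum k (runWeight k q) (N + 1)‖ ≤ H (N + 1) * e N := by
    intro N
    refine le_of_backward_recursion (j₀ := 0) (m := k + 1)
      (u := fun N => tailRatio q N * ‖runSum k (runWeight k q) (N + 1)‖)
      (v := fun N => H (N + 1) * e N)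
      (b := fun N => factorRatio q (N + 1))
      (c := fun N => realRunWeight k ‖q‖ (N + 1) * factorRatio q (N + 2))
      (by omega) (fun N => factorRatio_nonneg hq _)
      (fun N => mul_nonneg (realRunWeight_nonneg h0 hq _ _) (factorRatio_nonneg hq _))
      ?_ ?_ ?_ ?_ (Nat.zero_le N)
    · intro N _
      have h1 : ‖runSum k (runWeight k q) (N + 1)‖ ≤ ‖runSum k (runWeight k q) (N + 2)‖ +
          ‖q‖ ^ runSize k (N + 1) * ‖1 - q ^ (N + 1)‖ *
            ‖runSum k (runWeight k q) (N + (k + 1) + 1)‖ := by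
        rw [runSum_eq_add (summable_norm_runWeight hk hq) (N + 1), ← norm_runWeight, ← norm_mul,
          show N + 1 + k + 1 = N + (k + 1) + 1 by ring]
        exact norm_add_le _ _
      have h2 : tailRatio q (N + 1) ≤ factorRatio q (N + 2) * tailRatio q (N + (k + 1)) := by
        rw [tailRatio_eq hq (N + 1)]
        exact mul_le_mul_of_nonneg_left (tailRatio_mono hq (by omega)) (factorRatio_nonneg hq _)
      calc tailRatio q N * ‖runSum k (runWeight k q) (N + 1)‖
          ≤ tailRatio q N * (‖runSum k (runWeight k q) (N + 2)‖ +
          ‖q‖ ^ runSize k (N + 1) * ‖1 - q ^ (N + 1)‖ *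
            ‖runSum k (runWeight k q) (N + (k + 1) + 1)‖) :=
            mul_le_mul_of_nonneg_left h1 (tailRatio_nonneg hq N)
        _ = tailRatio q N * ‖runSum k (runWeight k q) (N + 2)‖ +
          ‖q‖ ^ runSize k (N + 1) * (tailRatio q N * ‖1 - q ^ (N + 1)‖) *
            ‖runSum k (runWeight k q) (N + (k + 1) + 1)‖ := by ring
        _ = factorRatio q (N + 1) * (tailRatio q (N + 1) * ‖runSum k (runWeight k q) (N + 2)‖) +
          realRunWeight k ‖q‖ (N + 1) * tailRatio q (N + 1) *
            ‖runSum k (runWeight k q) (N + (k + 1) + 1)‖ := by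
            rw [tailRatio_mul hq, tailRatio_eq hq N, realRunWeight]
            ring
        _ ≤ factorRatio q (N + 1) * (tailRatio q (N + 1) * ‖runSum k (runWeight k q) (N + 2)‖) +
          realRunWeight k ‖q‖ (N + 1) * (factorRatio q (N + 2) * tailRatio q (N + (k + 1))) *
            ‖runSum k (runWeight k q) (N + (k + 1) + 1)‖ := by
            gcongr
            exact realRunWeight_nonneg h0 hq _ _
        _ = _ := by ring
    · intro N _
      have h1 : H (N + 1) = H (N + 2) + realRunWeight k ‖q‖ (N + 1) * H (N + (k + 1) + 1) := by
        simp only [hH]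
        rw [realRunSum_eq_add (summable_abs_realRunWeight hk h0 hq) (N + 1),
          show N + 1 + k + 1 = N + (k + 1) + 1 by ring]
      have h2 : factorRatio q (N + 1) * e (N + 1) ≤ e N :=
        hstep N 1 (by omega) (by
          rcases le_or_gt M (N + 1) with h | h
          · exact Or.inl h
          · exact Or.inr (hM _ (by omega) (by omega))) _ (by omega) (by omega)
      have h3 : factorRatio q (N + 2) * e (N + (k + 1)) ≤ e N :=
        hstep N 2 (by omega) (by
          rcases le_or_gt M (N + 1) with h | h
          · exact Or.inl h
          · exact Or.inr (hM _ (by omega) (by omega))) _ (by omega) (by omega)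
      have h4 := mul_le_mul_of_nonneg_left h2 (zero_le_one.trans (hH1 (N + 2)))
      have h5 := mul_le_mul_of_nonneg_left h3 (mul_nonneg (realRunWeight_nonneg h0 hq k (N + 1))
        (zero_le_one.trans (hH1 (N + (k + 1) + 1))))
      rw [h1]
      calc _ = H (N + 2) * (factorRatio q (N + 1) * e (N + 1)) +
            realRunWeight k ‖q‖ (N + 1) * H (N + (k + 1) + 1) *
              (factorRatio q (N + 2) * e (N + (k + 1))) := by ring
        _ ≤ _ := by linarith
    · have h1 := (tendsto_tailRatio hq).mul ((tendsto_add_atTop_iff_nat 1).2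
        (tendsto_runSum (k := k) (summable_norm_runWeight hk hq)).norm)
      simpa using h1
    · have h1 : Tendsto e atTop (𝓝 1) := by
        refine tendsto_const_nhds.congr' ?_
        filter_upwards [eventually_ge_atTop M] with N hN
        simp only [he]
        rw [show M - 1 - N = 0 by omega]
        simp
      have h2 := ((tendsto_add_atTop_iff_nat 1).2
        (tendsto_realRunSum (k := k) (summable_abs_realRunWeight hk h0 hq))).mul h1
      simpa using h2
  -- pass from the tail ratios to the full product
  have hP : 0 < partitionSum ‖q‖ := zero_lt_one.trans_le (one_le_partitionSum h0 hq)
  have hR0 : ‖avoidGenFun ∅ q‖ = partitionSum ‖q‖ * tailRatio q 0 := by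
    simp only [tailRatio, Finset.range_zero, Finset.prod_empty, mul_one]
    field_simp
  have hm0 := main 0
  have hmk := main k
  have he0 : e 0 ≤ e k := by
    simp only [he]
    rw [Real.exp_le_exp, neg_le_neg_iff]
    gcongr
    omega
  have hRk : tailRatio q 0 * ‖runSum k (runWeight k q) (k + 1)‖ ≤ H (k + 1) * e k :=
    (mul_le_mul_of_nonneg_right (tailRatio_mono hq (Nat.zero_le k)) (norm_nonneg _)).trans hmk
  have hR1 : tailRatio q 0 * ‖runSum k (runWeight k q) 1‖ ≤ H 1 * e k :=
    hm0.trans (mul_le_mul_of_nonneg_left he0 (zero_le_one.trans (hH1 1)))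
  rw [norm_mul, hR0, mul_assoc, mul_assoc]
  refine mul_le_mul_of_nonneg_left ?_ hP.le
  calc tailRatio q 0 * ‖runFactor k q‖
      ≤ tailRatio q 0 * (‖runSum k (runWeight k q) 1‖ +
        ‖q‖ ^ runSize k 0 * ‖runSum k (runWeight k q) (k + 1)‖) := by
        refine mul_le_mul_of_nonneg_left ?_ (tailRatio_nonneg hq 0)
        rw [runFactor, ← norm_pow, ← norm_mul]
        exact norm_add_le _ _
    _ = tailRatio q 0 * ‖runSum k (runWeight k q) 1‖ +
        ‖q‖ ^ runSize k 0 * (tailRatio q 0 * ‖runSum k (runWeight k q) (k + 1)‖) := by ring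
    _ ≤ H 1 * e k + ‖q‖ ^ runSize k 0 * (H (k + 1) * e k) := by gcongr
    _ = realRunFactor k ‖q‖ * e k := by
        rw [realRunFactor]
        ring

/-! ### Bounds on a circle, away from the positive real axis -/

/-- Compared with its value at `|z|`, the factor `1 / |1 - z|` is small where `z` is not close to
the positive real axis. The logarithms of both sides are power series in `z`, and only the linear
terms are used. -/
lemma one_sub_norm_le_mul_exp {z : ℂ} (hz : ‖z‖ < 1) :
    1 - ‖z‖ ≤ ‖1 - z‖ * Real.exp (z.re - ‖z‖) := by
  have hz1 : 1 - z ≠ 0 := by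
    intro h
    have : z = 1 := (sub_eq_zero.1 h).symm
    rw [this, norm_one] at hz
    exact lt_irrefl _ hz
  have h1 := Complex.hasSum_re (Complex.hasSum_taylorSeries_neg_log hz)
  have h2 := Real.hasSum_pow_div_log_of_abs_lt_one (x := ‖z‖) (by rwa [abs_norm])
  rw [← hasSum_nat_add_iff' 1] at h1
  simp only [Finset.sum_range_one, pow_zero, Nat.cast_zero, div_zero, Complex.zero_re,
    sub_zero, Complex.neg_re, Complex.log_re] at h1
  have h3 := h2.sub h1
  have h4 : ‖z‖ - z.re ≤ -Real.log (1 - ‖z‖) - -Real.log ‖1 - z‖ := by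
    have h5 : ∀ n : ℕ,
        0 ≤ ‖z‖ ^ (n + 1) / ((n : ℝ) + 1) - (z ^ (n + 1) / ((n + 1 : ℕ) : ℂ)).re := by
      intro n
      rw [sub_nonneg]
      refine (Complex.re_le_norm _).trans (le_of_eq ?_)
      rw [norm_div, norm_pow, Complex.norm_natCast]
      push_cast
      rfl
    have := h3.summable.le_tsum 0 (fun n _ => h5 n)
    rw [h3.tsum_eq] at this
    simpa using this
  have h5 : 0 < 1 - ‖z‖ := by linarith
  rw [← Real.exp_log h5, ← Real.exp_log (norm_pos_iff.2 hz1), ← Real.exp_add, Real.exp_le_exp]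
  linarith

/-- The partition generating function off the positive real axis, compared with its value at
`|q|`. -/
lemma norm_avoidGenFun_le_mul_exp {q : ℂ} (hq : ‖q‖ < 1) :
    ‖avoidGenFun ∅ q‖ ≤ partitionSum ‖q‖ * Real.exp (‖q‖ / ‖1 - q‖ - ‖q‖ / (1 - ‖q‖)) := by
  have h0 := norm_nonneg q
  have hP := one_le_partitionSum h0 hq
  have hsq : HasSum (fun i : ℕ => (q ^ (i + 1)).re) (q / (1 - q)).re := by
    have := (hasSum_geometric_of_norm_lt_one hq).mul_left q
    refine (Complex.hasSum_re this).congr_fun fun i => ?_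
    rw [pow_succ']
  have hsr : HasSum (fun i : ℕ => ‖q‖ ^ (i + 1)) (‖q‖ / (1 - ‖q‖)) := by
    have := (hasSum_geometric_of_lt_one h0 hq).mul_left ‖q‖
    refine this.congr_fun fun i => ?_
    rw [pow_succ']
  have hfin : ∀ N, ‖avoidGenFun ∅ q‖ *
      (partitionSum ‖q‖ * ∏ i ∈ Finset.range N, (1 - ‖q‖ ^ (i + 1))) ≤
      partitionSum ‖q‖ * ‖avoidGenFun ∅ q * ∏ i ∈ Finset.range N, (1 - q ^ (i + 1))‖ *
      Real.exp (∑ i ∈ Finset.range N, (q ^ (i + 1)).re - ∑ i ∈ Finset.range N, ‖q‖ ^ (i + 1)) := by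
    intro N
    rw [← Finset.sum_sub_distrib, Real.exp_sum, norm_mul, norm_prod]
    have : ∏ i ∈ Finset.range N, (1 - ‖q‖ ^ (i + 1)) ≤ (∏ i ∈ Finset.range N, ‖1 - q ^ (i + 1)‖) *
        ∏ i ∈ Finset.range N, Real.exp ((q ^ (i + 1)).re - ‖q‖ ^ (i + 1)) := by
      rw [← Finset.prod_mul_distrib]
      refine Finset.prod_le_prod (fun i _ => (one_sub_norm_pow_pos hq i).le) fun i _ => ?_
      have := one_sub_norm_le_mul_exp (z := q ^ (i + 1))
        (by rw [norm_pow]; exact pow_lt_one₀ h0 hq (Nat.succ_ne_zero i))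
      rwa [norm_pow] at this
    calc _ = ‖avoidGenFun ∅ q‖ * partitionSum ‖q‖ *
          ∏ i ∈ Finset.range N, (1 - ‖q‖ ^ (i + 1)) := by ring
      _ ≤ _ := mul_le_mul_of_nonneg_left this (mul_nonneg (norm_nonneg _) (by linarith))
      _ = _ := by ring
  have hlim := le_of_tendsto_of_tendsto'
    ((tendsto_partitionSum_mul_prod h0 hq).const_mul ‖avoidGenFun ∅ q‖)
    (((tendsto_avoidGenFun_mul_prod hq).norm.const_mul (partitionSum ‖q‖)).mul
      ((hsq.tendsto_sum_nat.sub hsr.tendsto_sum_nat).rexp)) hfin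
  rw [mul_one, norm_one, mul_one] at hlim
  refine hlim.trans ?_
  gcongr
  refine (Complex.re_le_norm _).trans (le_of_eq ?_)
  rw [norm_div]

lemma one_add_le_exp_sub {x : ℝ} (h0 : 0 ≤ x) (h1 : x ≤ 1) :
    1 + x ≤ Real.exp (x - x ^ 2 / 4) := by
  have h2 : 0 ≤ x - x ^ 2 / 4 := by nlinarith
  refine le_trans ?_ (Real.quadratic_le_exp_of_nonneg h2)
  nlinarith [mul_nonneg (sq_nonneg x) (sub_nonneg.2 h1), mul_nonneg h0 (sub_nonneg.2 h1),
    sq_nonneg (x ^ 2)]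

/-- A supersolution for the absolute values of the run sums; it dominates `∏ (1 + r ^ i)`, the
product over `i ≥ j`, because `1 + x ≤ e ^ (x - x ^ 2 / 4)` on the unit interval. -/
noncomputable def runMajorant (r : ℝ) (j : ℕ) : ℝ :=
  Real.exp (r ^ j / (1 - r) - (r ^ 2) ^ j / (4 * (1 - r ^ 2)))

lemma runMajorant_eq {r : ℝ} (h0 : 0 ≤ r) (h1 : r < 1) (j : ℕ) :
    runMajorant r j = Real.exp (r ^ j - (r ^ j) ^ 2 / 4) * runMajorant r (j + 1) := by
  have h2 : 1 - r ≠ 0 := by linarith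
  have h3 : 1 - r ^ 2 ≠ 0 := by nlinarith
  rw [runMajorant, runMajorant, ← Real.exp_add]
  congr 1
  rw [pow_succ r j, pow_succ (r ^ 2) j, ← pow_mul r 2 j, mul_comm 2 j, pow_mul]
  field_simp
  ring

lemma one_add_mul_runMajorant_le {r : ℝ} (h0 : 0 ≤ r) (h1 : r < 1) (j : ℕ) :
    (1 + r ^ j) * runMajorant r (j + 1) ≤ runMajorant r j := by
  rw [runMajorant_eq h0 h1 j]
  exact mul_le_mul_of_nonneg_right
    (one_add_le_exp_sub (by positivity) (pow_le_one₀ h0 h1.le)) (Real.exp_pos _).le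

lemma runMajorant_antitone {r : ℝ} (h0 : 0 ≤ r) (h1 : r < 1) : Antitone (runMajorant r) :=
  antitone_nat_of_succ_le fun j => by
    have h2 := one_add_mul_runMajorant_le h0 h1 j
    have h3 : 0 ≤ r ^ j * runMajorant r (j + 1) :=
      mul_nonneg (by positivity) (Real.exp_pos _).le
    linarith

lemma tendsto_runMajorant {r : ℝ} (h0 : 0 ≤ r) (h1 : r < 1) :
    Tendsto (runMajorant r) atTop (𝓝 1) := by
  have h2 : r ^ 2 < 1 := by nlinarith
  have h3 := ((tendsto_pow_atTop_nhds_zero_of_lt_one h0 h1).div_const (1 - r)).sub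
    ((tendsto_pow_atTop_nhds_zero_of_lt_one (sq_nonneg r) h2).div_const (4 * (1 - r ^ 2)))
  have h4 := h3.rexp
  simp only [zero_div, sub_zero, Real.exp_zero] at h4
  exact h4

lemma norm_runSum_le_runMajorant {k : ℕ} (hk : 1 ≤ k) {q : ℂ} (hq : ‖q‖ < 1) {j : ℕ}
    (hj : 1 ≤ j) : ‖runSum k (runWeight k q) j‖ ≤ runMajorant ‖q‖ j := by
  have h0 := norm_nonneg q
  refine le_of_backward_recursion (j₀ := 1) (m := k + 1)
    (u := fun j => ‖runSum k (runWeight k q) j‖) (v := runMajorant ‖q‖) (b := fun _ => 1)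
    (c := fun j => ‖q‖ ^ (j + 1) * (1 + ‖q‖ ^ j)) (by omega) (fun _ => zero_le_one)
    (fun j => by positivity) ?_ ?_ ?_ (tendsto_runMajorant h0 hq) hj
  · intro j hj
    rw [runSum_eq_add (summable_norm_runWeight hk hq) j]
    refine (norm_add_le _ _).trans ?_
    rw [norm_mul, norm_runWeight, one_mul]
    have h1 : ‖q‖ ^ runSize k j ≤ ‖q‖ ^ (j + 1) :=
      pow_le_pow_of_le_one h0 hq.le (runSize_ge hk j)
    have h2 : ‖1 - q ^ j‖ ≤ 1 + ‖q‖ ^ j := by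
      refine (norm_sub_le _ _).trans (le_of_eq ?_)
      rw [norm_one, norm_pow]
    gcongr
    exact le_rfl
  · intro j hj
    set x := ‖q‖ ^ j with hx
    have hx0 : 0 ≤ x := by positivity
    have h1 := one_add_mul_runMajorant_le h0 hq j
    have h2 := one_add_mul_runMajorant_le h0 hq (j + 1)
    have h3 : runMajorant ‖q‖ (j + (k + 1)) ≤ runMajorant ‖q‖ (j + 2) :=
      runMajorant_antitone h0 hq (by omega)
    have h4 : ‖q‖ ^ (j + 1) * (1 + x) ≤ x * (1 + ‖q‖ ^ (j + 1)) := by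
      rw [pow_succ, ← hx]
      nlinarith
    have h5 : 0 ≤ runMajorant ‖q‖ (j + 2) := (Real.exp_pos _).le
    calc 1 * runMajorant ‖q‖ (j + 1) + ‖q‖ ^ (j + 1) * (1 + x) * runMajorant ‖q‖ (j + (k + 1))
        ≤ 1 * runMajorant ‖q‖ (j + 1) + x * (1 + ‖q‖ ^ (j + 1)) * runMajorant ‖q‖ (j + 2) := by
          gcongr
          exact (Real.exp_pos _).le
      _ = runMajorant ‖q‖ (j + 1) + x * ((1 + ‖q‖ ^ (j + 1)) * runMajorant ‖q‖ (j + 1 + 1)) := by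
          ring
      _ ≤ runMajorant ‖q‖ (j + 1) + x * runMajorant ‖q‖ (j + 1) := by gcongr
      _ ≤ runMajorant ‖q‖ j := by linarith
  · simpa using (tendsto_runSum (k := k) (summable_norm_runWeight hk hq)).norm

/-- Far from the positive real axis the generating function is exponentially smaller than on it:
there the partition factor loses more than the run factor can gain. -/
lemma norm_genFun_le_of_norm_one_sub {k : ℕ} (hk : 1 ≤ k) {q : ℂ} (hq : ‖q‖ < 1)
    (hq2 : 1 / 2 ≤ ‖q‖) (hfar : 24 * (1 - ‖q‖) ≤ ‖1 - q‖) :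
    ‖avoidGenFun ∅ q * runFactor k q‖ ≤ 2 * (partitionSum ‖q‖ * realRunFactor k ‖q‖) *
      Real.exp (-(‖q‖ / (1 - ‖q‖) / 24)) := by
  have h0 := norm_nonneg q
  have hr : 0 < 1 - ‖q‖ := by linarith
  set X := ‖q‖ / (1 - ‖q‖) with hX
  have hX0 : 0 ≤ X := div_nonneg h0 hr.le
  -- the quadratic term of the majorant leaves room for the factor `e ^ (-X / 12)`
  have hmaj : runMajorant ‖q‖ 1 ≤ Real.exp (11 / 12 * X) := by
    rw [runMajorant, Real.exp_le_exp, pow_one, pow_one]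
    have h1 : ‖q‖ ^ 2 / (4 * (1 - ‖q‖ ^ 2)) = X * (‖q‖ / (4 * (1 + ‖q‖))) := by
      rw [hX]
      have : 1 - ‖q‖ ^ 2 ≠ 0 := by nlinarith
      field_simp
      ring
    have h2 : 1 / 12 ≤ ‖q‖ / (4 * (1 + ‖q‖)) := by
      rw [div_le_div_iff₀ (by norm_num) (by positivity)]
      linarith
    rw [h1]
    nlinarith
  have hfac : ‖runFactor k q‖ ≤ 2 * Real.exp (11 / 12 * X) := by
    have h1 := norm_runSum_le_runMajorant hk hq (le_refl 1)
    have h2 := (norm_runSum_le_runMajorant hk hq (j := k + 1) (by omega)).trans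
      (runMajorant_antitone h0 hq (show 1 ≤ k + 1 by omega))
    have h3 : ‖q‖ ^ runSize k 0 ≤ 1 := pow_le_one₀ h0 hq.le
    rw [runFactor]
    refine (norm_add_le _ _).trans ?_
    rw [norm_mul, norm_pow]
    have h4 : ‖q‖ ^ runSize k 0 * ‖runSum k (runWeight k q) (k + 1)‖ ≤ 1 * runMajorant ‖q‖ 1 := by
      gcongr
    linarith
  have hP := norm_avoidGenFun_le_mul_exp hq
  have hPpos := one_le_partitionSum h0 hq
  have hH := one_le_realRunFactor hk h0 hq
  have hX24 : ‖q‖ / ‖1 - q‖ ≤ X / 24 := by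
    rw [hX, div_div]
    exact div_le_div_of_nonneg_left h0 (by positivity) (by linarith)
  rw [norm_mul]
  calc ‖avoidGenFun ∅ q‖ * ‖runFactor k q‖
      ≤ (partitionSum ‖q‖ * Real.exp (‖q‖ / ‖1 - q‖ - X)) * (2 * Real.exp (11 / 12 * X)) := by
        gcongr
    _ = 2 * partitionSum ‖q‖ * Real.exp (‖q‖ / ‖1 - q‖ - X + 11 / 12 * X) := by
        rw [Real.exp_add]
        ring
    _ ≤ 2 * partitionSum ‖q‖ * Real.exp (-(X / 24)) := by
        gcongr
        linarith
    _ = 2 * (partitionSum ‖q‖ * 1) * Real.exp (-(X / 24)) := by ring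
    _ ≤ _ := by gcongr

lemma norm_exp_neg_add_mul_I (t θ : ℝ) :
    ‖Complex.exp (-(t : ℂ) + θ * Complex.I)‖ = Real.exp (-t) := by
  rw [Complex.norm_exp]
  simp

/-- `|1 - qⁿ|²` in polar coordinates, with the cosine estimated by a quadratic. -/
lemma sq_norm_one_sub_pow_ge {t θ : ℝ} {n : ℕ} (hn : |n * θ| ≤ Real.pi) :
    (1 - Real.exp (-t) ^ n) ^ 2 + 2 * Real.exp (-t) ^ n * (2 / Real.pi ^ 2 * (n * θ) ^ 2) ≤
      ‖1 - Complex.exp (-(t : ℂ) + θ * Complex.I) ^ n‖ ^ 2 := by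
  have h1 : Complex.exp (-(t : ℂ) + θ * Complex.I) ^ n =
      Complex.exp (((-(n * t) : ℝ) : ℂ) + ((n * θ : ℝ) : ℂ) * Complex.I) := by
    rw [← Complex.exp_nat_mul]
    congr 1
    push_cast
    ring
  have h2 : Real.exp (-t) ^ n = Real.exp (-(n * t)) := by
    rw [← Real.exp_nat_mul]
    congr 1
    ring
  have h3 := Real.cos_le_one_sub_mul_cos_sq hn
  have h4 := Real.sin_sq_add_cos_sq (n * θ)
  have h5 := Real.exp_pos (-(n * t))
  rw [h1, h2, Complex.sq_norm, Complex.normSq_apply]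
  simp only [Complex.sub_re, Complex.sub_im, Complex.exp_re, Complex.exp_im, Complex.one_re,
    Complex.one_im, Complex.add_re, Complex.add_im, Complex.ofReal_re, Complex.ofReal_im,
    Complex.mul_re, Complex.mul_im, Complex.I_re, Complex.I_im, mul_zero, mul_one, sub_zero,
    add_zero, zero_add]
  set ρ := Real.exp (-(n * t))
  have h6 := mul_le_mul_of_nonneg_left h3 h5.le
  have h7 : ρ ^ 2 * (Real.sin (n * θ) ^ 2 + Real.cos (n * θ) ^ 2) = ρ ^ 2 := by rw [h4, mul_one]
  linarith

/-- Uniform decay of the generating function on the circle of radius `e ^ (-t)`. -/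
theorem norm_genFun_le {k : ℕ} (hk : 1 ≤ k) : ∃ c > 0, ∃ t₀ > 0, ∀ t : ℝ, 0 < t → t < t₀ →
    ∀ θ : ℝ, |θ| ≤ Real.pi →
      ‖avoidGenFun ∅ (Complex.exp (-(t : ℂ) + θ * Complex.I)) *
        runFactor k (Complex.exp (-(t : ℂ) + θ * Complex.I))‖ ≤
      2 * (partitionSum (Real.exp (-t)) * realRunFactor k (Real.exp (-t))) *
        Real.exp (-(c * min (θ ^ 2 / t ^ 3) (1 / t))) := by
  refine ⟨1 / (1280000 * (k + 1)), by positivity, 1 / (128 * (k + 2)), by positivity, ?_⟩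
  intro t ht0 ht θ hθ
  set q := Complex.exp (-(t : ℂ) + θ * Complex.I) with hq
  set r := Real.exp (-t) with hr
  have hqr : ‖q‖ = r := norm_exp_neg_add_mul_I t θ
  have hr0 : 0 < r := Real.exp_pos _
  have hr1 : r < 1 := by rw [hr, Real.exp_lt_one_iff]; linarith
  have hqlt : ‖q‖ < 1 := hqr ▸ hr1
  have hk0 : (1 : ℝ) ≤ k := by exact_mod_cast hk
  have htk : t * (128 * (k + 2)) < 1 := by rwa [lt_div_iff₀ (by positivity)] at ht
  have hrt : 1 - t ≤ r := by
    have := Real.add_one_le_exp (-t)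
    linarith
  have htsmall : t < 1 / 384 := by nlinarith
  have hG : 0 ≤ partitionSum r * realRunFactor k r := mul_nonneg
    (zero_le_one.trans (one_le_partitionSum hr0.le hr1))
    (zero_le_one.trans (one_le_realRunFactor hk hr0.le hr1))
  have hpi2 : Real.pi ^ 2 ≤ 10 := by
    have := Real.pi_lt_d2
    have := Real.pi_pos
    nlinarith
  have hpi2' : 0 < Real.pi ^ 2 := by positivity
  have hpi : 1 / 5 ≤ 2 / Real.pi ^ 2 := by
    rw [div_le_div_iff₀ (by norm_num) hpi2']
    linarith
  rcases le_total |θ| (64 * t) with hnear | hfar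
  · -- Near the positive real axis `θ / t` is bounded, and `|1 - q ^ i|²` exceeds
    -- `(1 - |q| ^ i)²` at least by the factor `1 + z` with `z` a multiple of `(θ / t)²`, for all
    -- `i ≤ M ≈ 1 / (64 t)`. As `z` is bounded, `1 + z ≥ e ^ (2 η)` for a small multiple `η` of `z`.
    set η := θ ^ 2 / (10000 * t ^ 2) with hη
    set M := ⌊1 / (64 * t)⌋₊ with hMdef
    have hM : (M : ℝ) ≤ 1 / (64 * t) := Nat.floor_le (by positivity)
    have hM' : 1 / (64 * t) < M + 1 := Nat.lt_floor_add_one _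
    have hη0 : 0 ≤ η := by positivity
    have hfac : ∀ i, 1 ≤ i → i ≤ M → factorRatio q i ≤ Real.exp (-η) := by
      intro i hi hiM
      have hi0 : (0 : ℝ) < i := by exact_mod_cast hi
      have hit : (i : ℝ) * t ≤ 1 / 64 := by
        have h1 : (i : ℝ) ≤ 1 / (64 * t) := le_trans (by exact_mod_cast hiM) hM
        rw [le_div_iff₀ (by positivity)] at h1
        linarith
      have hiθ : |i * θ| ≤ 1 := by
        rw [abs_mul, abs_of_pos hi0]
        nlinarith
      have hge := sq_norm_one_sub_pow_ge (t := t) (θ := θ) (n := i)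
        (hiθ.trans (by linarith [Real.pi_gt_three]))
      rw [← hq, ← hr] at hge
      have hri : r ^ i = Real.exp (-(i * t)) := by
        rw [hr, ← Real.exp_nat_mul]
        congr 1
        ring
      have hri1 : 1 - i * t ≤ r ^ i := by
        rw [hri]
        linarith [Real.add_one_le_exp (-(i * t : ℝ))]
      have hri2 : r ^ i ≤ 1 := pow_le_one₀ hr0.le hr1.le
      have hri3 : r ^ i < 1 := pow_lt_one₀ hr0.le hr1 (by omega)
      set z := θ ^ 2 / (5 * t ^ 2) with hz
      have hz0 : 0 ≤ z := by positivity
      have hz1 : z ≤ 999 := by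
        rw [hz, div_le_iff₀ (by positivity)]
        have : θ ^ 2 ≤ (64 * t) ^ 2 := sq_le_sq' (by linarith [neg_abs_le θ]) (by
          linarith [le_abs_self θ])
        nlinarith
      have hsq : (1 - r ^ i) ^ 2 * (1 + z) ≤ ‖1 - q ^ i‖ ^ 2 := by
        refine le_trans ?_ hge
        have h1 : (1 - r ^ i) ^ 2 * z ≤ (i * t) ^ 2 * z := by
          gcongr
          linarith
        have h2 : (i * t : ℝ) ^ 2 * z = 1 / 5 * (i * θ) ^ 2 := by
          rw [hz]
          field_simp
        have h3 : 1 / 5 * (i * θ) ^ 2 ≤ 2 / Real.pi ^ 2 * (i * θ) ^ 2 := by gcongr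
        have h4 : 1 * (2 / Real.pi ^ 2 * (i * θ) ^ 2) ≤
            2 * r ^ i * (2 / Real.pi ^ 2 * (i * θ) ^ 2) := by
          gcongr
          linarith
        linarith
      have hexp : 1 ≤ (1 + z) * Real.exp (-(2 * η)) := by
        have h1 : 1 - z / (1 + z) ≤ Real.exp (-(z / (1 + z))) := by
          linarith [Real.add_one_le_exp (-(z / (1 + z)))]
        have h2 : Real.exp (-(z / (1 + z))) ≤ Real.exp (-(2 * η)) := by
          rw [Real.exp_le_exp, neg_le_neg_iff]
          have : 2 * η = z / 1000 := by
            rw [hη, hz]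
            field_simp
            ring
          rw [this]
          gcongr
          linarith
        have h3 : (1 + z) * (1 - z / (1 + z)) = 1 := by
          field_simp
          ring
        exact h3.symm.trans_le (mul_le_mul_of_nonneg_left (h1.trans h2) (by linarith))
      have hpos := (sub_pos.2 hri3)
      have hpos' : 0 < ‖1 - q ^ i‖ := hpos.trans_le (hqr ▸ one_sub_norm_pow_le i)
      rw [factorRatio, hqr, div_le_iff₀ hpos']
      refine le_of_sq_le_sq ?_ (by positivity)
      have hexp2 : Real.exp (-η) ^ 2 = Real.exp (-(2 * η)) := by
        rw [← Real.exp_nat_mul]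
        congr 1
        push_cast
        ring
      rw [mul_pow, hexp2]
      calc (1 - r ^ i) ^ 2 = (1 - r ^ i) ^ 2 * 1 := by ring
        _ ≤ (1 - r ^ i) ^ 2 * ((1 + z) * Real.exp (-(2 * η))) := by gcongr
        _ = Real.exp (-(2 * η)) * ((1 - r ^ i) ^ 2 * (1 + z)) := by ring
        _ ≤ Real.exp (-(2 * η)) * ‖1 - q ^ i‖ ^ 2 := by gcongr
    have h1 := norm_genFun_le_of_factorRatio hk hqlt hη0 hfac
    rw [hqr] at h1
    have h2 : 1 / (128 * t) ≤ ((M - 1 - k : ℕ) : ℝ) := by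
      have h3 : (M : ℝ) - 1 - k ≤ ((M - 1 - k : ℕ) : ℝ) := by
        rw [sub_le_iff_le_add, sub_le_iff_le_add]
        exact_mod_cast (by omega : M ≤ M - 1 - k + k + 1)
      have h4 : 1 / (64 * t) = 1 / (128 * t) + 1 / (128 * t) := by
        field_simp
        norm_num
      have h5 : (k : ℝ) + 2 ≤ 1 / (128 * t) := by
        rw [le_div_iff₀ (by positivity)]
        linarith
      linarith
    have h6 : 1 / (1280000 * ((k : ℝ) + 1)) * min (θ ^ 2 / t ^ 3) (1 / t) ≤
        η * ((M - 1 - k : ℕ) : ℝ) / (k + 1) := by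
      calc 1 / (1280000 * ((k : ℝ) + 1)) * min (θ ^ 2 / t ^ 3) (1 / t)
          ≤ 1 / (1280000 * ((k : ℝ) + 1)) * (θ ^ 2 / t ^ 3) := by
            gcongr
            exact min_le_left _ _
        _ = η * (1 / (128 * t)) / (k + 1) := by
            rw [hη]
            field_simp
            ring
        _ ≤ _ := by gcongr
    refine h1.trans ?_
    have h7 : Real.exp (-(η * ((M - 1 - k : ℕ) : ℝ) / (k + 1))) ≤
        Real.exp (-(1 / (1280000 * ((k : ℝ) + 1)) * min (θ ^ 2 / t ^ 3) (1 / t))) := by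
      rw [Real.exp_le_exp, neg_le_neg_iff]
      exact h6
    calc _ ≤ partitionSum r * realRunFactor k r *
        Real.exp (-(1 / (1280000 * ((k : ℝ) + 1)) * min (θ ^ 2 / t ^ 3) (1 / t))) := by gcongr
      _ ≤ _ := by
        refine mul_le_mul_of_nonneg_right ?_ (Real.exp_pos _).le
        linarith
  · -- Away from the positive real axis `|1 - q|` is at least `24 (1 - |q|)`.
    have hge := sq_norm_one_sub_pow_ge (t := t) (θ := θ) (n := 1) (by simpa using hθ)
    rw [← hq, ← hr, pow_one, pow_one, Nat.cast_one, one_mul] at hge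
    have hfar' : 24 * (1 - ‖q‖) ≤ ‖1 - q‖ := by
      rw [hqr]
      refine le_of_sq_le_sq ?_ (norm_nonneg _)
      have h1 : (24 * (1 - r)) ^ 2 ≤ (24 * t) ^ 2 := by
        gcongr
        linarith
      have h2 : (64 * t) ^ 2 ≤ θ ^ 2 := by
        rw [← sq_abs θ]
        gcongr
      have h3 : 1 / 5 * θ ^ 2 ≤ 2 / Real.pi ^ 2 * θ ^ 2 := by gcongr
      have h4 : 9 / 10 * (2 / Real.pi ^ 2 * θ ^ 2) ≤ r * (2 / Real.pi ^ 2 * θ ^ 2) := by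
        gcongr
        linarith
      nlinarith [sq_nonneg (1 - r)]
    have h1 := norm_genFun_le_of_norm_one_sub hk hqlt (by rw [hqr]; linarith) hfar'
    rw [hqr] at h1
    refine h1.trans ?_
    have h2 : 1 / (2 * t) ≤ r / (1 - r) := by
      rw [div_le_div_iff₀ (by positivity) (by linarith)]
      nlinarith
    have h3 : 1 / (1280000 * ((k : ℝ) + 1)) * min (θ ^ 2 / t ^ 3) (1 / t) ≤ r / (1 - r) / 24 := by
      calc 1 / (1280000 * ((k : ℝ) + 1)) * min (θ ^ 2 / t ^ 3) (1 / t)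
          ≤ 1 / 48 * (1 / t) := by
            gcongr
            · linarith
            · exact min_le_right _ _
        _ = 1 / (2 * t) / 24 := by
            field_simp
            norm_num
        _ ≤ _ := by gcongr
    gcongr

/-! ### The partition generating function near `1` -/

/-- The value of `∏ (1 - e ^ (-(n + 1) t))`. -/
noncomputable def eulerProd (t : ℝ) : ℂ := ∏' n : ℕ, (1 - (Real.exp (-t) : ℂ) ^ (n + 1))

lemma partitionSum_mul_eulerProd {t : ℝ} (ht : 0 < t) :
    (partitionSum (Real.exp (-t)) : ℂ) * eulerProd t = 1 := by
  have hr0 : 0 < Real.exp (-t) := Real.exp_pos _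
  have hr1 : Real.exp (-t) < 1 := by rw [Real.exp_lt_one_iff]; linarith
  have hq : ‖(Real.exp (-t) : ℂ)‖ < 1 := by
    rwa [Complex.norm_real, Real.norm_of_nonneg hr0.le]
  have h1 := tendsto_avoidGenFun_mul_prod hq
  have h2 := (ModularForm.multipliable_one_sub_pow hq).hasProd.tendsto_prod_nat.const_mul
    (avoidGenFun ∅ (Real.exp (-t) : ℂ))
  rw [← avoidGenFun_ofReal]
  exact tendsto_nhds_unique h2 h1

/-- `eulerProd` and the Dedekind eta function on the imaginary axis. -/
lemma eta_ofReal_mul_I (t : ℝ) :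
    ModularForm.eta ((t / (2 * Real.pi) : ℝ) * Complex.I) =
      Complex.exp (-(t / 24 : ℝ)) * eulerProd t := by
  have hpi : (Real.pi : ℂ) ≠ 0 := Complex.ofReal_ne_zero.2 Real.pi_ne_zero
  unfold ModularForm.eta eulerProd
  congr 1
  · rw [Function.Periodic.qParam]
    congr 1
    push_cast
    field_simp
    rw [Complex.I_sq]
    ring
  · congr 1
    ext n
    rw [ModularForm.eta_q_eq_pow, Complex.ofReal_exp]
    congr 3
    push_cast
    field_simp
    rw [Complex.I_sq]
    ring

/-- The transformation of the Dedekind eta function under `z ↦ -1 / z` on the imaginary axis. -/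
lemma eulerProd_transform {t : ℝ} (ht : 0 < t) :
    Complex.exp (-(Real.pi ^ 2 / (6 * t) : ℝ)) * eulerProd (4 * Real.pi ^ 2 / t) =
      (√(t / (2 * Real.pi)) : ℝ) * (Complex.exp (-(t / 24 : ℝ)) * eulerProd t) := by
  have hpi := Real.pi_pos
  have ha : 0 < t / (2 * Real.pi) := by positivity
  have hz : ((t / (2 * Real.pi) : ℝ) * Complex.I : ℂ) ∈ UpperHalfPlane.upperHalfPlaneSet := by
    rw [UpperHalfPlane.upperHalfPlaneSet, Set.mem_ofPred_eq, Complex.im_ofReal_mul, Complex.I_im,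
      mul_one]
    exact ha
  have h := ModularForm.eta_comp_eq_csqrt_I_inv hz
  have hinv : (-1 / ((t / (2 * Real.pi) : ℝ) * Complex.I) : ℂ) =
      ((4 * Real.pi ^ 2 / t / (2 * Real.pi) : ℝ) : ℂ) * Complex.I := by
    have h1 : (t : ℂ) ≠ 0 := Complex.ofReal_ne_zero.2 ht.ne'
    have h2 : (Real.pi : ℂ) ≠ 0 := Complex.ofReal_ne_zero.2 hpi.ne'
    push_cast
    field_simp
    rw [Complex.I_sq]
    ring
  simp only [Function.comp_apply, Pi.smul_apply, Pi.mul_apply, smul_eq_mul] at h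
  rw [hinv, eta_ofReal_mul_I, eta_ofReal_mul_I] at h
  have hI : Complex.I.sqrt ≠ 0 := by
    rw [Complex.sqrt, Complex.cpow_def_of_ne_zero Complex.I_ne_zero]
    exact Complex.exp_ne_zero _
  have hs : (((t / (2 * Real.pi) : ℝ) : ℂ) * Complex.I).sqrt =
      (√(t / (2 * Real.pi)) : ℝ) * Complex.I.sqrt := by
    have h0 : ((t / (2 * Real.pi) : ℝ) : ℂ) ≠ 0 := Complex.ofReal_ne_zero.2 ha.ne'
    rw [Complex.sqrt, Complex.sqrt, Complex.cpow_def_of_ne_zero Complex.I_ne_zero,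
      Complex.cpow_def_of_ne_zero (mul_ne_zero h0 Complex.I_ne_zero),
      Complex.log_ofReal_mul ha Complex.I_ne_zero, add_mul, Complex.exp_add,
      Real.sqrt_eq_rpow, Real.rpow_def_of_pos ha, Complex.ofReal_exp]
    congr 3
    push_cast
    ring
  rw [hs] at h
  have hexp : Real.pi ^ 2 / (6 * t) = 4 * Real.pi ^ 2 / t / 24 := by
    field_simp
    ring
  rw [hexp, h]
  field_simp

lemma tendsto_eulerProd_atTop : Tendsto eulerProd atTop (𝓝 1) := by
  have h1 : ContinuousAt (fun q : ℂ => ∏' n : ℕ, (1 - q ^ (n + 1))) 0 :=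
    (ModularForm.differentiableOn_tprod_one_sub_pow.differentiableAt
      (Metric.ball_mem_nhds 0 one_pos)).continuousAt
  have h2 : Tendsto (fun t : ℝ => ((Real.exp (-t) : ℝ) : ℂ)) atTop (𝓝 0) := by
    have := (Complex.continuous_ofReal.tendsto 0).comp
      (Real.tendsto_exp_atBot.comp tendsto_neg_atTop_atBot)
    rwa [Complex.ofReal_zero] at this
  have h3 := h1.tendsto.comp h2
  simp only [zero_pow (Nat.succ_ne_zero _), sub_zero, tprod_one] at h3
  exact h3

/-- The behaviour of the partition generating function as its argument tends to `1`. -/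
theorem tendsto_partitionSum : Tendsto (fun t : ℝ => partitionSum (Real.exp (-t)) /
    (√(t / (2 * Real.pi)) * Real.exp (Real.pi ^ 2 / (6 * t)))) (𝓝[>] 0) (𝓝 1) := by
  have hE : Tendsto (fun t : ℝ => eulerProd (4 * Real.pi ^ 2 / t)) (𝓝[>] 0) (𝓝 1) := by
    have h1 : Tendsto (fun t : ℝ => 4 * Real.pi ^ 2 * t⁻¹) (𝓝[>] 0) atTop :=
      tendsto_inv_nhdsGT_zero.const_mul_atTop (by positivity)
    exact tendsto_eulerProd_atTop.comp h1
  have h1 : Tendsto (fun t : ℝ => Complex.exp (-(t / 24 : ℝ)) / eulerProd (4 * Real.pi ^ 2 / t))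
      (𝓝[>] 0) (𝓝 1) := by
    have h2 : Tendsto (fun t : ℝ => Complex.exp (-(t / 24 : ℝ))) (𝓝[>] 0) (𝓝 1) := by
      have : Continuous fun t : ℝ => Complex.exp (-(t / 24 : ℝ)) := by fun_prop
      have h3 := (this.tendsto 0).mono_left (nhdsWithin_le_nhds (s := Set.Ioi 0))
      simpa using h3
    have h3 := h2.div hE one_ne_zero
    rw [div_one] at h3
    exact h3
  have h4 := (Complex.continuous_re.tendsto _).comp h1
  rw [Complex.one_re] at h4
  refine h4.congr' ?_
  filter_upwards [self_mem_nhdsWithin] with t ht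
  rw [Set.mem_Ioi] at ht
  have ht' : 0 < 4 * Real.pi ^ 2 / t := by positivity
  have hP := partitionSum_mul_eulerProd ht
  have hE0 : eulerProd (4 * Real.pi ^ 2 / t) ≠ 0 := fun h => by
    have := partitionSum_mul_eulerProd ht'
    rw [h, mul_zero] at this
    exact zero_ne_one this
  have htr := eulerProd_transform ht
  have hs : ((√(t / (2 * Real.pi)) : ℝ) : ℂ) ≠ 0 := Complex.ofReal_ne_zero.2 (by positivity)
  rw [Function.comp_apply]
  rw [← Complex.ofReal_re (partitionSum (Real.exp (-t)) / _)]
  congr 1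
  push_cast at htr hP hs ⊢
  generalize ((√(t / (2 * Real.pi)) : ℝ) : ℂ) = S at htr hs ⊢
  rw [Complex.exp_neg] at htr
  have he := Complex.exp_ne_zero ((Real.pi : ℂ) ^ 2 / (6 * t))
  rw [div_eq_div_iff hE0 (mul_ne_zero hs he)]
  field_simp at htr
  linear_combination (-(partitionSum (Real.exp (-t)) : ℂ)) * htr -
    Complex.exp (-(t / 24 : ℂ)) * S * Complex.exp ((Real.pi : ℂ) ^ 2 / (6 * t)) * hP

/-! ### Convergence of holomorphic functions from convergence on a real segment -/

/-- A uniformly bounded family of holomorphic functions on a disc that tends to zero at the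
points of a radius tends to zero on the whole disc: all Taylor coefficients at the centre tend to
zero, by induction, and the Taylor series are dominated by a geometric series. -/
lemma tendsto_zero_of_tendsto_zero_on_radius {ι : Type*} {l : Filter ι} {h : ι → ℂ → ℂ} {R C : ℝ}
    (hd : ∀ᶠ n in l, DifferentiableOn ℂ (h n) (Metric.ball 0 R))
    (hb : ∀ᶠ n in l, ∀ z ∈ Metric.ball (0 : ℂ) R, ‖h n z‖ ≤ C)
    (hr : ∀ s : ℝ, 0 < s → s < R → Tendsto (fun n => h n s) l (𝓝 0)) {z : ℂ} (hz : ‖z‖ < R) :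
    Tendsto (fun n => h n z) l (𝓝 0) := by
  obtain ⟨ρ, hρz, hρR⟩ := exists_between hz
  have hρ : 0 < ρ := (norm_nonneg z).trans_lt hρz
  obtain ⟨b, hbdef⟩ : ∃ b : ι → ℕ → ℂ, b = fun n j =>
    ((j.factorial : ℂ))⁻¹ * iteratedDeriv j (h n) 0 := ⟨_, rfl⟩
  have hsum : ∀ᶠ n in l, ∀ w : ℂ, ‖w‖ < R → HasSum (fun j => b n j * w ^ j) (h n w) := by
    filter_upwards [hd] with n hn w hw
    refine (Complex.hasSum_taylorSeries_on_ball hn (by simpa using hw)).congr_fun fun j => ?_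
    simp only [hbdef, sub_zero, smul_eq_mul]
    ring
  have hbound : ∀ᶠ n in l, ∀ j, ‖b n j‖ ≤ C / ρ ^ j := by
    filter_upwards [hd, hb] with n hn hnb j
    have h1 := Complex.norm_iteratedDeriv_le_of_forall_mem_sphere_norm_le j hρ
      (hn.diffContOnCl_ball (Metric.closedBall_subset_ball hρR))
      (fun w hw => hnb w (Metric.sphere_subset_closedBall.trans
        (Metric.closedBall_subset_ball hρR) hw))
    have h2 : (0 : ℝ) < j.factorial := by exact_mod_cast j.factorial_pos
    simp only [hbdef]
    rw [norm_mul, norm_inv, Complex.norm_natCast, inv_mul_le_iff₀ h2, ← mul_div_assoc]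
    exact h1
  have hcoef : ∀ j, Tendsto (fun n => b n j) l (𝓝 0) := by
    intro j
    induction j using Nat.strong_induction_on with
    | _ j ih =>
    rw [tendsto_zero_iff_norm_tendsto_zero, tendsto_order]
    refine ⟨fun x hx => .of_forall fun n => hx.trans_le (norm_nonneg _), fun ε hε => ?_⟩
    -- evaluate at a small positive real `s`, where the terms after the `j`-th one are negligible
    obtain ⟨s, hs0, hs1, hs2⟩ : ∃ s : ℝ, 0 < s ∧ s ≤ ρ / 2 ∧ 2 * |C| * s / ρ ^ (j + 1) < ε / 2 := by
      have h1 : Tendsto (fun s : ℝ => 2 * |C| * s / ρ ^ (j + 1)) (𝓝[>] 0) (𝓝 0) := by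
        have : Continuous fun s : ℝ => 2 * |C| * s / ρ ^ (j + 1) := by fun_prop
        have h2 := (this.tendsto 0).mono_left (nhdsWithin_le_nhds (s := Set.Ioi 0))
        simpa using h2
      have h2 : ∀ᶠ s : ℝ in 𝓝[>] 0, s ≤ ρ / 2 :=
        nhdsWithin_le_nhds (eventually_le_nhds (by positivity))
      obtain ⟨s, ⟨hs1, hs2⟩, hs3⟩ := ((h2.and (h1.eventually_lt_const
        (show (0 : ℝ) < ε / 2 by positivity))).and self_mem_nhdsWithin).exists
      exact ⟨s, hs3, hs1, hs2⟩
    have hsR : ‖(s : ℂ)‖ < R := by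
      rw [Complex.norm_real, Real.norm_of_nonneg hs0.le]
      linarith
    have hlim : Tendsto (fun n => (‖h n s‖ + ∑ i ∈ Finset.range j, ‖b n i‖ * s ^ i) / s ^ j) l
        (𝓝 0) := by
      have h1 := (hr s hs0 (by linarith)).norm
      have h2 : Tendsto (fun n => ∑ i ∈ Finset.range j, ‖b n i‖ * s ^ i) l (𝓝 0) := by
        have := tendsto_finsetSum (Finset.range j) fun i hi =>
          ((ih i (Finset.mem_range.1 hi)).norm.mul_const (s ^ i))
        simpa using this
      simpa using (h1.add h2).div_const (s ^ j)
    filter_upwards [hsum, hbound, hlim.eventually_lt_const (show (0 : ℝ) < ε / 2 by positivity)]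
      with n hn1 hn2 hn3
    have hC : 0 ≤ C := by
      have := (norm_nonneg _).trans (hn2 0)
      simpa using this
    have h1 := hn1 s hsR
    have h2 := (hasSum_nat_add_iff' (j + 1)).2 h1
    have hx0 : 0 ≤ s / ρ := by positivity
    have hx1 : s / ρ ≤ 1 / 2 := by
      rw [div_le_div_iff₀ hρ (by norm_num)]
      linarith
    have h3 : ‖(h n s) - ∑ i ∈ Finset.range (j + 1), b n i * (s : ℂ) ^ i‖ ≤
        C * (s / ρ) ^ (j + 1) * (1 - s / ρ)⁻¹ := by
      refine h2.norm_le_of_bounded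
        ((hasSum_geometric_of_lt_one hx0 (by linarith)).mul_left (C * (s / ρ) ^ (j + 1)))
        fun i => ?_
      rw [norm_mul, norm_pow, Complex.norm_real, Real.norm_of_nonneg hs0.le]
      calc ‖b n (i + (j + 1))‖ * s ^ (i + (j + 1))
          ≤ C / ρ ^ (i + (j + 1)) * s ^ (i + (j + 1)) := by
            gcongr
            exact hn2 _
        _ = C * (s / ρ) ^ (j + 1) * (s / ρ) ^ i := by
            rw [mul_assoc, ← pow_add, add_comm (j + 1) i, div_pow]
            ring
    have h4 : (1 - s / ρ)⁻¹ ≤ 2 := by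
      rw [inv_le_comm₀ (by linarith) (by norm_num)]
      linarith
    have h5 : ‖b n j‖ * s ^ j ≤ ‖h n s‖ + ∑ i ∈ Finset.range j, ‖b n i‖ * s ^ i +
        C * (s / ρ) ^ (j + 1) * (1 - s / ρ)⁻¹ := by
      have h6 : b n j * (s : ℂ) ^ j = h n s - ∑ i ∈ Finset.range j, b n i * (s : ℂ) ^ i -
          (h n s - ∑ i ∈ Finset.range (j + 1), b n i * (s : ℂ) ^ i) := by
        rw [Finset.sum_range_succ]
        ring
      have h7 : ‖b n j‖ * s ^ j = ‖b n j * (s : ℂ) ^ j‖ := by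
        rw [norm_mul, norm_pow, Complex.norm_real, Real.norm_of_nonneg hs0.le]
      rw [h7, h6]
      refine (norm_sub_le _ _).trans (add_le_add ((norm_sub_le _ _).trans ?_) h3)
      gcongr
      refine (norm_sum_le _ _).trans (Finset.sum_le_sum fun i _ => ?_)
      rw [norm_mul, norm_pow, Complex.norm_real, Real.norm_of_nonneg hs0.le]
    have h8 : C * (s / ρ) ^ (j + 1) * (1 - s / ρ)⁻¹ ≤ (2 * |C| * s / ρ ^ (j + 1)) * s ^ j := by
      calc C * (s / ρ) ^ (j + 1) * (1 - s / ρ)⁻¹ ≤ C * (s / ρ) ^ (j + 1) * 2 := by gcongr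
        _ = (2 * |C| * s / ρ ^ (j + 1)) * s ^ j := by
          rw [abs_of_nonneg hC, div_pow, pow_succ s j]
          ring
    have h9 : ‖b n j‖ ≤ (‖h n s‖ + ∑ i ∈ Finset.range j, ‖b n i‖ * s ^ i) / s ^ j +
        2 * |C| * s / ρ ^ (j + 1) := by
      rw [div_add' _ _ _ (by positivity), le_div_iff₀ (by positivity)]
      linarith
    linarith
  have hlim : Tendsto (fun n => ∑' j, b n j * z ^ j) l (𝓝 (∑' _ : ℕ, (0 : ℂ))) := by
    refine tendsto_tsum_of_dominated_convergence (bound := fun j => C * (‖z‖ / ρ) ^ j)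
      ((summable_geometric_of_lt_one (by positivity) ((div_lt_one hρ).2 hρz)).mul_left C)
      (fun j => ?_) ?_
    · simpa using (hcoef j).mul_const (z ^ j)
    · filter_upwards [hbound] with n hn j
      rw [norm_mul, norm_pow]
      calc ‖b n j‖ * ‖z‖ ^ j ≤ C / ρ ^ j * ‖z‖ ^ j := by
            gcongr
            exact hn j
        _ = C * (‖z‖ / ρ) ^ j := by
            rw [div_pow]
            ring
  rw [tsum_zero] at hlim
  refine hlim.congr' ?_
  filter_upwards [hsum] with n hn
  exact (hn z hz).tsum_eq

/-! ### Recovering the coefficients -/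

/-- Cauchy's formula for the coefficients of a power series, on the circle of radius
`e ^ (-t)`. -/
lemma integral_genFun_mul_exp {a : ℕ → ℝ} {t : ℝ}
    (ha : Summable fun m => |a m| * Real.exp (-t) ^ m) (n : ℕ) :
    ∫ θ in (-Real.pi)..Real.pi,
      (∑' m, (a m : ℂ) * Complex.exp (-(t : ℂ) + θ * Complex.I) ^ m) *
        Complex.exp (-(n * θ * Complex.I)) =
      2 * Real.pi * (a n * Real.exp (-t) ^ n) := by
  have hterm : ∀ (m : ℕ) (θ : ℝ), (a m : ℂ) * Complex.exp (-(t : ℂ) + θ * Complex.I) ^ m *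
      Complex.exp (-(n * θ * Complex.I)) =
      (a m : ℂ) * (Real.exp (-t) : ℂ) ^ m *
        Complex.exp (((m : ℂ) - n) * Complex.I * θ) := by
    intro m θ
    rw [Complex.ofReal_exp, ← Complex.exp_nat_mul, ← Complex.exp_nat_mul,
      mul_assoc _ _ (Complex.exp (-_)), mul_assoc _ _ (Complex.exp (_ * _ * (θ : ℂ))),
      ← Complex.exp_add, ← Complex.exp_add]
    congr 2
    push_cast
    ring
  have hexpn : ∀ (m : ℕ) (θ : ℝ), ‖Complex.exp (((m : ℂ) - n) * Complex.I * θ)‖ = 1 := by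
    intro m θ
    rw [Complex.norm_exp]
    simp
  have hnorm : ∀ (m : ℕ) (θ : ℝ), ‖(a m : ℂ) * (Real.exp (-t) : ℂ) ^ m *
        Complex.exp (((m : ℂ) - n) * Complex.I * θ)‖ = |a m| * Real.exp (-t) ^ m := by
    intro m θ
    rw [norm_mul, norm_mul, norm_pow, hexpn, Complex.norm_real, Complex.norm_real,
      Real.norm_eq_abs, Real.norm_of_nonneg (Real.exp_pos _).le, mul_one]
  have h1 : HasSum (fun m => ∫ θ in (-Real.pi)..Real.pi, (a m : ℂ) * (Real.exp (-t) : ℂ) ^ m *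
        Complex.exp (((m : ℂ) - n) * Complex.I * θ))
      (∫ θ in (-Real.pi)..Real.pi,
        (∑' m, (a m : ℂ) * Complex.exp (-(t : ℂ) + θ * Complex.I) ^ m) *
        Complex.exp (-(n * θ * Complex.I))) := by
    refine intervalIntegral.hasSum_integral_of_dominated_convergence
      (fun m _ => |a m| * Real.exp (-t) ^ m) (fun m => ?_) (fun m => ?_) ?_ ?_ ?_
    · exact (by fun_prop : Continuous fun θ : ℝ => (a m : ℂ) * (Real.exp (-t) : ℂ) ^ m *
        Complex.exp (((m : ℂ) - n) * Complex.I * θ)).aestronglyMeasurable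
    · exact .of_forall fun θ _ => (hnorm m θ).le
    · exact .of_forall fun θ _ => ha
    · exact intervalIntegrable_const
    · refine .of_forall fun θ _ => ?_
      have h2 : Summable fun m => (a m : ℂ) * (Real.exp (-t) : ℂ) ^ m *
        Complex.exp (((m : ℂ) - n) * Complex.I * θ) :=
        .of_norm (ha.congr fun m => (hnorm m θ).symm)
      simp_rw [← hterm] at h2 ⊢
      rw [← tsum_mul_right]
      exact h2.hasSum
  have h2 : ∀ m, m ≠ n → ∫ θ in (-Real.pi)..Real.pi, (a m : ℂ) * (Real.exp (-t) : ℂ) ^ m *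
        Complex.exp (((m : ℂ) - n) * Complex.I * θ) = 0 := by
    intro m hm
    have hne : ((m : ℂ) - n) * Complex.I ≠ 0 :=
      mul_ne_zero (sub_ne_zero.2 (by exact_mod_cast hm)) Complex.I_ne_zero
    rw [intervalIntegral.integral_const_mul, integral_exp_mul_complex hne]
    have h3 : Complex.exp (((m : ℂ) - n) * Complex.I * (Real.pi : ℝ)) =
        Complex.exp (((m : ℂ) - n) * Complex.I * ((-Real.pi : ℝ) : ℂ)) := by
      rw [Complex.exp_eq_exp_iff_exists_int]
      refine ⟨(m : ℤ) - n, ?_⟩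
      push_cast
      ring
    rw [h3, sub_self, zero_div, mul_zero]
  rw [← h1.tsum_eq, tsum_eq_single n h2]
  simp only [sub_self, zero_mul, Complex.exp_zero, mul_one, intervalIntegral.integral_const,
    sub_neg_eq_add, Complex.real_smul]
  push_cast
  ring

/-! ### The saddle point method -/

/-- The sum of a power series with real coefficients, at a complex argument. -/
noncomputable def powerSum (a : ℕ → ℝ) (q : ℂ) : ℂ := ∑' m, (a m : ℂ) * q ^ m

/-- The sum of a power series with real coefficients, at a real argument. -/
noncomputable def realPowerSum (a : ℕ → ℝ) (r : ℝ) : ℝ := ∑' m, a m * r ^ m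

section powerSum

variable {a : ℕ → ℝ}

lemma powerSum_ofReal (a : ℕ → ℝ) (r : ℝ) : powerSum a r = (realPowerSum a r : ℂ) := by
  rw [powerSum, realPowerSum, Complex.ofReal_tsum]
  simp

lemma norm_powerSum_le (ha : ∀ m, 0 ≤ a m) {q : ℂ}
    (hs : Summable fun m => a m * ‖q‖ ^ m) : ‖powerSum a q‖ ≤ realPowerSum a ‖q‖ := by
  have h : ∀ m, ‖(a m : ℂ) * q ^ m‖ = a m * ‖q‖ ^ m := fun m => by
    rw [norm_mul, norm_pow, Complex.norm_real, Real.norm_of_nonneg (ha m)]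
  refine (norm_tsum_le_tsum_norm (hs.congr fun m => (h m).symm)).trans (le_of_eq ?_)
  rw [realPowerSum]
  exact tsum_congr h

lemma differentiableOn_powerSum (ha : ∀ m, 0 ≤ a m)
    (hs : ∀ r : ℝ, 0 < r → r < 1 → Summable fun m => a m * r ^ m) :
    DifferentiableOn ℂ (powerSum a) (Metric.ball 0 1) := by
  intro q hq
  rw [mem_ball_zero_iff] at hq
  obtain ⟨ρ, hρ, hρ1⟩ := exists_between hq
  have hρ0 : 0 < ρ := (norm_nonneg q).trans_lt hρ
  have h1 : DifferentiableOn ℂ (powerSum a) (Metric.ball 0 ρ) := by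
    refine Complex.differentiableOn_tsum_of_summable_norm (hs ρ hρ0 hρ1) (fun m => by fun_prop)
      Metric.isOpen_ball fun m w hw => ?_
    rw [mem_ball_zero_iff] at hw
    rw [norm_mul, norm_pow, Complex.norm_real, Real.norm_of_nonneg (ha m)]
    have := ha m
    gcongr
  exact (h1.differentiableAt
    (Metric.isOpen_ball.mem_nhds (by simpa using hρ))).differentiableWithinAt

end powerSum

/-- The Laplace transform of the measure `∑ a m e ^ (-m t) δ_m`, normalized to total mass one,
centred at `c / t ²` and rescaled by `t ^ (3/2)`. -/
noncomputable def scaledMgf (a : ℕ → ℝ) (c t : ℝ) (z : ℂ) : ℂ :=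
  powerSum a (Complex.exp (-(t : ℂ) + (t * √t : ℝ) * z)) * Complex.exp (-((c / √t : ℝ) * z)) /
    realPowerSum a (Real.exp (-t))

lemma scaledMgf_ofReal (a : ℕ → ℝ) (c t s : ℝ) :
    scaledMgf a c t s = ((realPowerSum a (Real.exp (-(t - t * √t * s))) *
      Real.exp (-(c / √t * s)) / realPowerSum a (Real.exp (-t)) : ℝ) : ℂ) := by
  have h : Complex.exp (-(t : ℂ) + (t * √t : ℝ) * s) = (Real.exp (-(t - t * √t * s)) : ℝ) := by
    push_cast
    congr 1
    ring
  rw [scaledMgf, h, powerSum_ofReal]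
  push_cast
  rfl

section saddle

variable {a : ℕ → ℝ} {c : ℝ}

lemma tendsto_sqrt_nhdsGT_zero : Tendsto (fun t : ℝ => √t) (𝓝[>] 0) (𝓝 0) := by
  have h := (Real.continuous_sqrt.tendsto 0).mono_left (nhdsWithin_le_nhds (s := Set.Ioi 0))
  rwa [Real.sqrt_zero] at h

lemma eventually_mul_sqrt_lt (R : ℝ) : ∀ᶠ t : ℝ in 𝓝[>] 0, 0 < t ∧ t * √t * R < t := by
  have h1 : Tendsto (fun t : ℝ => √t * R) (𝓝[>] 0) (𝓝 0) := by
    simpa using tendsto_sqrt_nhdsGT_zero.mul_const R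
  filter_upwards [self_mem_nhdsWithin, h1.eventually_lt_const one_pos] with t ht h
  rw [Set.mem_Ioi] at ht
  refine ⟨ht, ?_⟩
  rw [mul_assoc]
  exact mul_lt_of_lt_one_right ht h

/-- On the real axis the scaled transforms converge to that of a Gaussian. -/
lemma tendsto_scaledMgf_real
    (hasym : Tendsto (fun t : ℝ => realPowerSum a (Real.exp (-t)) /
      (√(t / Real.pi) * Real.exp (c / t))) (𝓝[>] 0) (𝓝 1)) (s : ℝ) :
    Tendsto (fun t : ℝ => scaledMgf a c t s) (𝓝[>] 0) (𝓝 (Complex.exp (c * (s : ℂ) ^ 2))) := by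
  have hpi := Real.pi_pos
  set D : ℝ → ℝ := fun t => realPowerSum a (Real.exp (-t)) / (√(t / Real.pi) * Real.exp (c / t))
    with hD
  have hδ : Tendsto (fun t : ℝ => 1 - √t * s) (𝓝[>] 0) (𝓝 1) := by
    simpa using tendsto_const_nhds.sub (tendsto_sqrt_nhdsGT_zero.mul_const s)
  have ht' : Tendsto (fun t : ℝ => t - t * √t * s) (𝓝[>] 0) (𝓝[>] 0) := by
    refine tendsto_nhdsWithin_iff.2 ⟨?_, ?_⟩
    · have : Continuous fun t : ℝ => t - t * √t * s := by fun_prop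
      have h := (this.tendsto 0).mono_left (nhdsWithin_le_nhds (s := Set.Ioi 0))
      simpa using h
    · filter_upwards [eventually_mul_sqrt_lt s] with t ht
      rw [Set.mem_Ioi]
      linarith [ht.2]
  have hlim : Tendsto (fun t : ℝ => D (t - t * √t * s) / D t * √(1 - √t * s) *
      Real.exp (c * s ^ 2 / (1 - √t * s))) (𝓝[>] 0) (𝓝 (1 / 1 * √1 * Real.exp (c * s ^ 2 / 1))) :=
    (((hasym.comp ht').div hasym one_ne_zero).mul hδ.sqrt).mul
      ((tendsto_const_nhds.div hδ one_ne_zero).rexp)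
  rw [div_one, Real.sqrt_one, one_mul, one_mul, div_one] at hlim
  have hC := (Complex.continuous_ofReal.tendsto _).comp hlim
  have hval : ((Real.exp (c * s ^ 2) : ℝ) : ℂ) = Complex.exp (c * (s : ℂ) ^ 2) := by
    push_cast
    rfl
  rw [hval] at hC
  refine hC.congr' ?_
  filter_upwards [eventually_mul_sqrt_lt s, hasym.eventually_ne one_ne_zero] with t ht hD0
  rw [scaledMgf_ofReal, Function.comp_apply]
  congr 1
  obtain ⟨ht0, hts⟩ := ht
  have hst : 0 < √t := Real.sqrt_pos.2 ht0
  have hsq : √t * √t = t := Real.mul_self_sqrt ht0.le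
  have h1s : 0 < 1 - √t * s := by
    by_contra hneg
    have h : t * (1 - √t * s) ≤ 0 := mul_nonpos_of_nonneg_of_nonpos ht0.le (not_lt.1 hneg)
    nlinarith
  have hfac : t - t * √t * s = t * (1 - √t * s) := by ring
  have hexp : c / t + c * s ^ 2 / (1 - √t * s) = c / (t * (1 - √t * s)) - c / √t * s := by
    clear hfac hts hD0
    generalize √t = w at hst hsq h1s ⊢
    subst hsq
    have hne := h1s.ne'
    field_simp
    ring
  have hR0 : realPowerSum a (Real.exp (-t)) ≠ 0 := fun h => hD0 (by simp only [hD, h, zero_div])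
  have hsqrt : √(t * (1 - √t * s) / Real.pi) = √(t / Real.pi) * √(1 - √t * s) := by
    rw [← Real.sqrt_mul (by positivity)]
    congr 1
    ring
  have hp1 : 0 < √(t / Real.pi) := by positivity
  have hp2 : 0 < √(1 - √t * s) := Real.sqrt_pos.2 h1s
  have hexp' : Real.exp (c / t) * Real.exp (c * s ^ 2 / (1 - √t * s)) =
      Real.exp (c / (t * (1 - √t * s))) * Real.exp (-(c / √t * s)) := by
    rw [← Real.exp_add, ← Real.exp_add, hexp, sub_eq_add_neg]
  simp only [hD]
  rw [hfac, hsqrt]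
  have he1 := Real.exp_pos (c / t)
  have he2 := Real.exp_pos (c / (t * (1 - √t * s)))
  generalize Real.exp (c / t) = E1 at *
  generalize Real.exp (c / (t * (1 - √t * s))) = E2 at *
  generalize Real.exp (-(c / √t * s)) = E3 at *
  generalize Real.exp (c * s ^ 2 / (1 - √t * s)) = E4 at *
  generalize √(t / Real.pi) = S1 at *
  generalize √(1 - √t * s) = S2 at *
  generalize realPowerSum a (Real.exp (-t)) = R1 at *
  generalize realPowerSum a (Real.exp (-(t * (1 - √t * s)))) = R2 at *
  field_simp
  linear_combination R2 * hexp'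

lemma exp_mul_le_add {x y R : ℝ} (hx : |x| ≤ R) :
    Real.exp (y * x) ≤ Real.exp (y * R) + Real.exp (y * -R) := by
  have h := abs_le.1 hx
  rcases le_total 0 y with hy | hy
  · have : Real.exp (y * x) ≤ Real.exp (y * R) :=
      Real.exp_le_exp.2 (mul_le_mul_of_nonneg_left h.2 hy)
    linarith [Real.exp_pos (y * -R)]
  · have : Real.exp (y * x) ≤ Real.exp (y * -R) :=
      Real.exp_le_exp.2 (mul_le_mul_of_nonpos_left h.1 hy)
    linarith [Real.exp_pos (y * R)]

/-- In a vertical strip the scaled transform is bounded by its values at the two real points of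
the boundary. -/
lemma norm_scaledMgf_le (ha : ∀ m, 0 ≤ a m)
    (hs : ∀ r : ℝ, 0 < r → r < 1 → Summable fun m => a m * r ^ m) {t R : ℝ}
    (hR0 : 0 ≤ R) (ht : 0 < t) (htR : t * √t * R < t) {z : ℂ} (hz : |z.re| ≤ R) :
    ‖scaledMgf a c t z‖ ≤ ‖scaledMgf a c t R‖ + ‖scaledMgf a c t ((-R : ℝ) : ℂ)‖ := by
  have hσ : 0 ≤ t * √t := by positivity
  have hsum : ∀ x : ℝ, |x| ≤ R → HasSum
      (fun m => a m * Real.exp (-t) ^ m * Real.exp ((m * (t * √t) - c / √t) * x))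
      (realPowerSum a (Real.exp (-(t - t * √t * x))) * Real.exp (-(c / √t * x))) := by
    intro x hx
    have hlt : Real.exp (-(t - t * √t * x)) < 1 := by
      rw [Real.exp_lt_one_iff]
      have : t * √t * x ≤ t * √t * R := mul_le_mul_of_nonneg_left ((le_abs_self x).trans hx) hσ
      linarith
    have := (hs _ (Real.exp_pos _) hlt).hasSum.mul_right (Real.exp (-(c / √t * x)))
    refine this.congr_fun fun m => ?_
    rw [← Real.exp_nat_mul, ← Real.exp_nat_mul, mul_assoc, mul_assoc, ← Real.exp_add,
      ← Real.exp_add]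
    congr 2
    ring
  have hG : 0 ≤ realPowerSum a (Real.exp (-t)) :=
    tsum_nonneg fun m => mul_nonneg (ha m) (by positivity)
  have hreal : ∀ x : ℝ, ‖scaledMgf a c t x‖ = realPowerSum a (Real.exp (-(t - t * √t * x))) *
      Real.exp (-(c / √t * x)) / realPowerSum a (Real.exp (-t)) := by
    intro x
    rw [scaledMgf_ofReal, Complex.norm_real, Real.norm_of_nonneg]
    refine div_nonneg (mul_nonneg ?_ (Real.exp_pos _).le) hG
    exact tsum_nonneg fun m => mul_nonneg (ha m) (by positivity)
  have hnorm : ‖Complex.exp (-(t : ℂ) + (t * √t : ℝ) * z)‖ = Real.exp (-(t - t * √t * z.re)) := by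
    rw [Complex.norm_exp, Complex.add_re, Complex.neg_re, Complex.ofReal_re,
      Complex.re_ofReal_mul]
    congr 1
    ring
  have h1 : ‖scaledMgf a c t z‖ ≤ realPowerSum a (Real.exp (-(t - t * √t * z.re))) *
      Real.exp (-(c / √t * z.re)) / realPowerSum a (Real.exp (-t)) := by
    rw [scaledMgf, norm_div, norm_mul, Complex.norm_real, Real.norm_of_nonneg hG,
      Complex.norm_exp (-_), Complex.neg_re, Complex.re_ofReal_mul]
    gcongr
    rw [← hnorm]
    refine norm_powerSum_le ha ?_
    rw [hnorm]
    refine hs _ (Real.exp_pos _) ?_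
    rw [Real.exp_lt_one_iff]
    have : t * √t * z.re ≤ t * √t * R :=
      mul_le_mul_of_nonneg_left ((le_abs_self _).trans hz) hσ
    linarith
  refine h1.trans ?_
  rw [hreal, hreal, ← add_div]
  gcongr
  refine hasSum_le (fun m => ?_) (hsum z.re hz)
    ((hsum R (abs_of_nonneg hR0).le).add (hsum (-R) (by rw [abs_neg, abs_of_nonneg hR0])))
  rw [← mul_add]
  exact mul_le_mul_of_nonneg_left (exp_mul_le_add hz) (mul_nonneg (ha m) (by positivity))

lemma differentiableOn_scaledMgf (ha : ∀ m, 0 ≤ a m)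
    (hs : ∀ r : ℝ, 0 < r → r < 1 → Summable fun m => a m * r ^ m) {t R : ℝ}
    (ht : 0 < t) (htR : t * √t * R < t) :
    DifferentiableOn ℂ (scaledMgf a c t) {z | z.re ≤ R} := by
  unfold scaledMgf
  refine DifferentiableOn.div_const (DifferentiableOn.mul ?_ (by fun_prop)) _
  refine (differentiableOn_powerSum ha hs).comp (by fun_prop) fun z hz => ?_
  rw [mem_ball_zero_iff, Complex.norm_exp, Complex.add_re, Complex.neg_re, Complex.ofReal_re,
    Complex.re_ofReal_mul, Real.exp_lt_one_iff]
  have hz' : z.re ≤ R := hz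
  have : t * √t * z.re ≤ t * √t * R := mul_le_mul_of_nonneg_left hz' (by positivity)
  linarith

/-- The scaled characteristic functions converge pointwise to a Gaussian. -/
lemma tendsto_scaledMgf (ha : ∀ m, 0 ≤ a m)
    (hs : ∀ r : ℝ, 0 < r → r < 1 → Summable fun m => a m * r ^ m)
    (hasym : Tendsto (fun t : ℝ => realPowerSum a (Real.exp (-t)) /
      (√(t / Real.pi) * Real.exp (c / t))) (𝓝[>] 0) (𝓝 1)) (z : ℂ) :
    Tendsto (fun t : ℝ => scaledMgf a c t z) (𝓝[>] 0) (𝓝 (Complex.exp (c * z ^ 2))) := by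
  set R := ‖z‖ + 1 with hR
  have hR0 : 0 < R := by positivity
  have hsub : ∀ w ∈ Metric.ball (0 : ℂ) R, |w.re| ≤ R := fun w hw =>
    (Complex.abs_re_le_norm w).trans (mem_ball_zero_iff.1 hw).le
  obtain ⟨C, hC⟩ : ∃ C : ℝ, ∀ w ∈ Metric.ball (0 : ℂ) R, ‖Complex.exp (c * w ^ 2)‖ ≤ C := by
    refine ⟨Real.exp (|c| * R ^ 2), fun w hw => ?_⟩
    refine (Complex.norm_exp_le_exp_norm _).trans (Real.exp_le_exp.2 ?_)
    rw [norm_mul, norm_pow, Complex.norm_real, Real.norm_eq_abs]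
    gcongr
    exact (mem_ball_zero_iff.1 hw).le
  have hbd : ∀ x : ℝ, ∀ᶠ t : ℝ in 𝓝[>] 0,
      ‖scaledMgf a c t x‖ ≤ ‖Complex.exp (c * (x : ℂ) ^ 2)‖ + 1 := fun x =>
    (((tendsto_scaledMgf_real hasym x).norm).eventually_lt_const (lt_add_one _)).mono
      fun t ht => ht.le
  have h := tendsto_zero_of_tendsto_zero_on_radius (l := 𝓝[>] (0 : ℝ)) (R := R)
    (h := fun t w => scaledMgf a c t w - Complex.exp (c * w ^ 2))
    (C := ‖Complex.exp (c * (R : ℂ) ^ 2)‖ + 1 + (‖Complex.exp (c * ((-R : ℝ) : ℂ) ^ 2)‖ + 1) + C)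
    ?_ ?_ ?_ (z := z) (by rw [hR]; linarith)
  · have h2 := h.add_const (Complex.exp (c * z ^ 2))
    simpa using h2
  · filter_upwards [eventually_mul_sqrt_lt R] with t ht
    refine DifferentiableOn.sub ((differentiableOn_scaledMgf ha hs ht.1 ht.2).mono ?_)
      (by fun_prop)
    exact fun w hw => (le_abs_self _).trans (hsub w hw)
  · filter_upwards [eventually_mul_sqrt_lt R, hbd R, hbd (-R)] with t ht h1 h2 w hw
    refine (norm_sub_le _ _).trans (add_le_add ?_ (hC w hw))
    exact (norm_scaledMgf_le ha hs hR0.le ht.1 ht.2 (hsub w hw)).trans (add_le_add h1 h2)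
  · intro s _ _
    have h2 := (tendsto_scaledMgf_real hasym s).sub_const (Complex.exp (c * (s : ℂ) ^ 2))
    simpa using h2

/-- A fixed integrable majorant for the decay of the generating function on the scaled circle. -/
lemma exp_neg_min_le {b t u : ℝ} (hb : 0 < b) (ht : 0 < t) (ht1 : t ≤ 1)
    (hu : |u| ≤ Real.pi / (t * √t)) :
    Real.exp (-(b * min (u ^ 2) (1 / t))) ≤
      (1 + 1 / b + 6 * (1 + Real.pi ^ 2) / b ^ 3) * (1 + u ^ 2)⁻¹ := by
  have h1 : 0 ≤ 6 * (1 + Real.pi ^ 2) / b ^ 3 := by positivity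
  have h2 : 0 ≤ 1 + 1 / b := by positivity
  have hu0 : 0 < 1 + u ^ 2 := by positivity
  rw [← div_eq_mul_inv, le_div_iff₀ hu0]
  rcases min_cases (u ^ 2) (1 / t) with h | h
  · rw [h.1]
    have h3 := Real.add_one_le_exp (b * u ^ 2)
    have h4 : Real.exp (-(b * u ^ 2)) * Real.exp (b * u ^ 2) = 1 := by
      rw [← Real.exp_add, neg_add_cancel, Real.exp_zero]
    have h5 : 1 + u ^ 2 ≤ (1 + 1 / b) * Real.exp (b * u ^ 2) := by
      have h6 : (1 + 1 / b) * (b * u ^ 2 + 1) = 1 + u ^ 2 + (1 / b + b * u ^ 2) := by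
        field_simp
        ring
      have h7 : 0 ≤ 1 / b + b * u ^ 2 := by positivity
      have h8 := mul_le_mul_of_nonneg_left h3 h2
      linarith
    have h9 := mul_le_mul_of_nonneg_left h5 (Real.exp_pos (-(b * u ^ 2))).le
    calc _ ≤ _ := h9
      _ = (1 + 1 / b) * (Real.exp (-(b * u ^ 2)) * Real.exp (b * u ^ 2)) := by ring
      _ ≤ _ := by rw [h4]; linarith
  · rw [h.1]
    have h3 := Real.pow_div_factorial_le_exp (b * (1 / t)) (by positivity) 3
    have h4 : Real.exp (-(b * (1 / t))) * Real.exp (b * (1 / t)) = 1 := by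
      rw [← Real.exp_add, neg_add_cancel, Real.exp_zero]
    have h5 : u ^ 2 ≤ Real.pi ^ 2 / t ^ 3 := by
      rw [← sq_abs]
      calc |u| ^ 2 ≤ (Real.pi / (t * √t)) ^ 2 := by gcongr
        _ = Real.pi ^ 2 / t ^ 3 := by
          rw [div_pow, mul_pow, Real.sq_sqrt ht.le]
          ring
    have h6 : 1 + u ^ 2 ≤ (1 + Real.pi ^ 2) / t ^ 3 := by
      have h7 : (1 : ℝ) ≤ 1 / t ^ 3 := by
        rw [le_div_iff₀ (by positivity), one_mul]
        exact pow_le_one₀ ht.le ht1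
      rw [add_div]
      linarith
    have h8 : (1 + Real.pi ^ 2) / t ^ 3 =
        6 * (1 + Real.pi ^ 2) / b ^ 3 * ((b * (1 / t)) ^ 3 / (Nat.factorial 3 : ℝ)) := by
      have : (Nat.factorial 3 : ℝ) = 6 := by norm_num [Nat.factorial]
      rw [this]
      field_simp
    have h9 : 1 + u ^ 2 ≤ 6 * (1 + Real.pi ^ 2) / b ^ 3 * Real.exp (b * (1 / t)) := by
      rw [h8] at h6
      exact h6.trans (mul_le_mul_of_nonneg_left h3 h1)
    have h10 := mul_le_mul_of_nonneg_left h9 (Real.exp_pos (-(b * (1 / t)))).le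
    calc _ ≤ _ := h10
      _ = 6 * (1 + Real.pi ^ 2) / b ^ 3 *
          (Real.exp (-(b * (1 / t))) * Real.exp (b * (1 / t))) := by ring
      _ ≤ _ := by rw [h4]; linarith

lemma continuous_scaledMgf_mul_I (ha : ∀ m, 0 ≤ a m)
    (hs : ∀ r : ℝ, 0 < r → r < 1 → Summable fun m => a m * r ^ m) {t : ℝ} (ht : 0 < t) :
    Continuous fun u : ℝ => scaledMgf a c t (u * Complex.I) := by
  have h1 := (differentiableOn_scaledMgf (c := c) ha hs ht
    (R := 0) (by rw [mul_zero]; exact ht)).continuousOn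
  refine h1.comp_continuous (by fun_prop) fun u => ?_
  change ((u : ℂ) * Complex.I).re ≤ 0
  simp

lemma norm_scaledMgf_mul_I (hG : 0 ≤ realPowerSum a (Real.exp (-t))) (u : ℝ) :
    ‖scaledMgf a c t (u * Complex.I)‖ =
      ‖powerSum a (Complex.exp (-(t : ℂ) + (t * √t * u : ℝ) * Complex.I))‖ /
        realPowerSum a (Real.exp (-t)) := by
  have h : (-(t : ℂ) + (t * √t : ℝ) * (u * Complex.I)) =
      -(t : ℂ) + (t * √t * u : ℝ) * Complex.I := by
    push_cast
    ring
  have h2 : ‖Complex.exp (-((c / √t : ℝ) * (u * Complex.I)))‖ = 1 := by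
    rw [Complex.norm_exp, Complex.neg_re, Complex.re_ofReal_mul, Complex.re_ofReal_mul,
      Complex.I_re, mul_zero, mul_zero, neg_zero, Real.exp_zero]
  rw [scaledMgf, norm_div, norm_mul, h2, mul_one, h, Complex.norm_real, Real.norm_of_nonneg hG]

/-- The integral of the scaled characteristic function over one full period converges to a
Gaussian integral. -/
lemma tendsto_integral_scaledMgf (ha : ∀ m, 0 ≤ a m)
    (hs : ∀ r : ℝ, 0 < r → r < 1 → Summable fun m => a m * r ^ m)
    (hasym : Tendsto (fun t : ℝ => realPowerSum a (Real.exp (-t)) /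
      (√(t / Real.pi) * Real.exp (c / t))) (𝓝[>] 0) (𝓝 1))
    {b K t₀ : ℝ} (hb : 0 < b) (ht₀ : 0 < t₀)
    (hdecay : ∀ t : ℝ, 0 < t → t < t₀ → ∀ θ : ℝ, |θ| ≤ Real.pi →
      ‖powerSum a (Complex.exp (-(t : ℂ) + θ * Complex.I))‖ ≤
        K * realPowerSum a (Real.exp (-t)) *
          Real.exp (-(b * min (θ ^ 2 / t ^ 3) (1 / t)))) :
    Tendsto (fun t : ℝ => ∫ u in (-(Real.pi / (t * √t)))..(Real.pi / (t * √t)),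
      scaledMgf a c t (u * Complex.I)) (𝓝[>] 0) (𝓝 ((√(Real.pi / c) : ℝ) : ℂ)) := by
  have hpi := Real.pi_pos
  have hlim : ((√(Real.pi / c) : ℝ) : ℂ) =
      ∫ u : ℝ, Complex.exp (c * ((u : ℂ) * Complex.I) ^ 2) := by
    rw [← integral_gaussian, ← integral_complex_ofReal]
    congr 1
    ext u
    push_cast
    congr 1
    rw [mul_pow, Complex.I_sq]
    ring
  have hpos : ∀ᶠ t : ℝ in 𝓝[>] 0, 0 < t ∧ t < t₀ ∧ t ≤ 1 ∧
      0 < realPowerSum a (Real.exp (-t)) := by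
    filter_upwards [self_mem_nhdsWithin, nhdsWithin_le_nhds (eventually_lt_nhds ht₀),
      nhdsWithin_le_nhds (eventually_le_nhds one_pos), hasym.eventually_ne one_ne_zero]
      with t h1 h2 h3 h4
    refine ⟨h1, h2, h3, lt_of_le_of_ne ?_ fun h => h4 (by rw [← h, zero_div])⟩
    exact tsum_nonneg fun m => mul_nonneg (ha m) (by positivity)
  set S : ℝ → Set ℝ := fun t => Set.Ioc (-(Real.pi / (t * √t))) (Real.pi / (t * √t)) with hS
  have hmain : Tendsto (fun t : ℝ => ∫ u, (S t).indicator
      (fun u : ℝ => scaledMgf a c t (u * Complex.I)) u) (𝓝[>] 0)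
      (𝓝 ((√(Real.pi / c) : ℝ) : ℂ)) := by
    rw [hlim]
    refine MeasureTheory.tendsto_integral_filter_of_dominated_convergence
      (fun u => |K| * ((1 + 1 / b + 6 * (1 + Real.pi ^ 2) / b ^ 3) * (1 + u ^ 2)⁻¹))
      ?_ ?_ ((integrable_inv_one_add_sq.const_mul _).const_mul _) ?_
    · filter_upwards [self_mem_nhdsWithin] with t ht
      exact (continuous_scaledMgf_mul_I ha hs ht).aestronglyMeasurable.indicator measurableSet_Ioc
    · filter_upwards [hpos] with t ht
      obtain ⟨ht0, htt, ht1, hG⟩ := ht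
      refine .of_forall fun u => ?_
      have hσ : 0 < t * √t := by positivity
      rw [Set.indicator_apply]
      split_ifs with hu
      · have hu' : |u| ≤ Real.pi / (t * √t) := abs_le.2 ⟨hu.1.le, hu.2⟩
        rw [norm_scaledMgf_mul_I hG.le, div_le_iff₀ hG]
        have hθ : |t * √t * u| ≤ Real.pi := by
          rw [abs_mul, abs_of_pos hσ, mul_comm]
          rwa [le_div_iff₀ hσ] at hu'
        have h1 := hdecay t ht0 htt _ hθ
        have h2 : (t * √t * u) ^ 2 / t ^ 3 = u ^ 2 := by
          rw [mul_pow, mul_pow, Real.sq_sqrt ht0.le]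
          field_simp
        rw [h2] at h1
        refine h1.trans ?_
        calc K * realPowerSum a (Real.exp (-t)) * Real.exp (-(b * min (u ^ 2) (1 / t)))
            ≤ |K| * realPowerSum a (Real.exp (-t)) *
              ((1 + 1 / b + 6 * (1 + Real.pi ^ 2) / b ^ 3) * (1 + u ^ 2)⁻¹) := by
              gcongr
              · exact le_abs_self K
              · exact exp_neg_min_le hb ht0 ht1 hu'
          _ = _ := by ring
      · rw [norm_zero]
        positivity
    · refine .of_forall fun u => ?_
      refine (tendsto_scaledMgf ha hs hasym (u * Complex.I)).congr' ?_
      have h1 : Tendsto (fun t : ℝ => (t * √t) * |u|) (𝓝[>] 0) (𝓝 0) := by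
        have : Continuous fun t : ℝ => (t * √t) * |u| := by fun_prop
        have h := (this.tendsto 0).mono_left (nhdsWithin_le_nhds (s := Set.Ioi 0))
        simpa using h
      filter_upwards [self_mem_nhdsWithin, h1.eventually_lt_const hpi] with t ht h2
      have ht' : 0 < t := ht
      have hσ : 0 < t * √t := by positivity
      have hu : |u| < Real.pi / (t * √t) := by
        rw [lt_div_iff₀ hσ, mul_comm]
        exact h2
      rw [Set.indicator_of_mem]
      exact ⟨(abs_lt.1 hu).1, (abs_lt.1 hu).2.le⟩
  refine hmain.congr' ?_
  filter_upwards [self_mem_nhdsWithin] with t ht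
  have ht' : 0 < t := ht
  rw [MeasureTheory.integral_indicator measurableSet_Ioc, intervalIntegral.integral_of_le]
  have : 0 ≤ Real.pi / (t * √t) := by positivity
  linarith

/-- Solving the rescaled coefficient formula for the coefficient `A`; here `w = √t` and
`C = √c`. -/
lemma saddle_rearrange {G I A w C E p P : ℂ} (hw : w ≠ 0) (hC : C ≠ 0) (hE : E ≠ 0)
    (hP : P ≠ 0) (h : w * w * w * (G * I) = 2 * p * (A * E⁻¹)) :
    G / (w / P * E) * I * (C / P) =
      A / (C / (2 * p * (C * C / (w * w) ^ 2)) * (E * E)) := by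
  field_simp at h ⊢
  linear_combination h

/-- The saddle point method: a power series with nonnegative coefficients that grows like
`√(t / π) e ^ (c / t)` at `e ^ (-t)` and decays on the circles around the origin has
coefficients `∼ √c / (2 π n) e ^ (2 √(c n))`. -/
theorem tendsto_coeff_of_growth (ha : ∀ m, 0 ≤ a m)
    (hs : ∀ r : ℝ, 0 < r → r < 1 → Summable fun m => a m * r ^ m) (hc : 0 < c)
    (hasym : Tendsto (fun t : ℝ => realPowerSum a (Real.exp (-t)) /
      (√(t / Real.pi) * Real.exp (c / t))) (𝓝[>] 0) (𝓝 1))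
    {b K t₀ : ℝ} (hb : 0 < b) (ht₀ : 0 < t₀)
    (hdecay : ∀ t : ℝ, 0 < t → t < t₀ → ∀ θ : ℝ, |θ| ≤ Real.pi →
      ‖powerSum a (Complex.exp (-(t : ℂ) + θ * Complex.I))‖ ≤
        K * realPowerSum a (Real.exp (-t)) *
          Real.exp (-(b * min (θ ^ 2 / t ^ 3) (1 / t)))) :
    Tendsto (fun n : ℕ => a n / (√c / (2 * Real.pi * n) * Real.exp (2 * √(c * n))))
      atTop (𝓝 1) := by
  have hpi := Real.pi_pos
  have hint := tendsto_integral_scaledMgf ha hs hasym hb ht₀ hdecay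
  set I : ℝ → ℂ := fun t => ∫ u in (-(Real.pi / (t * √t)))..(Real.pi / (t * √t)),
      scaledMgf a c t (u * Complex.I) with hI
  set D : ℝ → ℝ := fun t => realPowerSum a (Real.exp (-t)) / (√(t / Real.pi) * Real.exp (c / t))
    with hD
  -- the saddle point: `e ^ (c / t + n t)` is minimal at `t = √(c / n)`
  have hτ : Tendsto (fun n : ℕ => √(c / n)) atTop (𝓝[>] 0) := by
    refine tendsto_nhdsWithin_iff.2 ⟨?_, ?_⟩
    · have h := (tendsto_const_div_atTop_nhds_zero_nat c).sqrt
      rwa [Real.sqrt_zero] at h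
    · filter_upwards [eventually_gt_atTop 0] with n hn
      have : (0 : ℝ) < n := by exact_mod_cast hn
      exact Real.sqrt_pos.2 (by positivity)
  have hlim : Tendsto (fun t : ℝ => (D t : ℂ) * I t * (√c / √Real.pi : ℝ)) (𝓝[>] 0) (𝓝 1) := by
    have h1 := (((Complex.continuous_ofReal.tendsto _).comp hasym).mul hint).mul_const
      ((√c / √Real.pi : ℝ) : ℂ)
    have h2 : ((1 : ℝ) : ℂ) * ((√(Real.pi / c) : ℝ) : ℂ) * ((√c / √Real.pi : ℝ) : ℂ) = 1 := by
      rw [← Complex.ofReal_mul, ← Complex.ofReal_mul, Real.sqrt_div hpi.le, one_mul]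
      have h3 : √c ≠ 0 := (Real.sqrt_pos.2 hc).ne'
      have h4 : √Real.pi ≠ 0 := (Real.sqrt_pos.2 hpi).ne'
      rw [div_mul_div_comm, mul_comm, div_self (mul_ne_zero h3 h4), Complex.ofReal_one]
    rw [h2] at h1
    exact h1
  have hre := (Complex.continuous_re.tendsto _).comp (hlim.comp hτ)
  rw [Complex.one_re] at hre
  refine hre.congr' ?_
  filter_upwards [eventually_gt_atTop 0, hτ.eventually (hasym.eventually_ne one_ne_zero)]
    with n hn hDn
  have hn0 : (0 : ℝ) < n := by exact_mod_cast hn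
  rw [Function.comp_apply, Function.comp_apply,
    ← Complex.ofReal_re (a n / (√c / (2 * Real.pi * n) * Real.exp (2 * √(c * n))))]
  congr 1
  have hτ0 : 0 < √(c / n) := Real.sqrt_pos.2 (by positivity)
  have hnτ : (n : ℝ) = c / √(c / n) ^ 2 := by
    rw [Real.sq_sqrt (by positivity)]
    field_simp
  have hcn : √(c * n) = c / √(c / n) := by
    rw [Real.sqrt_eq_iff_mul_self_eq (by positivity) (by positivity)]
    rw [div_mul_div_comm, Real.mul_self_sqrt (by positivity)]
    field_simp
  rw [hcn]
  generalize √(c / n) = t at *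
  have hst : 0 < √t := Real.sqrt_pos.2 hτ0
  have hsq : √t * √t = t := Real.mul_self_sqrt hτ0.le
  have hG : realPowerSum a (Real.exp (-t)) ≠ 0 := fun h => hDn (by simp only [hD, h, zero_div])
  have hσ : t * √t ≠ 0 := by positivity
  have hr1 : Real.exp (-t) < 1 := by
    rw [Real.exp_lt_one_iff]
    linarith
  have hcoef := integral_genFun_mul_exp (a := a) (t := t)
    ((hs _ (Real.exp_pos _) hr1).congr fun m => by rw [abs_of_nonneg (ha m)]) n
  have hsub := intervalIntegral.smul_integral_comp_mul_left (a := -(Real.pi / (t * √t)))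
    (b := Real.pi / (t * √t)) (fun θ : ℝ => powerSum a (Complex.exp (-(t : ℂ) + θ * Complex.I)) *
      Complex.exp (-(n * θ * Complex.I))) (t * √t)
  rw [mul_neg, mul_div_cancel₀ _ hσ] at hsub
  have hcoef' : (t * √t : ℝ) • ∫ u in (-(Real.pi / (t * √t)))..(Real.pi / (t * √t)),
      powerSum a (Complex.exp (-(t : ℂ) + (t * √t * u : ℝ) * Complex.I)) *
      Complex.exp (-(n * (t * √t * u : ℝ) * Complex.I)) =
      2 * Real.pi * (a n * Real.exp (-t) ^ n) := hsub.trans hcoef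
  have hint_eq : ∫ u in (-(Real.pi / (t * √t)))..(Real.pi / (t * √t)),
      powerSum a (Complex.exp (-(t : ℂ) + (t * √t * u : ℝ) * Complex.I)) *
      Complex.exp (-(n * (t * √t * u : ℝ) * Complex.I)) =
      realPowerSum a (Real.exp (-t)) * I t := by
    rw [hI]
    simp only
    rw [← intervalIntegral.integral_const_mul]
    congr 1
    ext u
    have h1 : -(t : ℂ) + (t * √t : ℝ) * (u * Complex.I) =
      -(t : ℂ) + (t * √t * u : ℝ) * Complex.I := by
      push_cast
      ring
    have h2 : -((c / √t : ℝ) * ((u : ℂ) * Complex.I)) = -(n * (t * √t * u : ℝ) * Complex.I) := by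
      have h3 : c / √t = n * (t * √t) := by
        rw [hnτ]
        field_simp
        rw [pow_two, hsq]
      rw [h3]
      push_cast
      ring
    have hG' : (realPowerSum a (Real.exp (-t)) : ℂ) ≠ 0 := Complex.ofReal_ne_zero.2 hG
    rw [scaledMgf, h1, h2]
    field_simp
  rw [hint_eq, Complex.real_smul] at hcoef'
  have hexp : Real.exp (-t) ^ n = (Real.exp (c / t))⁻¹ := by
    rw [← Real.exp_nat_mul, ← Real.exp_neg]
    congr 1
    rw [hnτ]
    field_simp
  have hexp2 : Real.exp (2 * (c / t)) = Real.exp (c / t) * Real.exp (c / t) := by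
    rw [← Real.exp_add, two_mul]
  have hsqt : √(t / Real.pi) = √t / √Real.pi := Real.sqrt_div hτ0.le _
  have hsc : √c * √c = c := Real.mul_self_sqrt hc.le
  rw [← Complex.ofReal_pow, hexp] at hcoef'
  rw [hexp2, hnτ]
  simp only [hD]
  rw [hsqt]
  have hE : Real.exp (c / t) ≠ 0 := (Real.exp_pos _).ne'
  have hsc0 : √c ≠ 0 := (Real.sqrt_pos.2 hc).ne'
  have hsp0 : √Real.pi ≠ 0 := (Real.sqrt_pos.2 hpi).ne'
  have key := saddle_rearrange (G := realPowerSum a (Real.exp (-t))) (I := I t) (A := a n)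
    (Complex.ofReal_ne_zero.2 hst.ne') (Complex.ofReal_ne_zero.2 hsc0)
    (Complex.ofReal_ne_zero.2 hE)
    (Complex.ofReal_ne_zero.2 hsp0) (by
      rw [← Complex.ofReal_mul √t, hsq, ← Complex.ofReal_mul, hcoef', Complex.ofReal_inv])
  rw [← Complex.ofReal_mul √t, hsq, ← Complex.ofReal_mul √c, hsc] at key
  generalize Real.exp (c / t) = E at *
  push_cast
  exact key

end saddle

/-! ### The dilogarithm -/

/-- The function `-Li₂(-z) = ∑ (-1) ^ n z ^ (n + 1) / (n + 1) ^ 2`. -/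
noncomputable def negDilog (z : ℝ) : ℝ := ∑' n : ℕ, (-1) ^ n * z ^ (n + 1) / ((n : ℝ) + 1) ^ 2

lemma summable_one_div_add_one_sq : Summable fun n : ℕ => 1 / ((n : ℝ) + 1) ^ 2 := by
  have h := (summable_nat_add_iff 1).2 hasSum_zeta_two.summable
  simpa using h

lemma continuousOn_negDilog : ContinuousOn negDilog (Set.Icc 0 1) := by
  refine continuousOn_tsum (fun n => by fun_prop) summable_one_div_add_one_sq fun n z hz => ?_
  rw [norm_div, norm_mul, norm_pow, norm_pow, norm_neg, norm_one, one_pow, one_mul, norm_pow,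
    Real.norm_of_nonneg hz.1, Real.norm_of_nonneg (by positivity : (0 : ℝ) ≤ (n : ℝ) + 1)]
  gcongr
  exact pow_le_one₀ hz.1 hz.2

lemma negDilog_zero : negDilog 0 = 0 := by
  simp [negDilog]

lemma hasDerivAt_negDilog {z : ℝ} (h0 : 0 < z) (h1 : z < 1) :
    HasDerivAt negDilog (Real.log (1 + z) / z) z := by
  obtain ⟨r, hzr, hr1⟩ := exists_between h1
  have hr0 : 0 < r := h0.trans hzr
  have hder : ∀ (n : ℕ) (x : ℝ),
      HasDerivAt (fun x : ℝ => (-1) ^ n * x ^ (n + 1) / ((n : ℝ) + 1) ^ 2)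
      ((-1) ^ n * x ^ n / ((n : ℝ) + 1)) x := by
    intro n x
    have h := (((hasDerivAt_pow (n + 1) x).const_mul ((-1 : ℝ) ^ n)).div_const
      (((n : ℝ) + 1) ^ 2))
    refine h.congr_deriv ?_
    push_cast
    field_simp
  have hz : |z| < 1 := by rwa [abs_of_pos h0]
  have h := hasDerivAt_tsum_of_isPreconnected
    (g := fun (n : ℕ) (x : ℝ) => (-1) ^ n * x ^ (n + 1) / ((n : ℝ) + 1) ^ 2)
    (g' := fun (n : ℕ) (x : ℝ) => (-1) ^ n * x ^ n / ((n : ℝ) + 1))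
    (summable_geometric_of_lt_one hr0.le hr1) Metric.isOpen_ball
    (convex_ball (0 : ℝ) r).isPreconnected (fun n x _ => hder n x) (fun n x hx => ?_)
    (Metric.mem_ball_self hr0) (by simp) (y := z)
    (by rwa [mem_ball_zero_iff, Real.norm_eq_abs, abs_of_pos h0])
  · refine HasDerivAt.congr_deriv (f := negDilog) h ?_
    have hs := Real.hasSum_pow_div_log_of_abs_lt_one (x := -z) (by rwa [abs_neg])
    rw [sub_neg_eq_add] at hs
    have hs' := (hs.mul_left (-z⁻¹)).tsum_eq
    rw [div_eq_inv_mul, ← neg_mul_neg (z⁻¹), ← hs']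
    congr 1
    ext n
    rw [pow_succ, neg_pow z]
    field_simp
  · rw [mem_ball_zero_iff] at hx
    rw [norm_div, norm_mul, norm_pow, norm_pow, norm_neg, norm_one, one_pow, one_mul,
      Real.norm_of_nonneg (by positivity : (0 : ℝ) ≤ (n : ℝ) + 1)]
    refine (div_le_self (by positivity) (by linarith [(Nat.cast_nonneg n : (0 : ℝ) ≤ n)])).trans ?_
    gcongr

lemma negDilog_one : negDilog 1 = Real.pi ^ 2 / 12 := by
  have hz := hasSum_zeta_two
  generalize hP : Real.pi ^ 2 / 6 = P at hz
  have he : HasSum (fun n : ℕ => 1 / ((2 * n : ℕ) : ℝ) ^ 2) (1 / 4 * P) := by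
    have h1 : (fun n : ℕ => 1 / ((2 * n : ℕ) : ℝ) ^ 2) =
        fun n : ℕ => 1 / 4 * (1 / (n : ℝ) ^ 2) := by
      ext n
      push_cast
      ring
    rw [h1]
    exact hz.mul_left (1 / 4)
  have hodd : Summable fun n : ℕ => 1 / ((2 * n + 1 : ℕ) : ℝ) ^ 2 :=
    hz.summable.comp_injective (i := fun n => 2 * n + 1) fun a b h => by simpa using h
  obtain ⟨O, hO⟩ := hodd
  have ho : 1 / 4 * P + O = P :=
    (HasSum.even_add_odd (f := fun n : ℕ => 1 / (n : ℝ) ^ 2) he hO).unique hz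
  have he' : HasSum (fun n : ℕ => 1 / ((2 * (n + 1) : ℕ) : ℝ) ^ 2) (1 / 4 * P) := by
    have h := (hasSum_nat_add_iff' (f := fun n : ℕ => 1 / ((2 * n : ℕ) : ℝ) ^ 2) 1).2 he
    simpa using h
  have key : HasSum (fun n : ℕ => (-1) ^ n * (1 : ℝ) ^ (n + 1) / ((n : ℝ) + 1) ^ 2)
      (O + -(1 / 4 * P)) := by
    refine HasSum.even_add_odd ?_ ?_
    · have h1 : (fun n : ℕ => (-1) ^ (2 * n) * (1 : ℝ) ^ (2 * n + 1) /
          (((2 * n : ℕ) : ℝ) + 1) ^ 2) =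
          fun n : ℕ => 1 / ((2 * n + 1 : ℕ) : ℝ) ^ 2 := by
        ext n
        simp
      rw [h1]
      exact hO
    · have h1 : (fun n : ℕ => (-1) ^ (2 * n + 1) * (1 : ℝ) ^ (2 * n + 1 + 1) /
          (((2 * n + 1 : ℕ) : ℝ) + 1) ^ 2) =
          fun n : ℕ => -(1 / ((2 * (n + 1) : ℕ) : ℝ) ^ 2) := by
        ext n
        rw [pow_succ, pow_mul]
        push_cast
        ring
      rw [h1]
      exact he'.neg
  rw [negDilog, key.tsum_eq]
  linarith

/-! ### Exponent and amplitude of the trial solution -/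

section profile

variable {k : ℕ} {y : ℝ}

/-- The numerator of `d/dy log (y (1 + y ^ k) / (1 + y ^ (k + 1)))`. -/
noncomputable def flowDenom (k : ℕ) (y : ℝ) : ℝ := 1 + (k + 1) * y ^ k - k * y ^ (k + 1)

lemma one_le_flowDenom (h0 : 0 ≤ y) (h1 : y ≤ 1) : 1 ≤ flowDenom k y := by
  have h2 : 0 ≤ y ^ k := pow_nonneg h0 k
  have h3 : y ^ k * y ≤ y ^ k := mul_le_of_le_one_right h2 h1
  have h4 := mul_le_mul_of_nonneg_left h3 (Nat.cast_nonneg k : (0 : ℝ) ≤ k)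
  rw [flowDenom, pow_succ]
  linarith

/-- The solution `y` of `e ^ (-s) = y (1 + y ^ k) / (1 + y ^ (k + 1))` satisfies
`y' = -y * flowSpeed k y`. -/
noncomputable def flowSpeed (k : ℕ) (y : ℝ) : ℝ :=
  (1 + y ^ k) * (1 + y ^ (k + 1)) / flowDenom k y

/-- Minus the derivative of the exponent of the trial solution. To leading order the trial solution
is multiplied by `f = exp (-logRatio k y) = (1 + y ^ (k + 1)) / (1 + y ^ k)` when its index
increases by one. This `f` solves the characteristic equation
`1 = f + x ^ k (1 - x) f ^ (k + 1)` of the recursion for the sums over runs, where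
`x = y (1 + y ^ k) / (1 + y ^ (k + 1))`. -/
noncomputable def logRatio (k : ℕ) (y : ℝ) : ℝ := Real.log (1 + y ^ k) - Real.log (1 + y ^ (k + 1))

/-- The exponent of the trial solution: the antiderivative of `-logRatio` along the flow that
vanishes at `y = 0`. -/
noncomputable def trialExponent (k : ℕ) (y : ℝ) : ℝ :=
  negDilog (y ^ k) / k - negDilog (y ^ (k + 1)) / (k + 1) + logRatio k y ^ 2 / 2

/-- The logarithm of the amplitude of the trial solution, chosen so that the first order terms of
the residual cancel, see `trial_first_order`. -/
noncomputable def trialLogAmplitude (k : ℕ) (y : ℝ) : ℝ :=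
  (logRatio k y - Real.log (flowDenom k y)) / 2

/-- The derivative of the logarithm of the amplitude along the flow. -/
noncomputable def trialSlope (k : ℕ) (y : ℝ) : ℝ :=
  -(flowSpeed k y / 2 * (k * y ^ k / (1 + y ^ k) - (k + 1) * y ^ (k + 1) / (1 + y ^ (k + 1)) -
    k * (k + 1) * (y ^ k - y ^ (k + 1)) / flowDenom k y))

lemma hasDerivAt_log_one_add_pow (m : ℕ) (h0 : 0 < y) :
    HasDerivAt (fun y : ℝ => Real.log (1 + y ^ m)) (m * y ^ m / (1 + y ^ m) / y) y := by
  have hA : (1 + y ^ m) ≠ 0 := by positivity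
  have h := ((hasDerivAt_pow m y).const_add 1).log hA
  refine h.congr_deriv ?_
  rcases m with _ | m
  · simp
  · rw [Nat.add_sub_cancel, pow_succ]
    field_simp

lemma hasDerivAt_logRatio (h0 : 0 < y) :
    HasDerivAt (logRatio k)
      ((k * y ^ k / (1 + y ^ k) - (k + 1) * y ^ (k + 1) / (1 + y ^ (k + 1))) / y) y := by
  have h := (hasDerivAt_log_one_add_pow k h0).sub (hasDerivAt_log_one_add_pow (k + 1) h0)
  refine HasDerivAt.congr_deriv (f := logRatio k) h ?_
  push_cast
  ring

/-- Along the flow the derivative of `logRatio` is `flowSpeed - 1`. -/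
lemma flowSpeed_mul_deriv_logRatio (h0 : 0 < y) (h1 : y ≤ 1) :
    (k * y ^ k / (1 + y ^ k) - (k + 1) * y ^ (k + 1) / (1 + y ^ (k + 1))) / y *
      (-(y * flowSpeed k y)) = flowSpeed k y - 1 := by
  have hQ : flowDenom k y ≠ 0 := (zero_lt_one.trans_le (one_le_flowDenom h0.le h1)).ne'
  have hA : 1 + y ^ k ≠ 0 := by positivity
  have hB : 1 + y ^ (k + 1) ≠ 0 := by positivity
  have hQ' : flowDenom k y = 1 + (k + 1) * y ^ k - k * y ^ (k + 1) := rfl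
  rw [flowSpeed]
  generalize flowDenom k y = Q at *
  field_simp
  rw [hQ', pow_succ]
  ring

lemma hasDerivAt_negDilog_pow {m : ℕ} (hm : 1 ≤ m) (h0 : 0 < y) (h1 : y < 1) :
    HasDerivAt (fun y : ℝ => negDilog (y ^ m) / m) (Real.log (1 + y ^ m) / y) y := by
  have h := ((hasDerivAt_negDilog (pow_pos h0 m) (pow_lt_one₀ h0.le h1 (by omega))).comp y
    (hasDerivAt_pow m y)).div_const (m : ℝ)
  refine HasDerivAt.congr_deriv (f := fun y : ℝ => negDilog (y ^ m) / m) h ?_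
  have hm0 : (m : ℝ) ≠ 0 := by positivity
  obtain ⟨m, rfl⟩ : ∃ n, m = n + 1 := ⟨m - 1, by omega⟩
  rw [Nat.add_sub_cancel, pow_succ]
  field_simp

lemma hasDerivAt_trialExponent (hk : 1 ≤ k) (h0 : 0 < y) (h1 : y < 1) :
    HasDerivAt (trialExponent k) (logRatio k y / y + logRatio k y *
      ((k * y ^ k / (1 + y ^ k) - (k + 1) * y ^ (k + 1) / (1 + y ^ (k + 1))) / y)) y := by
  have h := ((hasDerivAt_negDilog_pow hk h0 h1).sub
    (hasDerivAt_negDilog_pow (m := k + 1) (by omega) h0 h1)).add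
    (((hasDerivAt_logRatio (k := k) h0).pow 2).div_const 2)
  have hf : trialExponent k = fun y => negDilog (y ^ k) / k -
      negDilog (y ^ (k + 1)) / ((k + 1 : ℕ) : ℝ) + logRatio k y ^ 2 / 2 := by
    ext z
    rw [trialExponent, Nat.cast_add_one]
  rw [hf]
  refine h.congr_deriv ?_
  rw [logRatio]
  push_cast
  ring

lemma hasDerivAt_trialLogAmplitude (h0 : 0 < y) (h1 : y ≤ 1) :
    HasDerivAt (trialLogAmplitude k) (((k * y ^ k / (1 + y ^ k) -
      (k + 1) * y ^ (k + 1) / (1 + y ^ (k + 1))) / y -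
      k * (k + 1) * (y ^ k - y ^ (k + 1)) / flowDenom k y / y) / 2) y := by
  have hQ : flowDenom k y ≠ 0 := (zero_lt_one.trans_le (one_le_flowDenom h0.le h1)).ne'
  have hd : HasDerivAt (flowDenom k) (k * (k + 1) * (y ^ k - y ^ (k + 1)) / y) y := by
    have h := (((hasDerivAt_pow k y).const_mul ((k : ℝ) + 1)).const_add 1).sub
      ((hasDerivAt_pow (k + 1) y).const_mul (k : ℝ))
    refine HasDerivAt.congr_deriv (f := flowDenom k) h ?_
    rcases k with _ | k
    · simp
    · rw [Nat.add_sub_cancel, Nat.add_sub_cancel, pow_succ, pow_succ]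
      push_cast
      field_simp
      ring
  have h := ((hasDerivAt_logRatio (k := k) h0).sub (hd.log hQ)).div_const 2
  refine HasDerivAt.congr_deriv (f := trialLogAmplitude k) h ?_
  ring

/-- The first order terms of the residual of the trial solution cancel. -/
lemma trial_first_order (h0 : 0 < y) (h1 : y ≤ 1) :
    (1 + y ^ (k + 1)) / (1 + y ^ k) * (trialSlope k y - (flowSpeed k y - 1) / 2) +
      (1 - (1 + y ^ (k + 1)) / (1 + y ^ k)) * ((k + 1) * trialSlope k y -
        (k + 1) ^ 2 * ((flowSpeed k y - 1) / 2) - k * (k + 1) / 2) = 0 := by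
  have hQ : flowDenom k y ≠ 0 := (zero_lt_one.trans_le (one_le_flowDenom h0.le h1)).ne'
  have hA : 1 + y ^ k ≠ 0 := by positivity
  have hB : 1 + y ^ (k + 1) ≠ 0 := by positivity
  have hQ' : flowDenom k y = 1 + (k + 1) * y ^ k - k * y ^ (k + 1) := rfl
  rw [trialSlope, flowSpeed]
  generalize flowDenom k y = Q at *
  field_simp
  rw [hQ', pow_succ]
  ring

/-- The characteristic equation of the recursion for the sums over runs. -/
lemma one_sub_ratio_eq (hx0 : 0 < y) :
    (y * (1 + y ^ k) / (1 + y ^ (k + 1))) ^ k * (1 - y * (1 + y ^ k) / (1 + y ^ (k + 1))) *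
      ((1 + y ^ (k + 1)) / (1 + y ^ k)) ^ (k + 1) = 1 - (1 + y ^ (k + 1)) / (1 + y ^ k) := by
  have hA : 1 + y ^ k ≠ 0 := by positivity
  have hB : 1 + y ^ (k + 1) ≠ 0 := by positivity
  have h : (y * (1 + y ^ k) / (1 + y ^ (k + 1))) ^ k * ((1 + y ^ (k + 1)) / (1 + y ^ k)) ^ k =
      y ^ k := by
    rw [← mul_pow]
    congr 1
    field_simp
  rw [pow_succ ((1 + y ^ (k + 1)) / (1 + y ^ k))]
  calc _ = ((y * (1 + y ^ k) / (1 + y ^ (k + 1))) ^ k * ((1 + y ^ (k + 1)) / (1 + y ^ k)) ^ k) *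
        ((1 - y * (1 + y ^ k) / (1 + y ^ (k + 1))) * ((1 + y ^ (k + 1)) / (1 + y ^ k))) := by ring
    _ = _ := by
      rw [h]
      field_simp
      ring

end profile

/-! ### The flow -/

section flow

variable {k : ℕ} {s t d y : ℝ}

/-- The right-hand side of the equation `e ^ (-s) = y (1 + y ^ k) / (1 + y ^ (k + 1))`. -/
noncomputable def flowMap (k : ℕ) (y : ℝ) : ℝ := y * (1 + y ^ k) / (1 + y ^ (k + 1))

lemma hasDerivAt_flowMap (h0 : 0 ≤ y) :
    HasDerivAt (flowMap k) (flowDenom k y / (1 + y ^ (k + 1)) ^ 2) y := by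
  have hB : 1 + y ^ (k + 1) ≠ 0 := by positivity
  have h := ((hasDerivAt_id y).mul ((hasDerivAt_pow k y).const_add 1)).div
    ((hasDerivAt_pow (k + 1) y).const_add 1) hB
  refine HasDerivAt.congr_deriv (f := flowMap k) h ?_
  congr 1
  simp only [id, Pi.mul_apply, flowDenom]
  rcases k with _ | k
  · simp
    ring
  · rw [Nat.add_sub_cancel, Nat.add_sub_cancel]
    push_cast
    ring

lemma continuousOn_flowMap : ContinuousOn (flowMap k) (Set.Icc 0 1) := fun _ hy =>
  (hasDerivAt_flowMap hy.1).continuousAt.continuousWithinAt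

lemma sub_le_flowMap_sub {y y' : ℝ} (h0 : 0 ≤ y) (h : y ≤ y') (h1 : y' ≤ 1) :
    1 / 4 * (y' - y) ≤ flowMap k y' - flowMap k y := by
  refine Convex.mul_sub_le_image_sub_of_le_deriv (convex_Icc (0 : ℝ) 1) continuousOn_flowMap ?_ ?_
    y ⟨h0, h.trans h1⟩ y' ⟨h0.trans h, h1⟩ h
  · rw [interior_Icc]
    exact fun z hz => (hasDerivAt_flowMap hz.1.le).differentiableAt.differentiableWithinAt
  · rw [interior_Icc]
    intro z hz
    rw [(hasDerivAt_flowMap hz.1.le).deriv]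
    have h2 : z ^ (k + 1) ≤ 1 := pow_le_one₀ hz.1.le hz.2.le
    have h3 : 0 ≤ z ^ (k + 1) := pow_nonneg hz.1.le _
    have h4 := one_le_flowDenom (k := k) hz.1.le hz.2.le
    rw [div_le_div_iff₀ (by norm_num) (by positivity)]
    nlinarith

lemma exists_flow (k : ℕ) (s : ℝ) :
    ∃ y, 0 ≤ s → y ∈ Set.Icc (0 : ℝ) 1 ∧ flowMap k y = Real.exp (-s) := by
  by_cases hs : 0 ≤ s
  · have h := intermediate_value_Icc zero_le_one (continuousOn_flowMap (k := k))
    obtain ⟨y, hy, he⟩ := h (a := Real.exp (-s)) ⟨by simp [flowMap, Real.exp_nonneg], by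
      rw [flowMap]
      simpa using hs⟩
    exact ⟨y, fun _ => ⟨hy, he⟩⟩
  · exact ⟨0, fun h => absurd h hs⟩

/-- The solution `y` of `e ^ (-s) = y (1 + y ^ k) / (1 + y ^ (k + 1))` in the unit interval, for
`s ≥ 0`; the value at negative `s` is arbitrary. -/
noncomputable def flow (k : ℕ) (s : ℝ) : ℝ := (exists_flow k s).choose

lemma flow_nonneg (hs : 0 ≤ s) : 0 ≤ flow k s := ((exists_flow k s).choose_spec hs).1.1

lemma flow_le_one (hs : 0 ≤ s) : flow k s ≤ 1 := ((exists_flow k s).choose_spec hs).1.2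

lemma flowMap_flow (hs : 0 ≤ s) : flowMap k (flow k s) = Real.exp (-s) :=
  ((exists_flow k s).choose_spec hs).2

lemma flow_pos (hs : 0 ≤ s) : 0 < flow k s := by
  refine (flow_nonneg hs).lt_of_ne fun h => ?_
  have h1 := flowMap_flow (k := k) hs
  rw [← h, flowMap, zero_mul, zero_div] at h1
  exact (Real.exp_pos _).ne h1

lemma flow_lt_one (hs : 0 < s) : flow k s < 1 := by
  refine (flow_le_one hs.le).lt_of_ne fun h => ?_
  have h1 := flowMap_flow (k := k) hs.le
  rw [h] at h1
  have h2 : flowMap k 1 = 1 := by simp [flowMap]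
  rw [h2, eq_comm, Real.exp_eq_one_iff] at h1
  linarith

lemma flow_le_exp (hs : 0 ≤ s) : flow k s ≤ Real.exp (-s) := by
  have h0 := flow_nonneg (k := k) hs
  have h1 := flow_le_one (k := k) hs
  rw [← flowMap_flow (k := k) hs, flowMap, le_div_iff₀ (by positivity)]
  refine mul_le_mul_of_nonneg_left ?_ h0
  have h2 : flow k s ^ (k + 1) ≤ flow k s ^ k := pow_le_pow_of_le_one h0 h1 (Nat.le_succ k)
  linarith

lemma abs_flow_sub_le (hs : 0 ≤ s) (hd : 0 ≤ d) :
    |flow k (s + d) - flow k s| ≤ 4 * Real.exp (-s) * d := by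
  have h1 := flowMap_flow (k := k) hs
  have h2 := flowMap_flow (k := k) (add_nonneg hs hd)
  have h3 : Real.exp (-(s + d)) ≤ Real.exp (-s) := Real.exp_le_exp.2 (by linarith)
  have h4 : Real.exp (-s) * (1 - d) ≤ Real.exp (-(s + d)) := by
    rw [neg_add, Real.exp_add]
    exact mul_le_mul_of_nonneg_left (Real.one_sub_le_exp_neg d) (Real.exp_pos _).le
  rcases le_total (flow k (s + d)) (flow k s) with h | h
  · have h5 := sub_le_flowMap_sub (k := k) (flow_nonneg (add_nonneg hs hd)) h (flow_le_one hs)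
    rw [abs_of_nonpos (by linarith)]
    linarith
  · have h5 := sub_le_flowMap_sub (k := k) (flow_nonneg hs) h (flow_le_one (add_nonneg hs hd))
    rw [abs_of_nonneg (by linarith)]
    nlinarith [Real.exp_pos (-s)]

lemma abs_flow_sub_le_abs {s' : ℝ} (hs : 0 ≤ s) (hs' : 0 ≤ s') :
    |flow k s' - flow k s| ≤ 4 * |s' - s| := by
  wlog h : s ≤ s' generalizing s s'
  · rw [abs_sub_comm, abs_sub_comm s']
    exact this hs' hs (le_of_not_ge h)
  have h1 := abs_flow_sub_le (k := k) hs (sub_nonneg.2 h)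
  rw [add_sub_cancel] at h1
  rw [abs_of_nonneg (sub_nonneg.2 h)]
  refine h1.trans (mul_le_mul_of_nonneg_right ?_ (sub_nonneg.2 h))
  have : Real.exp (-s) ≤ 1 := Real.exp_le_one_iff.2 (by linarith)
  linarith

lemma continuousOn_flow : ContinuousOn (flow k) (Set.Ici 0) := by
  refine LipschitzOnWith.continuousOn (K := 4) (LipschitzOnWith.of_dist_le_mul fun x hx y hy => ?_)
  rw [Real.dist_eq, Real.dist_eq]
  exact abs_flow_sub_le_abs hy hx

lemma flow_zero : flow k 0 = 1 := by
  have h1 := flowMap_flow (k := k) le_rfl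
  have h2 := sub_le_flowMap_sub (k := k) (y' := 1) (flow_nonneg (k := k) le_rfl)
    (flow_le_one le_rfl) le_rfl
  have h3 : flowMap k 1 = 1 := by simp [flowMap]
  rw [h1, h3, neg_zero, Real.exp_zero] at h2
  linarith [flow_le_one (k := k) (le_refl 0)]

lemma tendsto_flow_zero : Tendsto (flow k) (𝓝[>] 0) (𝓝 1) := by
  have h := (continuousOn_flow (k := k) 0 Set.self_mem_Ici).mono Set.Ioi_subset_Ici_self
  rw [ContinuousWithinAt, flow_zero] at h
  exact h

lemma tendsto_flow_atTop : Tendsto (flow k) atTop (𝓝 0) := by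
  refine squeeze_zero' ?_ ?_ (Real.tendsto_exp_atBot.comp tendsto_neg_atTop_atBot)
  · filter_upwards [eventually_ge_atTop 0] with s hs using flow_nonneg hs
  · filter_upwards [eventually_ge_atTop 0] with s hs using flow_le_exp hs

/-- The flow is differentiated as the inverse of `-log (flowMap k y)`. -/
lemma hasDerivAt_flow (hs : 0 < s) :
    HasDerivAt (flow k) (-(flow k s * flowSpeed k (flow k s))) s := by
  have h0 := flow_pos (k := k) hs.le
  have hcont : ContinuousAt (flow k) s := continuousOn_flow.continuousAt (Ici_mem_nhds hs)
  have hQ := zero_lt_one.trans_le (one_le_flowDenom (k := k) h0.le (flow_le_one hs.le))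
  have hψ : flowMap k (flow k s) ≠ 0 := by
    rw [flowMap_flow hs.le]
    exact (Real.exp_pos _).ne'
  have hf := ((hasDerivAt_flowMap (k := k) h0.le).log hψ).neg
  have h := HasDerivAt.of_local_left_inverse hcont hf ?_ ?_
  · refine h.congr_deriv ?_
    rw [flowSpeed, flowMap]
    have hA : 1 + flow k s ^ k ≠ 0 := by positivity
    have hB : 1 + flow k s ^ (k + 1) ≠ 0 := by positivity
    field_simp
  · rw [flowMap]
    have hA : 0 < 1 + flow k s ^ k := by positivity
    have hB : 0 < 1 + flow k s ^ (k + 1) := by positivity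
    refine neg_ne_zero.2 (ne_of_gt ?_)
    positivity
  · filter_upwards [Ioi_mem_nhds hs] with u hu
    simp only [Pi.neg_apply]
    rw [flowMap_flow (le_of_lt hu), Real.log_exp, neg_neg]

lemma hasDerivAt_logRatio_flow (hs : 0 < s) :
    HasDerivAt (fun s => logRatio k (flow k s)) (flowSpeed k (flow k s) - 1) s := by
  have h0 := flow_pos (k := k) hs.le
  exact ((hasDerivAt_logRatio h0).comp s (hasDerivAt_flow hs)).congr_deriv
    (flowSpeed_mul_deriv_logRatio h0 (flow_le_one hs.le))

lemma hasDerivAt_trialExponent_flow (hk : 1 ≤ k) (hs : 0 < s) :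
    HasDerivAt (fun s => trialExponent k (flow k s)) (-logRatio k (flow k s)) s := by
  have h0 := flow_pos (k := k) hs.le
  refine ((hasDerivAt_trialExponent hk h0 (flow_lt_one hs)).comp s
    (hasDerivAt_flow hs)).congr_deriv ?_
  rw [add_mul, mul_assoc, flowSpeed_mul_deriv_logRatio h0 (flow_le_one hs.le)]
  field_simp
  ring

lemma hasDerivAt_trialLogAmplitude_flow (hs : 0 < s) :
    HasDerivAt (fun s => trialLogAmplitude k (flow k s)) (trialSlope k (flow k s)) s := by
  have h0 := flow_pos (k := k) hs.le
  refine ((hasDerivAt_trialLogAmplitude (k := k) h0 (flow_le_one hs.le)).comp s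
    (hasDerivAt_flow hs)).congr_deriv ?_
  rw [trialSlope]
  field_simp

end flow

/-! ### Taylor expansion along the flow -/

section taylor

variable {k : ℕ}

lemma contDiffOn_flowSpeed : ContDiffOn ℝ 1 (flowSpeed k) (Set.Icc 0 1) := by
  unfold flowSpeed flowDenom
  refine ContDiffOn.div (by fun_prop) (by fun_prop) fun y hy => ?_
  exact (zero_lt_one.trans_le (one_le_flowDenom hy.1 hy.2)).ne'

lemma contDiffOn_ratio (m : ℕ) : ContDiffOn ℝ 1 (fun y : ℝ => y ^ m / (1 + y ^ m)) (Set.Icc 0 1) :=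
  ContDiffOn.div (by fun_prop) (by fun_prop) fun y hy => by
    have := pow_nonneg hy.1 m
    positivity

lemma contDiffOn_trialSlope : ContDiffOn ℝ 1 (trialSlope k) (Set.Icc 0 1) := by
  have h1 : ContDiffOn ℝ 1 (fun y : ℝ => (k : ℝ) * (k + 1) * (y ^ k - y ^ (k + 1)) / flowDenom k y)
      (Set.Icc 0 1) := by
    unfold flowDenom
    refine ContDiffOn.div (by fun_prop) (by fun_prop) fun y hy => ?_
    exact (zero_lt_one.trans_le (one_le_flowDenom hy.1 hy.2)).ne'
  have h := ((contDiffOn_flowSpeed (k := k)).div_const 2).mul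
    ((((contDiffOn_const (c := (k : ℝ))).mul (contDiffOn_ratio k)).sub
      ((contDiffOn_const (c := (k : ℝ) + 1)).mul (contDiffOn_ratio (k + 1)))).sub h1)
  refine h.neg.congr fun y _ => ?_
  rw [trialSlope]
  ring

lemma exists_lipschitz_of_contDiffOn {g : ℝ → ℝ} (hg : ContDiffOn ℝ 1 g (Set.Icc 0 1)) :
    ∃ C, 0 ≤ C ∧ ∀ y ∈ Set.Icc (0 : ℝ) 1, ∀ z ∈ Set.Icc (0 : ℝ) 1, |g y - g z| ≤ C * |y - z| := by
  obtain ⟨K, hK⟩ := hg.exists_lipschitzOnWith one_ne_zero (convex_Icc 0 1) isCompact_Icc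
  exact ⟨K, K.2, fun y hy z hz => hK.dist_le_mul y hy z hz⟩

lemma abs_sub_le_of_abs_deriv_le {F F' : ℝ → ℝ} {M d : ℝ} (hd : 0 ≤ d)
    (hF : ∀ u ∈ Set.Icc 0 d, HasDerivAt F (F' u) u) (hb : ∀ u ∈ Set.Icc 0 d, |F' u| ≤ M) :
    |F d - F 0| ≤ M * d := by
  have h := norm_image_sub_le_of_norm_deriv_le_segment' (f := F) (f' := F') (C := M)
    (fun u hu => (hF u hu).hasDerivWithinAt) (fun u hu => hb u ⟨hu.1, hu.2.le⟩) d ⟨hd, le_rfl⟩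
  rwa [sub_zero] at h

/-- Bounds for the derivatives and the Taylor remainders of exponent and amplitude along the
flow. All of them carry the decay factor `e ^ (-s)`. -/
lemma exists_taylor_bound (hk : 1 ≤ k) : ∃ C, 0 ≤ C ∧ ∀ s, 0 < s →
    |flowSpeed k (flow k s) - 1| ≤ C * Real.exp (-s) ∧
    |trialSlope k (flow k s)| ≤ C * Real.exp (-s) ∧ ∀ d, 0 ≤ d →
    |trialLogAmplitude k (flow k (s + d)) - trialLogAmplitude k (flow k s) -
      d * trialSlope k (flow k s)| ≤ C * Real.exp (-s) * d ^ 2 ∧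
    |trialExponent k (flow k (s + d)) - trialExponent k (flow k s) + d * logRatio k (flow k s) +
      d ^ 2 * ((flowSpeed k (flow k s) - 1) / 2)| ≤ C * Real.exp (-s) * d ^ 3 := by
  obtain ⟨C₁, h₁, hV⟩ := exists_lipschitz_of_contDiffOn (contDiffOn_flowSpeed (k := k))
  obtain ⟨C₂, h₂, hp⟩ := exists_lipschitz_of_contDiffOn (contDiffOn_trialSlope (k := k))
  have hk0 : k ≠ 0 := by omega
  have hmem : ∀ {s : ℝ}, 0 ≤ s → flow k s ∈ Set.Icc (0 : ℝ) 1 := fun hs =>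
    ⟨flow_nonneg hs, flow_le_one hs⟩
  have h0 : (0 : ℝ) ∈ Set.Icc (0 : ℝ) 1 := ⟨le_rfl, zero_le_one⟩
  refine ⟨4 * (C₁ + C₂), by positivity, fun s hs => ?_⟩
  have he := Real.exp_pos (-s)
  have hle := flow_le_exp (k := k) hs.le
  have habs : |flow k s - 0| ≤ Real.exp (-s) := by
    rwa [sub_zero, abs_of_nonneg (flow_nonneg hs.le)]
  refine ⟨?_, ?_, fun d hd => ?_⟩
  · have h := hV _ (hmem hs.le) 0 h0
    have h3 : flowSpeed k 0 = 1 := by simp [flowSpeed, flowDenom, hk0]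
    rw [h3] at h
    nlinarith [mul_le_mul_of_nonneg_left habs h₁]
  · have h := hp _ (hmem hs.le) 0 h0
    have h3 : trialSlope k 0 = 0 := by simp [trialSlope, hk0]
    rw [h3, sub_zero] at h
    nlinarith [mul_le_mul_of_nonneg_left habs h₂]
  · set D := 4 * (C₁ + C₂) * Real.exp (-s) with hD
    have hD0 : 0 ≤ D := by positivity
    have hVd : ∀ u, 0 ≤ u → |flowSpeed k (flow k (s + u)) - flowSpeed k (flow k s)| ≤ D * u := by
      intro u hu
      have h := hV _ (hmem (add_nonneg hs.le hu)) _ (hmem hs.le)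
      have h4 := mul_le_mul_of_nonneg_left (abs_flow_sub_le (k := k) hs.le hu) h₁
      have h5 : 0 ≤ C₂ * (Real.exp (-s) * u) := by positivity
      rw [hD]
      linarith
    have hpd : ∀ u, 0 ≤ u → |trialSlope k (flow k (s + u)) - trialSlope k (flow k s)| ≤ D * u := by
      intro u hu
      have h := hp _ (hmem (add_nonneg hs.le hu)) _ (hmem hs.le)
      have h4 := mul_le_mul_of_nonneg_left (abs_flow_sub_le (k := k) hs.le hu) h₂
      have h5 : 0 ≤ C₁ * (Real.exp (-s) * u) := by positivity
      rw [hD]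
      linarith
    constructor
    · have h := abs_sub_le_of_abs_deriv_le (M := D * d) hd (F := fun u =>
          trialLogAmplitude k (flow k (s + u)) - u * trialSlope k (flow k s))
        (F' := fun u => trialSlope k (flow k (s + u)) - 1 * trialSlope k (flow k s))
        (fun u hu => (HasDerivAt.comp_const_add s u (hasDerivAt_trialLogAmplitude_flow
          (by linarith [hu.1]))).sub ((hasDerivAt_id u).mul_const _))
        (fun u hu => by
          rw [one_mul]
          exact (hpd u hu.1).trans (mul_le_mul_of_nonneg_left hu.2 hD0))
      simp only [add_zero, zero_mul, sub_zero] at h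
      calc _ = _ := by
            congr 1
            ring
        _ ≤ _ := h
        _ = _ := by ring
    · have hL : ∀ u, 0 ≤ u → |logRatio k (flow k (s + u)) - logRatio k (flow k s) -
          u * (flowSpeed k (flow k s) - 1)| ≤ D * u ^ 2 := by
        intro u hu
        have h := abs_sub_le_of_abs_deriv_le (M := D * u) hu (F := fun v =>
            logRatio k (flow k (s + v)) - v * (flowSpeed k (flow k s) - 1))
          (F' := fun v => flowSpeed k (flow k (s + v)) - 1 - 1 * (flowSpeed k (flow k s) - 1))
          (fun v hv => (HasDerivAt.comp_const_add s v (hasDerivAt_logRatio_flow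
            (by linarith [hv.1]))).sub ((hasDerivAt_id v).mul_const _))
          (fun v hv => by
            rw [one_mul, sub_sub_sub_cancel_right]
            exact (hVd v hv.1).trans (mul_le_mul_of_nonneg_left hv.2 hD0))
        simp only [add_zero, zero_mul, sub_zero] at h
        calc _ = _ := by
              congr 1
              ring
          _ ≤ _ := h
          _ = _ := by ring
      have h := abs_sub_le_of_abs_deriv_le (M := D * d ^ 2) hd (F := fun u =>
          trialExponent k (flow k (s + u)) + u * logRatio k (flow k s) +
            u ^ 2 * ((flowSpeed k (flow k s) - 1) / 2))
        (F' := fun u => -logRatio k (flow k (s + u)) + 1 * logRatio k (flow k s) +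
          (2 : ℕ) * u ^ (2 - 1) * ((flowSpeed k (flow k s) - 1) / 2))
        (fun u hu => ((HasDerivAt.comp_const_add s u (hasDerivAt_trialExponent_flow hk
          (by linarith [hu.1]))).add ((hasDerivAt_id u).mul_const _)).add
          ((hasDerivAt_pow 2 u).mul_const _))
        (fun u hu => by
          have h1 := hL u hu.1
          rw [← abs_neg] at h1
          calc _ = _ := by
                congr 1
                push_cast
                ring
            _ ≤ _ := h1
            _ ≤ _ := mul_le_mul_of_nonneg_left (pow_le_pow_left₀ hu.1 hu.2 2) hD0)
      simp only [add_zero, zero_mul, zero_pow two_ne_zero] at h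
      calc _ = _ := by
            congr 1
            ring
        _ ≤ _ := h
        _ = _ := by ring

end taylor

/-! ### The trial solution and the sums over runs -/

section trial

variable {k : ℕ}

/-- The trial solution of the recursion for the sums over runs, as a function of `s = j t`. -/
noncomputable def trial (k : ℕ) (t s : ℝ) : ℝ :=
  Real.exp (trialExponent k (flow k s) / t + trialLogAmplitude k (flow k s))

/-- A second order estimate for a convex combination of exponentials whose first order terms
cancel. -/
lemma abs_convexComb_exp_sub_one_le {C ε t f u v z w : ℝ} (hC : 1 ≤ C) (hε0 : 0 ≤ ε)
    (hε1 : ε ≤ 1) (ht0 : 0 ≤ t) (ht : t ≤ 1 / (2 * C)) (hf0 : 0 ≤ f) (hf1 : f ≤ 1)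
    (hf : 1 - f ≤ C * ε)
    (hu : |u| ≤ C * ε) (hv : |v| ≤ C) (hz : |z - t * u| ≤ C * t ^ 2 * ε)
    (hw : |w - t * v| ≤ C * t ^ 2 * ε) (huv : f * u + (1 - f) * v = 0) :
    |f * Real.exp z + (1 - f) * Real.exp w - 1| ≤
      (4 * C ^ 2 + 4 * C ^ 3 + 2 * C) * (t ^ 2 * ε) := by
  have hC0 : 0 < C := by linarith
  have htC : 2 * C * t ≤ 1 := by
    rw [le_div_iff₀ (by positivity)] at ht
    linarith
  have ht1 : t ≤ 1 := by nlinarith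
  have htt : t ^ 2 ≤ t := by nlinarith
  have hz1 : |z| ≤ 2 * C * t * ε := by
    have h1 : |z| ≤ |z - t * u| + |t * u| := by
      have := abs_add_le (z - t * u) (t * u)
      rwa [sub_add_cancel] at this
    rw [abs_mul, abs_of_nonneg ht0] at h1
    have h2 := mul_le_mul_of_nonneg_left hu ht0
    have h3 : C * t ^ 2 * ε ≤ C * t * ε := by gcongr
    linarith
  have hw1 : |w| ≤ 2 * C * t := by
    have h1 : |w| ≤ |w - t * v| + |t * v| := by
      have := abs_add_le (w - t * v) (t * v)
      rwa [sub_add_cancel] at this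
    rw [abs_mul, abs_of_nonneg ht0] at h1
    have h2 := mul_le_mul_of_nonneg_left hv ht0
    have h3 : C * t ^ 2 * ε ≤ C * t * 1 := by gcongr
    linarith
  have hz2 : |z| ≤ 1 := hz1.trans (mul_le_one₀ htC hε0 hε1)
  have hez := Real.abs_exp_sub_one_sub_id_le hz2
  have hew := Real.abs_exp_sub_one_sub_id_le (hw1.trans htC)
  have hzs : z ^ 2 ≤ 4 * C ^ 2 * (t ^ 2 * ε) := by
    rw [← sq_abs]
    calc |z| ^ 2 ≤ (2 * C * t * ε) ^ 2 := by gcongr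
      _ = 4 * C ^ 2 * (t ^ 2 * (ε * ε)) := by ring
      _ ≤ 4 * C ^ 2 * (t ^ 2 * (ε * 1)) := by gcongr
      _ = _ := by ring
  have hws : w ^ 2 ≤ 4 * C ^ 2 * t ^ 2 := by
    rw [← sq_abs]
    calc |w| ^ 2 ≤ (2 * C * t) ^ 2 := by gcongr
      _ = _ := by ring
  have hf' : 0 ≤ 1 - f := by linarith
  have hsplit : f * Real.exp z + (1 - f) * Real.exp w - 1 =
      f * (Real.exp z - 1 - z) + (1 - f) * (Real.exp w - 1 - w) + f * (z - t * u) +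
        (1 - f) * (w - t * v) := by
    linear_combination t * huv
  rw [hsplit]
  have a1 : |f * (Real.exp z - 1 - z)| ≤ 4 * C ^ 2 * (t ^ 2 * ε) := by
    rw [abs_mul, abs_of_nonneg hf0]
    exact (mul_le_of_le_one_left (abs_nonneg _) hf1).trans (hez.trans hzs)
  have a2 : |(1 - f) * (Real.exp w - 1 - w)| ≤ 4 * C ^ 3 * (t ^ 2 * ε) := by
    rw [abs_mul, abs_of_nonneg hf']
    calc _ ≤ (C * ε) * (4 * C ^ 2 * t ^ 2) :=
          mul_le_mul hf (hew.trans hws) (abs_nonneg _) (by positivity)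
      _ = _ := by ring
  have a3 : |f * (z - t * u)| ≤ C * (t ^ 2 * ε) := by
    rw [abs_mul, abs_of_nonneg hf0, ← mul_assoc]
    exact (mul_le_of_le_one_left (abs_nonneg _) hf1).trans hz
  have a4 : |(1 - f) * (w - t * v)| ≤ C * (t ^ 2 * ε) := by
    rw [abs_mul, abs_of_nonneg hf', ← mul_assoc]
    exact (mul_le_of_le_one_left (abs_nonneg _) (by linarith)).trans hw
  have b1 := abs_add_le (f * (Real.exp z - 1 - z) + (1 - f) * (Real.exp w - 1 - w) +
    f * (z - t * u)) ((1 - f) * (w - t * v))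
  have b2 := abs_add_le (f * (Real.exp z - 1 - z) + (1 - f) * (Real.exp w - 1 - w))
    (f * (z - t * u))
  have b3 := abs_add_le (f * (Real.exp z - 1 - z)) ((1 - f) * (Real.exp w - 1 - w))
  linarith

/-- The exponent in the quotient of two values of the trial solution, apart from the leading
part. -/
noncomputable def trialStep (k : ℕ) (t s m : ℝ) : ℝ :=
  (trialExponent k (flow k (s + m * t)) - trialExponent k (flow k s)) / t +
    (trialLogAmplitude k (flow k (s + m * t)) - trialLogAmplitude k (flow k s)) +
    m * logRatio k (flow k s)

lemma exp_neg_logRatio {y : ℝ} (h0 : 0 < y) :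
    Real.exp (-logRatio k y) = (1 + y ^ (k + 1)) / (1 + y ^ k) := by
  rw [logRatio, neg_sub, Real.exp_sub, Real.exp_log (by positivity), Real.exp_log (by positivity)]

lemma trial_add (t s : ℝ) (hs : 0 < s) (m : ℕ) :
    trial k t (s + m * t) = trial k t s *
      (((1 + flow k s ^ (k + 1)) / (1 + flow k s ^ k)) ^ m * Real.exp (trialStep k t s m)) := by
  rw [← exp_neg_logRatio (flow_pos hs.le), ← Real.exp_nat_mul, ← Real.exp_add, trial, trial,
    ← Real.exp_add, trialStep]
  congr 1
  ring

/-- The trial solution satisfies the recursion for the sums over runs up to a relative error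
`O(t ^ 2 e ^ (-s))`. -/
lemma exists_trial_residual_bound (hk : 1 ≤ k) : ∃ C, 0 < C ∧ ∃ t₀, 0 < t₀ ∧ ∀ t, 0 < t → t ≤ t₀ →
    ∀ s, 0 < s →
    |trial k t (s + t) + Real.exp (-(t * (k * (k + 1) / 2))) * (Real.exp (-s) ^ k *
      (1 - Real.exp (-s))) * trial k t (s + (k + 1 : ℕ) * t) - trial k t s| ≤
      C * (t ^ 2 * Real.exp (-s)) * trial k t s := by
  obtain ⟨D, hD0, hD⟩ := exists_taylor_bound hk
  set K : ℝ := (k : ℝ) + 1 with hK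
  have hk0 : (0 : ℝ) ≤ k := Nat.cast_nonneg k
  have hK1 : 1 ≤ K := by linarith
  set C : ℝ := 1 + D * (K ^ 3 + K ^ 2) + K ^ 2 with hC
  have hC1 : 1 ≤ C := by
    have : 0 ≤ D * (K ^ 3 + K ^ 2) + K ^ 2 := by positivity
    linarith
  refine ⟨4 * C ^ 2 + 4 * C ^ 3 + 2 * C, by positivity, 1 / (2 * C), by positivity,
    fun t ht0 ht s hs => ?_⟩
  obtain ⟨hV, hp, hT⟩ := hD s hs
  have hy0 := flow_pos (k := k) hs.le
  have hy1 := flow_le_one (k := k) hs.le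
  have hye := flow_le_exp (k := k) hs.le
  have hfm := flowMap_flow (k := k) hs.le
  have hfo := trial_first_order (k := k) hy0 hy1
  have hid := one_sub_ratio_eq (k := k) hy0
  rw [flowMap] at hfm
  rw [hfm] at hid
  have hε0 := Real.exp_pos (-s)
  have hε1 : Real.exp (-s) ≤ 1 := Real.exp_le_one_iff.2 (by linarith)
  have h1 := trial_add (k := k) t s hs 1
  have h2 := trial_add (k := k) t s hs (k + 1)
  rw [Nat.cast_one, one_mul, pow_one] at h1
  set f := (1 + flow k s ^ (k + 1)) / (1 + flow k s ^ k) with hf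
  have hpk : flow k s ^ (k + 1) ≤ flow k s ^ k := pow_le_pow_of_le_one hy0.le hy1 (Nat.le_succ k)
  have hpk1 : flow k s ^ k ≤ flow k s := by
    simpa using pow_le_pow_of_le_one hy0.le hy1 hk
  have hA : 0 < 1 + flow k s ^ k := by positivity
  have hf0 : 0 ≤ f := by positivity
  have hf1 : f ≤ 1 := (div_le_one hA).2 (by linarith)
  have hfε : 1 - f ≤ Real.exp (-s) := by
    have h3 : 1 - f = (flow k s ^ k - flow k s ^ (k + 1)) / (1 + flow k s ^ k) := by
      rw [hf]
      field_simp
      ring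
    rw [h3]
    have h4 : 0 ≤ flow k s ^ (k + 1) := by positivity
    refine (div_le_self (by linarith) (by linarith [pow_pos hy0 k])).trans ?_
    linarith
  -- the Taylor remainder of the exponent of a step
  have hstep : ∀ m : ℝ, 0 ≤ m → m ≤ K → |trialStep k t s m - t * (m * trialSlope k (flow k s) -
      m ^ 2 * ((flowSpeed k (flow k s) - 1) / 2))| ≤
        D * (K ^ 3 + K ^ 2) * t ^ 2 * Real.exp (-s) := by
    intro m hm hmK
    obtain ⟨hT1, hT2⟩ := hT (m * t) (by positivity)
    have h3 : trialStep k t s m - t * (m * trialSlope k (flow k s) -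
        m ^ 2 * ((flowSpeed k (flow k s) - 1) / 2)) =
        (trialExponent k (flow k (s + m * t)) - trialExponent k (flow k s) +
          m * t * logRatio k (flow k s) +
          (m * t) ^ 2 * ((flowSpeed k (flow k s) - 1) / 2)) / t +
        (trialLogAmplitude k (flow k (s + m * t)) - trialLogAmplitude k (flow k s) -
          m * t * trialSlope k (flow k s)) := by
      rw [trialStep]
      field_simp
      ring
    rw [h3]
    refine (abs_add_le _ _).trans ?_
    rw [abs_div, abs_of_pos ht0]
    have h4 : D * Real.exp (-s) * (m * t) ^ 3 / t ≤ D * Real.exp (-s) * (K ^ 3 * t ^ 2) := by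
      rw [div_le_iff₀ ht0]
      calc _ = D * Real.exp (-s) * (m ^ 3 * t ^ 2) * t := by ring
        _ ≤ _ := by gcongr
    have h5 : D * Real.exp (-s) * (m * t) ^ 2 ≤ D * Real.exp (-s) * (K ^ 2 * t ^ 2) := by
      rw [mul_pow]
      gcongr
    have h6 := div_le_div_of_nonneg_right hT2 ht0.le
    linarith
  have hu : ∀ m : ℝ, 0 ≤ m → m ≤ K → |m * trialSlope k (flow k s) -
      m ^ 2 * ((flowSpeed k (flow k s) - 1) / 2)| ≤ D * (K ^ 3 + K ^ 2) * Real.exp (-s) := by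
    intro m hm hmK
    refine (abs_sub _ _).trans ?_
    rw [abs_mul, abs_mul, abs_div, abs_of_nonneg hm, abs_of_nonneg (sq_nonneg m), abs_two]
    have h3 : m * |trialSlope k (flow k s)| ≤ K ^ 3 * (D * Real.exp (-s)) := by
      have : K ≤ K ^ 3 := le_self_pow₀ hK1 (by norm_num)
      exact mul_le_mul (hmK.trans this) hp (abs_nonneg _) (by positivity)
    have h4 : m ^ 2 * (|flowSpeed k (flow k s) - 1| / 2) ≤ K ^ 2 * (D * Real.exp (-s)) := by
      refine mul_le_mul (pow_le_pow_left₀ hm hmK 2) ?_ (by positivity) (by positivity)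
      linarith [abs_nonneg (flowSpeed k (flow k s) - 1)]
    linarith
  have hDK : 0 ≤ D * (K ^ 3 + K ^ 2) := by positivity
  have hDC : D * (K ^ 3 + K ^ 2) ≤ C := by
    have : 0 ≤ K ^ 2 := by positivity
    linarith
  have hcore := abs_convexComb_exp_sub_one_le (C := C) (ε := Real.exp (-s)) (t := t) (f := f)
    (u := trialSlope k (flow k s) - (flowSpeed k (flow k s) - 1) / 2)
    (v := K * trialSlope k (flow k s) - K ^ 2 * ((flowSpeed k (flow k s) - 1) / 2) -
      k * K / 2)
    (z := trialStep k t s 1) (w := trialStep k t s K - t * (k * K / 2)) hC1 hε0.le hε1 ht0.le ht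
    hf0 hf1 (hfε.trans (le_mul_of_one_le_left hε0.le hC1))
    (by
      have := hu 1 zero_le_one hK1
      rw [one_mul, one_pow, one_mul] at this
      exact this.trans (mul_le_mul_of_nonneg_right hDC hε0.le))
    (by
      have h3 := hu K (by linarith) le_rfl
      have h4 := abs_sub (K * trialSlope k (flow k s) -
        K ^ 2 * ((flowSpeed k (flow k s) - 1) / 2)) (k * K / 2)
      rw [abs_of_nonneg (by positivity : 0 ≤ (k : ℝ) * K / 2)] at h4
      have h5 : (k : ℝ) * K / 2 ≤ K ^ 2 := by nlinarith
      have h6 := mul_le_mul_of_nonneg_left hε1 hDK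
      linarith)
    (by
      have := hstep 1 zero_le_one hK1
      rw [one_mul, one_pow, one_mul] at this
      refine this.trans ?_
      gcongr)
    (by
      have := hstep K (by linarith) le_rfl
      rw [mul_sub t, sub_sub_sub_cancel_right]
      refine this.trans ?_
      gcongr)
    hfo
  have hpos : 0 < trial k t s := Real.exp_pos _
  rw [h1, h2, Nat.cast_add_one]
  -- by the characteristic equation the two summands have the weights `f` and `1 - f`
  have hfin : trial k t s * (f * Real.exp (trialStep k t s 1)) +
      Real.exp (-(t * (k * K / 2))) * (Real.exp (-s) ^ k * (1 - Real.exp (-s))) *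
        (trial k t s * (f ^ (k + 1) * Real.exp (trialStep k t s K))) - trial k t s =
      (f * Real.exp (trialStep k t s 1) + (1 - f) *
        Real.exp (trialStep k t s K - t * (k * K / 2)) - 1) * trial k t s := by
    rw [← hid, sub_eq_add_neg (trialStep k t s K), Real.exp_add]
    ring
  rw [hfin, abs_mul, abs_of_pos hpos]
  exact mul_le_mul_of_nonneg_right hcore hpos.le

end trial

/-! ### Asymptotics of the sums over runs -/

section runs

variable {k : ℕ}

lemma continuousOn_logRatio : ContinuousOn (logRatio k) (Set.Icc 0 1) := by
  have h : ∀ m : ℕ, ContinuousOn (fun y : ℝ => Real.log (1 + y ^ m)) (Set.Icc 0 1) := fun m =>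
    ContinuousOn.log (by fun_prop) fun y hy => by
      have := pow_nonneg hy.1 m
      positivity
  exact (h k).sub (h (k + 1))

lemma continuousOn_trialExponent : ContinuousOn (trialExponent k) (Set.Icc 0 1) := by
  have h : ∀ m : ℕ, ContinuousOn (fun y : ℝ => negDilog (y ^ m)) (Set.Icc 0 1) := fun m =>
    continuousOn_negDilog.comp (by fun_prop) fun y hy =>
      ⟨pow_nonneg hy.1 m, pow_le_one₀ hy.1 hy.2⟩
  exact (((h k).div_const _).sub ((h (k + 1)).div_const _)).add
    ((continuousOn_logRatio.pow 2).div_const 2)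

lemma continuousOn_trialLogAmplitude : ContinuousOn (trialLogAmplitude k) (Set.Icc 0 1) := by
  have h : ContinuousOn (fun y : ℝ => Real.log (flowDenom k y)) (Set.Icc 0 1) := by
    refine ContinuousOn.log ?_ fun y hy =>
      (zero_lt_one.trans_le (one_le_flowDenom hy.1 hy.2)).ne'
    unfold flowDenom
    fun_prop
  exact (continuousOn_logRatio.sub h).div_const 2

lemma tendsto_comp_flow_zero {g : ℝ → ℝ} (hg : ContinuousOn g (Set.Icc 0 1)) :
    Tendsto (fun s => g (flow k s)) (𝓝[>] 0) (𝓝 (g 1)) := by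
  refine (hg 1 ⟨zero_le_one, le_rfl⟩).tendsto.comp (tendsto_nhdsWithin_iff.2
    ⟨tendsto_flow_zero, ?_⟩)
  filter_upwards [self_mem_nhdsWithin] with s hs
  exact ⟨flow_nonneg (le_of_lt hs), flow_le_one (le_of_lt hs)⟩

lemma tendsto_comp_flow_atTop {g : ℝ → ℝ} (hg : ContinuousOn g (Set.Icc 0 1)) :
    Tendsto (fun s => g (flow k s)) atTop (𝓝 (g 0)) := by
  refine (hg 0 ⟨le_rfl, zero_le_one⟩).tendsto.comp (tendsto_nhdsWithin_iff.2
    ⟨tendsto_flow_atTop, ?_⟩)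
  filter_upwards [eventually_ge_atTop 0] with s hs
  exact ⟨flow_nonneg hs, flow_le_one hs⟩

lemma tendsto_trial_atTop (hk : 1 ≤ k) (t : ℝ) : Tendsto (trial k t) atTop (𝓝 1) := by
  have hk0 : k ≠ 0 := by omega
  have h := (Real.continuous_exp.tendsto _).comp
    (((tendsto_comp_flow_atTop (k := k) (continuousOn_trialExponent (k := k))).div_const t).add
      (tendsto_comp_flow_atTop (k := k) (continuousOn_trialLogAmplitude (k := k))))
  have h1 : trialExponent k 0 = 0 := by simp [trialExponent, logRatio, negDilog_zero, hk0]
  have h2 : trialLogAmplitude k 0 = 0 := by simp [trialLogAmplitude, logRatio, flowDenom, hk0]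
  rw [h1, h2, zero_div, add_zero, Real.exp_zero] at h
  exact h

lemma exp_neg_two_mul_le {z : ℝ} (h0 : 0 ≤ z) (h1 : z ≤ 1 / 2) : Real.exp (-(2 * z)) ≤ 1 - z := by
  have h2 : Real.exp (2 * z) * Real.exp (-(2 * z)) = 1 := by
    rw [← Real.exp_add, add_neg_cancel, Real.exp_zero]
  have h3 : 1 ≤ Real.exp (2 * z) * (1 - z) := by
    nlinarith [Real.add_one_le_exp (2 * z)]
  exact le_of_mul_le_mul_left (h2.trans_le h3) (Real.exp_pos _)

lemma realRunWeight_exp (t : ℝ) (j : ℕ) :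
    realRunWeight k (Real.exp (-t)) j = Real.exp (-(t * (k * (k + 1) / 2))) *
      (Real.exp (-(j * t)) ^ k * (1 - Real.exp (-(j * t)))) := by
  have h : (2 : ℝ) * runSize k j = 2 * (k * j) + k * (k + 1) := by
    exact_mod_cast two_mul_runSize k j
  rw [realRunWeight, ← mul_assoc, ← Real.exp_nat_mul, ← Real.exp_nat_mul, ← Real.exp_nat_mul,
    ← Real.exp_add]
  congr 2
  · linear_combination (-t / 2) * h
  · congr 1
    ring

/-- The sums over runs agree with the trial solution up to a factor `e ^ O(t)`: the trial
solution, corrected by the sum of the residuals, is a super- and a subsolution of the recursion. -/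
lemma exists_realRunSum_bound (hk : 1 ≤ k) : ∃ C, ∃ t₀, 0 < t₀ ∧ ∀ t, 0 < t → t ≤ t₀ →
    ∀ j : ℕ, 1 ≤ j →
    trial k t (j * t) * Real.exp (-(C * t)) ≤
      realRunSum k (realRunWeight k (Real.exp (-t))) j ∧
    realRunSum k (realRunWeight k (Real.exp (-t))) j ≤ trial k t (j * t) * Real.exp (C * t) := by
  obtain ⟨D, hD, t₁, ht₁, hres⟩ := exists_trial_residual_bound hk
  refine ⟨4 * D, min t₁ (min 1 (1 / (2 * D))), by positivity, fun t ht htt => ?_⟩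
  have htt₁ : t ≤ t₁ := htt.trans (min_le_left _ _)
  have ht1 : t ≤ 1 := htt.trans ((min_le_right _ _).trans (min_le_left _ _))
  have htD : t ≤ 1 / (2 * D) := htt.trans ((min_le_right _ _).trans (min_le_right _ _))
  rw [le_div_iff₀ (by positivity)] at htD
  set r := Real.exp (-t) with hr
  have hr0 : 0 < r := Real.exp_pos _
  have hr1 : t / 2 ≤ 1 - r := by
    have h1 := Real.add_one_le_exp t
    have h2 : r * Real.exp t = 1 := by rw [hr, ← Real.exp_add, neg_add_cancel, Real.exp_zero]
    nlinarith
  have hr1' : r < 1 := by linarith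
  have hpow : ∀ j : ℕ, Real.exp (-(j * t)) = r ^ j := fun j => by
    rw [hr, ← Real.exp_nat_mul]
    congr 1
    ring
  -- `δ` bounds the relative residual, and `κ j` is twice the sum of the `δ i` over `i ≥ j`
  set δ : ℕ → ℝ := fun j => D * (t ^ 2 * r ^ j) with hδ
  set κ : ℕ → ℝ := fun j => 2 * D * t ^ 2 * r ^ j / (1 - r) with hκ
  have hδ0 : ∀ j, 0 ≤ δ j := fun j => by positivity
  have hδ1 : ∀ j, δ j ≤ 1 / 2 := fun j => by
    have h1 : r ^ j ≤ 1 := pow_le_one₀ hr0.le hr1'.le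
    have h2 : t ^ 2 ≤ t * 1 := by nlinarith
    calc δ j ≤ D * (t * 1 * 1) := by simp only [hδ]; gcongr
      _ ≤ 1 / 2 := by linarith
  have hκδ : ∀ j, κ j = κ (j + 1) + 2 * δ j := fun j => by
    have : 1 - r ≠ 0 := by linarith
    simp only [hκ, hδ]
    field_simp
    ring
  have hκmono : ∀ i j, i ≤ j → κ j ≤ κ i := fun i j hij => by
    have : r ^ j ≤ r ^ i := pow_le_pow_of_le_one hr0.le hr1'.le hij
    have : 0 < 1 - r := by linarith
    simp only [hκ]
    gcongr
  have hκle : ∀ j, κ j ≤ 4 * D * t := fun j => by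
    have h1 : r ^ j ≤ 1 := pow_le_one₀ hr0.le hr1'.le
    simp only [hκ]
    rw [div_le_iff₀ (by linarith)]
    have h2 : 2 * D * t ^ 2 * r ^ j ≤ 2 * D * t ^ 2 * 1 := by gcongr
    have h3 := mul_le_mul_of_nonneg_left hr1 (by positivity : 0 ≤ 4 * D * t)
    linarith
  have hκlim : Tendsto κ atTop (𝓝 0) := by
    have h := ((tendsto_pow_atTop_nhds_zero_of_lt_one hr0.le hr1').const_mul
      (2 * D * t ^ 2)).div_const (1 - r)
    rwa [mul_zero, zero_div] at h
  have hhlim : Tendsto (fun j : ℕ => trial k t (j * t)) atTop (𝓝 1) :=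
    (tendsto_trial_atTop hk t).comp (tendsto_natCast_atTop_atTop.atTop_mul_const ht)
  set w := realRunWeight k r with hw
  have hw0 : ∀ j, 0 ≤ w j := realRunWeight_nonneg hr0.le hr1' k
  have hws := summable_abs_realRunWeight hk hr0.le hr1'
  have hpos : ∀ s, 0 < trial k t s := fun s => Real.exp_pos _
  have hres' : ∀ j : ℕ, 1 ≤ j → |trial k t ((j + 1 : ℕ) * t) +
      w j * trial k t ((j + (k + 1) : ℕ) * t) - trial k t (j * t)| ≤ δ j * trial k t (j * t) := by
    intro j hj
    have hj0 : (0 : ℝ) < j := by exact_mod_cast hj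
    have h := hres t ht htt₁ (j * t) (by positivity)
    rw [← realRunWeight_exp, hpow] at h
    convert h using 4
    · congr 1
      push_cast
      ring
    · congr 2
      push_cast
      ring
  intro j hj
  constructor
  · refine le_trans (mul_le_mul_of_nonneg_left (Real.exp_le_exp.2 (neg_le_neg (hκle j)))
      (hpos _).le) ?_
    refine le_of_backward_recursion (j₀ := 1) (m := k + 1)
      (u := fun j => trial k t (j * t) * Real.exp (-κ j)) (v := realRunSum k w)
      (b := fun _ => 1) (c := w) (by omega) (fun _ => zero_le_one) hw0 ?_ ?_ ?_
      (tendsto_realRunSum hws) hj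
    · intro j hj
      have h1 := (abs_le.1 (hres' j hj)).1
      have h2 := exp_neg_two_mul_le (hδ0 j) (hδ1 j)
      have h3 : Real.exp (-κ j) = Real.exp (-κ (j + 1)) * Real.exp (-(2 * δ j)) := by
        rw [← Real.exp_add, hκδ j]
        congr 1
        ring
      have h4 : Real.exp (-κ (j + 1)) ≤ Real.exp (-κ (j + (k + 1))) :=
        Real.exp_le_exp.2 (neg_le_neg (hκmono _ _ (by omega)))
      calc trial k t (j * t) * Real.exp (-κ j)
          = Real.exp (-κ (j + 1)) * (trial k t (j * t) * Real.exp (-(2 * δ j))) := by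
            rw [h3]
            ring
        _ ≤ Real.exp (-κ (j + 1)) * (trial k t (j * t) * (1 - δ j)) := by
            have := (hpos (j * t)).le
            gcongr
        _ ≤ Real.exp (-κ (j + 1)) * (trial k t ((j + 1 : ℕ) * t) +
            w j * trial k t ((j + (k + 1) : ℕ) * t)) := by
            refine mul_le_mul_of_nonneg_left ?_ (Real.exp_pos _).le
            linarith
        _ = 1 * (trial k t ((j + 1 : ℕ) * t) * Real.exp (-κ (j + 1))) +
            w j * (trial k t ((j + (k + 1) : ℕ) * t) * Real.exp (-κ (j + 1))) := by ring
        _ ≤ _ := by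
            have := hw0 j
            have := (hpos ((j + (k + 1) : ℕ) * t)).le
            gcongr
    · intro j _
      rw [one_mul, realRunSum_eq_add hws j, ← add_assoc]
    · have h := hhlim.mul ((Real.continuous_exp.tendsto _).comp hκlim.neg)
      simpa using h
  · refine le_trans ?_ (mul_le_mul_of_nonneg_left (Real.exp_le_exp.2 (hκle j)) (hpos _).le)
    refine le_of_backward_recursion (j₀ := 1) (m := k + 1)
      (v := fun j => trial k t (j * t) * Real.exp (κ j)) (u := realRunSum k w)
      (b := fun _ => 1) (c := w) (by omega) (fun _ => zero_le_one) hw0 ?_ ?_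
      (tendsto_realRunSum hws) ?_ hj
    · intro j _
      rw [one_mul, realRunSum_eq_add hws j, ← add_assoc]
    · intro j hj
      have h1 := (abs_le.1 (hres' j hj)).2
      have h2 : 1 + δ j ≤ Real.exp (2 * δ j) := by
        have := Real.add_one_le_exp (2 * δ j)
        linarith [hδ0 j]
      have h4 : Real.exp (κ (j + (k + 1))) ≤ Real.exp (κ (j + 1)) :=
        Real.exp_le_exp.2 (hκmono _ _ (by omega))
      calc 1 * (trial k t ((j + 1 : ℕ) * t) * Real.exp (κ (j + 1))) +
            w j * (trial k t ((j + (k + 1) : ℕ) * t) * Real.exp (κ (j + (k + 1))))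
          ≤ 1 * (trial k t ((j + 1 : ℕ) * t) * Real.exp (κ (j + 1))) +
            w j * (trial k t ((j + (k + 1) : ℕ) * t) * Real.exp (κ (j + 1))) := by
            have := hw0 j
            have := (hpos ((j + (k + 1) : ℕ) * t)).le
            gcongr
        _ = Real.exp (κ (j + 1)) * (trial k t ((j + 1 : ℕ) * t) +
            w j * trial k t ((j + (k + 1) : ℕ) * t)) := by ring
        _ ≤ Real.exp (κ (j + 1)) * (trial k t (j * t) * (1 + δ j)) := by
            refine mul_le_mul_of_nonneg_left ?_ (Real.exp_pos _).le
            linarith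
        _ ≤ Real.exp (κ (j + 1)) * (trial k t (j * t) * Real.exp (2 * δ j)) := by
            have := (hpos (j * t)).le
            gcongr
        _ = trial k t (j * t) * Real.exp (κ j) := by
            rw [hκδ j, Real.exp_add]
            ring
    · have h := hhlim.mul ((Real.continuous_exp.tendsto _).comp hκlim)
      simpa using h

lemma trialExponent_one (hk : 1 ≤ k) :
    trialExponent k 1 = Real.pi ^ 2 / (12 * (k * (k + 1))) := by
  have hk0 : (k : ℝ) ≠ 0 := by positivity
  simp only [trialExponent, logRatio, one_pow, sub_self, negDilog_one]
  field_simp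
  ring

lemma exp_trialLogAmplitude_one : Real.exp (trialLogAmplitude k 1) = (√2)⁻¹ := by
  have h : trialLogAmplitude k 1 = -(Real.log 2 / 2) := by
    simp only [trialLogAmplitude, logRatio, flowDenom, one_pow]
    rw [show (1 : ℝ) + (k + 1) * 1 - k * 1 = 2 by ring]
    ring
  rw [h, Real.exp_neg, Real.sqrt_eq_rpow, Real.rpow_def_of_pos two_pos]
  congr 2
  ring

lemma tendsto_const_mul_nhdsGT_zero {m : ℝ} (hm : 0 < m) :
    Tendsto (fun t : ℝ => m * t) (𝓝[>] 0) (𝓝[>] 0) := by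
  refine tendsto_nhdsWithin_iff.2 ⟨?_, ?_⟩
  · have h := (tendsto_id (x := 𝓝 (0 : ℝ))).const_mul m
    rw [mul_zero] at h
    exact h.mono_left nhdsWithin_le_nhds
  · filter_upwards [self_mem_nhdsWithin] with t ht
    exact mul_pos hm ht

/-- The exponent of the trial solution is stationary at the origin, because `logRatio` vanishes
at `y = 1`. -/
lemma tendsto_trialExponent_sub_div (hk : 1 ≤ k) {m : ℝ} (hm : 0 < m) :
    Tendsto (fun t : ℝ => (trialExponent k (flow k (m * t)) - trialExponent k 1) / t)
      (𝓝[>] 0) (𝓝 0) := by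
  have h0 : logRatio k 1 = 0 := by simp [logRatio]
  have hL := tendsto_comp_flow_zero (k := k) (continuousOn_logRatio (k := k))
  rw [h0] at hL
  have hmt := tendsto_const_mul_nhdsGT_zero hm
  rw [Metric.tendsto_nhds]
  intro ε hε
  have h1 := (Metric.tendsto_nhds.1 hL) (ε / m) (by positivity)
  obtain ⟨b, hb, hb'⟩ := mem_nhdsGT_iff_exists_Ioo_subset.1 h1
  have hb0 : (0 : ℝ) < b := hb
  filter_upwards [self_mem_nhdsWithin, hmt (Ioo_mem_nhdsGT hb0)] with t ht hmb
  have ht0 : (0 : ℝ) < t := ht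
  have hmt0 : 0 < m * t := hmb.1
  have hcont : ContinuousOn (fun s => trialExponent k (flow k s)) (Set.Icc 0 (m * t)) :=
    continuousOn_trialExponent.comp (continuousOn_flow.mono Set.Icc_subset_Ici_self)
      fun s hs => ⟨flow_nonneg hs.1, flow_le_one hs.1⟩
  obtain ⟨c, hc, hce⟩ := exists_hasDerivAt_eq_slope _ _ hmt0 hcont
    fun s hs => hasDerivAt_trialExponent_flow hk hs.1
  rw [flow_zero, sub_zero] at hce
  have h2 : (trialExponent k (flow k (m * t)) - trialExponent k 1) / t =
      m * -logRatio k (flow k c) := by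
    rw [hce]
    field_simp
  have h3 : dist (logRatio k (flow k c)) 0 < ε / m := hb' ⟨hc.1, hc.2.trans hmb.2⟩
  rw [Real.dist_eq, sub_zero] at h3 ⊢
  rw [h2, abs_mul, abs_neg, abs_of_pos hm]
  rwa [lt_div_iff₀' hm] at h3

lemma tendsto_trial_div (hk : 1 ≤ k) {m : ℝ} (hm : 0 < m) :
    Tendsto (fun t : ℝ => trial k t (m * t) / Real.exp (Real.pi ^ 2 / (12 * (k * (k + 1) * t))))
      (𝓝[>] 0) (𝓝 (√2)⁻¹) := by
  have hmt := tendsto_const_mul_nhdsGT_zero hm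
  have h := (Real.continuous_exp.tendsto _).comp ((tendsto_trialExponent_sub_div hk hm).add
    ((tendsto_comp_flow_zero (k := k) (continuousOn_trialLogAmplitude (k := k))).comp hmt))
  rw [zero_add, exp_trialLogAmplitude_one] at h
  refine h.congr' ?_
  filter_upwards [self_mem_nhdsWithin] with t ht
  have ht0 : t ≠ 0 := ne_of_gt ht
  have hk0 : (k : ℝ) ≠ 0 := by positivity
  rw [Function.comp_apply, Function.comp_apply, trialExponent_one hk, trial, ← Real.exp_sub]
  congr 1
  field_simp
  ring

lemma tendsto_realRunSum_div (hk : 1 ≤ k) {m : ℕ} (hm : 1 ≤ m) :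
    Tendsto (fun t : ℝ => realRunSum k (realRunWeight k (Real.exp (-t))) m /
      Real.exp (Real.pi ^ 2 / (12 * (k * (k + 1) * t)))) (𝓝[>] 0) (𝓝 (√2)⁻¹) := by
  obtain ⟨C, t₀, ht₀, hC⟩ := exists_realRunSum_bound hk
  have hm0 : (0 : ℝ) < m := by exact_mod_cast hm
  have h := tendsto_trial_div hk hm0
  have hexp : ∀ c : ℝ, Tendsto (fun t : ℝ => Real.exp (c * t)) (𝓝[>] 0) (𝓝 1) := by
    intro c
    have h1 : Tendsto (fun t : ℝ => Real.exp (c * t)) (𝓝 0) (𝓝 (Real.exp (c * 0))) :=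
      Continuous.tendsto (by fun_prop) 0
    rw [mul_zero, Real.exp_zero] at h1
    exact h1.mono_left nhdsWithin_le_nhds
  have hlo := h.mul (hexp (-C))
  have hhi := h.mul (hexp C)
  rw [mul_one] at hlo hhi
  have hev : ∀ᶠ t : ℝ in 𝓝[>] 0, t ∈ Set.Ioo 0 t₀ := Ioo_mem_nhdsGT ht₀
  refine tendsto_of_tendsto_of_tendsto_of_le_of_le' hlo hhi ?_ ?_
  · filter_upwards [hev] with t ht
    rw [div_mul_eq_mul_div, neg_mul]
    exact div_le_div_of_nonneg_right (hC t ht.1 ht.2.le m hm).1 (Real.exp_pos _).le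
  · filter_upwards [hev] with t ht
    rw [div_mul_eq_mul_div]
    exact div_le_div_of_nonneg_right (hC t ht.1 ht.2.le m hm).2 (Real.exp_pos _).le

/-- The two summands of the factor `H` each contribute `1 / √2`. -/
lemma tendsto_realRunFactor (hk : 1 ≤ k) :
    Tendsto (fun t : ℝ => realRunFactor k (Real.exp (-t)) /
      (√2 * Real.exp (Real.pi ^ 2 / (12 * (k * (k + 1) * t))))) (𝓝[>] 0) (𝓝 1) := by
  have hexp : Tendsto (fun t : ℝ => Real.exp (-t) ^ runSize k 0) (𝓝[>] 0) (𝓝 1) := by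
    have h1 : Tendsto (fun t : ℝ => Real.exp (-t) ^ runSize k 0) (𝓝 0)
        (𝓝 (Real.exp (-0) ^ runSize k 0)) := Continuous.tendsto (by fun_prop) 0
    rw [neg_zero, Real.exp_zero, one_pow] at h1
    exact h1.mono_left nhdsWithin_le_nhds
  have h := ((tendsto_realRunSum_div hk le_rfl).add (hexp.mul
    (tendsto_realRunSum_div hk (m := k + 1) (by omega)))).div_const √2
  have h2 : ((√2)⁻¹ + 1 * (√2)⁻¹) / √2 = 1 := by
    have h3 : √2 * √2 = (2 : ℝ) := Real.mul_self_sqrt zero_le_two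
    have h4 : √2 ≠ 0 := by positivity
    field_simp
    rw [pow_two, h3]
    norm_num
  rw [h2] at h
  refine h.congr fun t => ?_
  rw [realRunFactor]
  have h4 : √2 ≠ 0 := by positivity
  have h5 := (Real.exp_pos (Real.pi ^ 2 / (12 * (k * (k + 1) * t)))).ne'
  field_simp

end runs

/-! ### The number of lower run overpartitions -/

theorem theorem1p2 (k : ℕ) (hk : 1 ≤ k) :
    Asymptotics.IsEquivalent Filter.atTop
      (fun n : ℕ => (numRunOverpartitions k n : ℝ))
      (fun n : ℕ => 1 / (2 * Real.sqrt 6 * (n : ℝ)) *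
        Real.sqrt (1 + 1 / (2 * (k : ℝ) * ((k : ℝ) + 1))) *
        Real.exp (Real.pi *
          Real.sqrt (2 / 3 * (1 + 1 / (2 * (k : ℝ) * ((k : ℝ) + 1))) * (n : ℝ)))) := by
  have hpi := Real.pi_pos
  have hk0 : (0 : ℝ) < k := by exact_mod_cast hk
  set x : ℝ := 1 + 1 / (2 * (k : ℝ) * ((k : ℝ) + 1)) with hx
  have hx0 : 0 < x := by positivity
  set c : ℝ := Real.pi ^ 2 / 6 * x with hc
  have hc0 : 0 < c := by positivity
  set a : ℕ → ℝ := fun n => (numRunOverpartitions k n : ℝ) with ha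
  have hreal : ∀ r : ℝ, 0 ≤ r → r < 1 → realPowerSum a r = partitionSum r * realRunFactor k r :=
    fun r h0 h1 => (hasSum_numRunOverpartitions_real hk h0 h1).tsum_eq
  have hcomplex : ∀ q : ℂ, ‖q‖ < 1 → powerSum a q = avoidGenFun ∅ q * runFactor k q := by
    intro q hq
    rw [← (hasSum_numRunOverpartitions hk hq).tsum_eq, powerSum]
    simp [ha]
  have hr1 : ∀ t : ℝ, 0 < t → Real.exp (-t) < 1 := fun t ht =>
    Real.exp_lt_one_iff.2 (neg_neg_of_pos ht)
  have hasym : Tendsto (fun t : ℝ => realPowerSum a (Real.exp (-t)) /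
      (√(t / Real.pi) * Real.exp (c / t))) (𝓝[>] 0) (𝓝 1) := by
    have h := tendsto_partitionSum.mul (tendsto_realRunFactor hk)
    rw [one_mul] at h
    refine h.congr' ?_
    filter_upwards [self_mem_nhdsWithin] with t ht
    have ht0 : (0 : ℝ) < t := ht
    rw [hreal _ (Real.exp_pos _).le (hr1 t ht0), div_mul_div_comm]
    congr 1
    have h1 : √(t / Real.pi) = √(t / (2 * Real.pi)) * √2 := by
      rw [← Real.sqrt_mul (by positivity)]
      congr 1
      field_simp
    have h2 : c / t = Real.pi ^ 2 / (6 * t) + Real.pi ^ 2 / (12 * (k * (k + 1) * t)) := by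
      rw [hc, hx]
      field_simp
      ring
    rw [h1, h2, Real.exp_add]
    ring
  obtain ⟨b, hb, t₀, ht₀, hdecay⟩ := norm_genFun_le hk
  have main := tendsto_coeff_of_growth (a := a) (c := c) (fun m => Nat.cast_nonneg _)
    (fun r h0 h1 => (hasSum_numRunOverpartitions_real hk h0.le h1).summable) hc0 hasym hb ht₀
    (K := 2) (fun t h0 h1 θ hθ => by
      rw [hreal _ (Real.exp_pos _).le (hr1 t h0), hcomplex _ (by
        rw [norm_exp_neg_add_mul_I]
        exact hr1 t h0)]
      exact hdecay t h0 h1 θ hθ)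
  refine Asymptotics.isEquivalent_of_tendsto_one (main.congr fun n => ?_)
  rw [Pi.div_apply]
  congr 1
  have h6 : √(6 : ℝ) ≠ 0 := by positivity
  have hsc : √c = Real.pi * √x / √6 := by
    rw [hc, Real.sqrt_mul (by positivity), Real.sqrt_div (by positivity), Real.sqrt_sq hpi.le]
    ring
  have hscn : 2 * √(c * n) = Real.pi * √(2 / 3 * x * n) := by
    rw [show 2 * √(c * n) = √(2 ^ 2) * √(c * n) by rw [Real.sqrt_sq zero_le_two],
      show Real.pi * √(2 / 3 * x * n) = √(Real.pi ^ 2) * √(2 / 3 * x * n) by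
        rw [Real.sqrt_sq hpi.le],
      ← Real.sqrt_mul (by positivity), ← Real.sqrt_mul (by positivity), hc]
    congr 1
    ring
  rw [hscn, hsc]
  congr 1
  rcases eq_or_ne (n : ℝ) 0 with hn | hn
  · simp [hn]
  · field_simp
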